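/- Let $K$ be an imaginary quadratic field with discriminant $D<0$ (so $K=\mathbb{Q}(\sqrt D)$), class number $h$ and $w$ roots of unity. For $r>0$, functions $f_n(s)$ are said to converge in the mean with index $r$ towards $f(s)$ in $[\alpha,\beta]$ (where $\beta=\infty$ is allowed) if for all real $\alpha<\alpha_1<\beta_1<\beta$ $$\limsup_{T\to\infty}\frac1T\int_1^T\int_{\alpha_1}^{\beta_1}|f(\sigma+it)-f_n(\sigma+it)|^r\,d\sigma\,dt\longrightarrow 0\qquad(n\to\infty).$$ Let $p_n$ be the $n$-th prime number and $\mathfrak N$ the norm of ideals of the ring of integers of $K$. (1) Let $\chi$ be any character of the ideal class group of $K$. The Hecke $L$-function $L(s,\chi)=\sum_{\mathfrak n}\chi(\mathfrak n)\mathfrak N(\mathfrak n)^{-s}$ (sum over nonzero integral ideals, absolutely convergent for $\operatorname{Re}s>1$) has an analytic continuation to $\mathbb{C}\setminus\{1\}$, and the truncated Euler products $$L_n(s,\chi)=\prod_{\mathfrak N(\mathfrak p)\le p_n}\left(1-\chi(\mathfrak p)\mathfrak N(\mathfrak p)^{-s}\right)^{-1}$$ (product over nonzero prime ideals) converge in the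 mean with index $2$ towards $L(s,\chi)$ in $[1/2,\infty]$. (2) Let $Q(x,y)=ax^2+bxy+cy^2$ be a positive definite quadratic form with integer coefficients and discriminant $b^2-4ac=D$. The Epstein zeta function $E(s,Q)=\sum_{(m,n)\ne(0,0)}Q(m,n)^{-s}$ (sum over integers $m,n$, absolutely convergent for $\operatorname{Re}s>1$) has an analytic continuation to $\mathbb{C}\setminus\{1\}$. Let $\mathfrak a_Q$ be any nonzero integral ideal in the ideal class corresponding to $Q$, that is, in the class of the ideal generated by $a$ and $\frac{-b+\sqrt D}{2}$, for either choice of $\sqrt D$. Let $\chi_1,\dots,\chi_J$ be representatives of the characters of the class group up to complex conjugation (every character equals $\chi_j$ or $\overline{\chi_j}$ for exactly one $j$), and put $a_j=\frac wh\chi_j(\mathfrak a_Q)$ if $\chi_j$ is real and $a_j=\frac{2w}h\operatorname{Re}\chi_j(\mathfrak a_Q)$ otherwise. Then the functions $$E_n(s,Q)=\sum_{j=1}^J a_jL_n(s,\chi_j)$$ converge in the mean with index $2$ towards $E(s,Q)$ in $[1/2,\infty]$. -/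

import Mathlib

open Filter Topology MeasureTheory
open scoped NumberField nonZeroDivisors

noncomputable section

namespace EpsteinZeta

/-! ### Convergence in the mean -/

/-- The functions `fn n` converge in the mean with index `r` towards `f` in `[α, β]`: for all real
`α < α₁ < β₁ < β`, the upper mean value (`T → ∞`) of `∫_{α₁}^{β₁} |f(σ+it) - fn n (σ+it)|^r dσ`
over `1 ≤ t ≤ T` tends to `0` as `n → ∞`. All quantities are taken in `[0, ∞]`. -/
def ConvergesInMean (r : ℝ) (α β : EReal) (fn : ℕ → ℂ → ℂ) (f : ℂ → ℂ) : Prop :=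
  ∀ α₁ β₁ : ℝ, α < (α₁ : EReal) → α₁ < β₁ → (β₁ : EReal) < β →
    Tendsto
      (fun n : ℕ => limsup
        (fun T : ℝ => ENNReal.ofReal (1 / T) *
          ∫⁻ t in Set.Icc (1 : ℝ) T, ∫⁻ σ in Set.Icc α₁ β₁,
            ‖f ((σ : ℂ) + (t : ℂ) * Complex.I) - fn n ((σ : ℂ) + (t : ℂ) * Complex.I)‖ₑ ^ r)
        atTop)
      atTop (𝓝 0)

/-! ### Analytic continuation -/

/-- `F` is holomorphic on `ℂ ∖ {1}`, and for `Re s > 1` the series `∑ i, u i s` converges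
absolutely with sum `F s`. -/
def IsContinuation {ι : Type*} (u : ι → ℂ → ℂ) (F : ℂ → ℂ) : Prop :=
  DifferentiableOn ℂ F {1}ᶜ ∧ ∀ s : ℂ, 1 < s.re → HasSum (fun i => u i s) (F s)

/-- The continuation is unique (away from the point `1`, where its value is irrelevant). -/
theorem IsContinuation.eqOn {ι : Type*} {u : ι → ℂ → ℂ} {F G : ℂ → ℂ}
    (hF : IsContinuation u F) (hG : IsContinuation u G) : Set.EqOn F G {1}ᶜ := by
  have hconn : IsPreconnected ({1}ᶜ : Set ℂ) :=
    (isConnected_compl_singleton_of_one_lt_rank (by simp) (1 : ℂ)).isPreconnected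
  have ho : IsOpen ({1}ᶜ : Set ℂ) := isOpen_compl_singleton
  refine (hF.1.analyticOnNhd ho).eqOn_of_preconnected_of_eventuallyEq (hG.1.analyticOnNhd ho)
    hconn (z₀ := 2) (by norm_num) ?_
  have h2 : {s : ℂ | 1 < s.re} ∈ 𝓝 (2 : ℂ) :=
    (isOpen_lt continuous_const Complex.continuous_re).mem_nhds (by norm_num)
  filter_upwards [h2] with s hs using (hF.2 s hs).unique (hG.2 s hs)

open Classical in
/-- The analytic continuation to `ℂ ∖ {1}` of the series `∑ i, u i s` (if there is none, the
series itself). -/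
def continuation {ι : Type*} (u : ι → ℂ → ℂ) : ℂ → ℂ :=
  if h : ∃ F : ℂ → ℂ, IsContinuation u F then h.choose else fun s => ∑' i, u i s

/-! ### Hecke `L`-functions of class group characters -/

section Hecke

variable {K : Type*} [Field K] [NumberField K]

/-- The term `χ(𝔫) N(𝔫)^{-s}` belonging to a nonzero integral ideal `𝔫`. -/
def heckeTerm (χ : ClassGroup (𝓞 K) →* ℂˣ) (𝔫 : (Ideal (𝓞 K))⁰) (s : ℂ) : ℂ :=
  (χ (ClassGroup.mk0 𝔫) : ℂ) * (Ideal.absNorm (𝔫 : Ideal (𝓞 K)) : ℂ) ^ (-s)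

/-- The Hecke `L`-function `L(s, χ)`: the analytic continuation of `∑ χ(𝔫) N(𝔫)^{-s}`. -/
def heckeL (χ : ClassGroup (𝓞 K) →* ℂˣ) : ℂ → ℂ := continuation (heckeTerm χ)

/-- A nonzero prime ideal, as a nonzero ideal. -/
def primeIdeal (v : IsDedekindDomain.HeightOneSpectrum (𝓞 K)) : (Ideal (𝓞 K))⁰ :=
  ⟨v.asIdeal, mem_nonZeroDivisors_of_ne_zero v.ne_bot⟩

variable (K) in
theorem finite_primes_absNorm_le (x : ℕ) :
    {v : IsDedekindDomain.HeightOneSpectrum (𝓞 K) | Ideal.absNorm v.asIdeal ≤ x}.Finite :=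
  Set.Finite.preimage (f := fun v : IsDedekindDomain.HeightOneSpectrum (𝓞 K) => v.asIdeal)
    (fun _ _ _ _ h => IsDedekindDomain.HeightOneSpectrum.ext h)
    (Ideal.finite_setOfPred_absNorm_le (S := 𝓞 K) x)

/-- The `n`-th prime number, `n = 1, 2, 3, …`. -/
def nthPrime (n : ℕ) : ℕ := Nat.nth Nat.Prime (n - 1)

/-- The truncated Euler product `L_n(s, χ)`, over the nonzero prime ideals `𝔭` with
`N(𝔭) ≤ p_n`. -/
def truncL (χ : ClassGroup (𝓞 K) →* ℂˣ) (n : ℕ) (s : ℂ) : ℂ :=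
  ∏ v ∈ (finite_primes_absNorm_le K (nthPrime n)).toFinset, (1 - heckeTerm χ (primeIdeal v) s)⁻¹

/-- The complex conjugate of a character. -/
def conjChar (χ : ClassGroup (𝓞 K) →* ℂˣ) : ClassGroup (𝓞 K) →* ℂˣ :=
  (Units.map (starRingEnd ℂ).toMonoidHom).comp χ

end Hecke

/-! ### Binary quadratic forms and their Epstein zeta functions -/

/-- The binary quadratic form `a x² + b x y + c y²` with integer coefficients. -/
structure BinaryForm where
  a : ℤ
  b : ℤ
  c : ℤ

namespace BinaryForm

/-- The value `Q(x, y)`. -/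
def eval {R : Type*} [CommRing R] (Q : BinaryForm) (x y : R) : R :=
  (Q.a : R) * x ^ 2 + (Q.b : R) * x * y + (Q.c : R) * y ^ 2

/-- The discriminant `b² - 4ac`. -/
def discr (Q : BinaryForm) : ℤ := Q.b ^ 2 - 4 * Q.a * Q.c

/-- `Q` is positive definite. -/
def PosDef (Q : BinaryForm) : Prop := ∀ x y : ℝ, (x, y) ≠ 0 → 0 < Q.eval x y

theorem PosDef.a_pos {Q : BinaryForm} (hQ : Q.PosDef) : 0 < Q.a := by
  have h := hQ 1 0 (by simp)
  simpa [eval] using h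

/-- The term `Q(m, n)^{-s}` belonging to a pair of integers `(m, n) ≠ (0, 0)`. -/
def epsteinTerm (Q : BinaryForm) (v : {v : ℤ × ℤ // v ≠ 0}) (s : ℂ) : ℂ :=
  ((Q.eval v.1.1 v.1.2 : ℤ) : ℂ) ^ (-s)

/-- The Epstein zeta function `E(s, Q)`: the analytic continuation of `∑' Q(m, n)^{-s}`. -/
def epsteinE (Q : BinaryForm) : ℂ → ℂ := continuation Q.epsteinTerm

variable {K : Type*} [Field K] [NumberField K]

/-- The integral ideal of `K = ℚ(δ)`, `δ = √D`, `D = b² - 4ac`, attached to the positive definite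
form `Q` by the classical correspondence: it is generated by `a` and `(-b + √D) / 2`. -/
def ideal (Q : BinaryForm) (hQ : Q.PosDef) (δ : K) : (Ideal (𝓞 K))⁰ :=
  ⟨Ideal.span {x : 𝓞 K | (x : K) = (Q.a : K) ∨ (x : K) = (-(Q.b : K) + δ) / 2}, by
    refine mem_nonZeroDivisors_of_ne_zero fun h => ?_
    have hmem : (Q.a : 𝓞 K) ∈
        Ideal.span {x : 𝓞 K | (x : K) = (Q.a : K) ∨ (x : K) = (-(Q.b : K) + δ) / 2} :=
      Ideal.subset_span (Or.inl (by simp))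
    rw [h] at hmem
    have h0 : (Q.a : 𝓞 K) = 0 := by simpa using hmem
    exact hQ.a_pos.ne' (by exact_mod_cast h0)⟩

end BinaryForm

section Combination

variable {K : Type*} [Field K] [NumberField K]

/-- `χ 1, …, χ J` are representatives of the class group characters up to complex conjugation:
each character is `χ j` or the conjugate of `χ j` for exactly one `j`. -/
def IsRepresentatives {J : ℕ} (χ : Fin J → (ClassGroup (𝓞 K) →* ℂˣ)) : Prop :=
  ∀ ψ : ClassGroup (𝓞 K) →* ℂˣ, ∃! j : Fin J, ψ = χ j ∨ ψ = conjChar (χ j)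

open Classical in
/-- The coefficient of `L(s, χ)` in `E(s, Q)`, where `𝔞` is an integral ideal in the class
corresponding to `Q`: with `w` roots of unity and class number `h`, it is `(w / h) χ(𝔞)` if `χ` is
real and `(2 w / h) Re χ(𝔞)` if it is not. -/
def coeff (𝔞 : (Ideal (𝓞 K))⁰) (χ : ClassGroup (𝓞 K) →* ℂˣ) : ℂ :=
  if conjChar χ = χ then
    (NumberField.Units.torsionOrder K : ℂ) / (NumberField.classNumber K : ℂ) *
      (χ (ClassGroup.mk0 𝔞) : ℂ)
  else
    2 * (NumberField.Units.torsionOrder K : ℂ) / (NumberField.classNumber K : ℂ) *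
      (((χ (ClassGroup.mk0 𝔞) : ℂ).re : ℝ) : ℂ)

/-- `E_n(s, Q) = ∑ a_j L_n(s, χ_j)`. -/
def truncE {J : ℕ} (𝔞 : (Ideal (𝓞 K))⁰) (χ : Fin J → (ClassGroup (𝓞 K) →* ℂˣ)) (n : ℕ)
    (s : ℂ) : ℂ :=
  ∑ j : Fin J, coeff 𝔞 (χ j) * truncL (χ j) n s

end Combination

end EpsteinZeta

end

/-!
The argument is analytic for a class of Dirichlet series of degree two (`SelfDual`), and arithmetic
only in showing that the Hecke `L`-functions belong to it.

*Continuation.* The theta series `κ + ∑ a_m e^{-l m z}` of a class group character is a linear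
combination of theta series of binary quadratic forms. Poisson summation (`formTheta_inv`) makes it
a modular form of weight one with respect to `z ↦ 1 / z` (`selfDual_idealChar`), and its Mellin
transform continues `F(s) = ∑ a_m m^{-s}` to `ℂ ∖ {1}` (`SelfDual.exists_continuation`).

*Mean squares.* Let `∑ b_m m^{-s}` converge absolutely for `Re s > 0`. Along the ray
`z = x (1 + i v)`, the Mellin transform of `∑ (a_m - b_m) e^{-l m z}`, corrected by a multiple of
`e^{-l z} / z`, equals `(l (1 + i v))^{-s} Γ(s)` times `F(s) - ∑ b_m m^{-s}` without its pole, for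
all `Re s > 0` (`SelfDual.mellin_thetaDiff`). For `t / 2 ≤ v ≤ t` this gamma factor is at least of
size `t^{-1/2}` (`exists_le_norm_sq_rayFactor`). So Plancherel's inequality
(`lintegral_enorm_sq_mellin_le`), integrated over the slopes `v ∈ (0, T)`, bounds the mean square of
`F - ∑ b_m m^{-s}` over `1 ≤ t ≤ T` by a mean square of the theta difference over a sector
(`SelfDual.exists_lintegral_vertical_le`). In the part `|z| ≥ 1` of the sector, Parseval's identity
on the lines `Re z = x` gives `∑ |a_m - b_m|² m^{-2α}`; the part `|z| < 1` is mapped by `z ↦ 1 / z`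
to a region where the weight decreases, and contributes nothing in the limit
(`SelfDual.exists_sectorAvg_le`). Hence approximation of the coefficients in the square mean implies
convergence in the mean (`SelfDual.convergesInMean`). No approximate functional equation and no
bound for `F` in the critical strip is needed.

*Euler products.* The truncated Euler product is the Dirichlet series over the ideals all of whose
prime factors have norm at most `p_n` (`truncL_eq_dirichletSeries`). Its coefficients are those of
`L(s, χ)` for `m ≤ p_n`, and in general bounded by the number of ideals of norm `m`, which is
`O(m^ε)` (`exists_card_idealOfNorm_le`). This gives the first part (`convergesInMean_truncL`).

*Epstein zeta functions.* The ideal of `Q` has a `ℤ`-basis with norm form `Q` (`exists_idealBasis`),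
so `E(s, Q)` is `w` times the zeta function of an ideal class (`hasSum_lattice`), which is a
combination of all `L(s, χ)` by orthogonality (`sum_character_mul_heckeL`). An ideal times its
conjugate is principal (`mul_conjIdeal`), so conjugate characters have the same `L`-function
(`heckeL_conjChar`) and can be grouped. Convergence in the mean is linear (`ConvergesInMean.sum`).
-/

noncomputable section

namespace EpsteinZeta
open FourierTransform Set

/-! ### Plancherel for the Mellin transform -/

theorem integral_fourier_smul_eq_flip {f g : ℝ → ℂ} (hf : Integrable f) (hg : Integrable g) :
    ∫ x, 𝓕 g x • f x = ∫ x, g x • 𝓕 f x := by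
  have := VectorFourier.integral_fourierIntegral_smul_eq_flip (L := innerₗ ℝ) (f := g) (g := f)
    Real.continuous_fourierChar continuous_inner hg hf
  simpa only [flip_innerₗ] using! this

/-- The Fourier integral of a function in `L¹ ∩ L²` represents its Fourier transform in `L²`. -/
theorem fourier_toLp_ae_eq {f : ℝ → ℂ} (h1 : Integrable f) (h2 : MemLp f 2) :
    (𝓕 (h2.toLp f) : Lp ℂ 2 (volume : Measure ℝ)) =ᵐ[volume] 𝓕 f := by
  have hcont : Continuous (𝓕 f) :=
    VectorFourier.fourierIntegral_continuous Real.continuous_fourierChar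
      continuous_inner h1
  refine ae_eq_of_integral_contDiff_smul_eq
    ((Lp.memLp _).locallyIntegrable (by norm_num)) hcont.locallyIntegrable fun g hg hgc => ?_
  have hgc' : HasCompactSupport (fun x => (g x : ℂ)) := hgc.comp_left (g := ((↑) : ℝ → ℂ)) rfl
  have hg' : ContDiff ℝ (⊤ : ℕ∞) (fun x => (g x : ℂ)) := Complex.ofRealCLM.contDiff.comp hg
  set φ : SchwartzMap ℝ ℂ := hgc'.toSchwartzMap hg'
  have hφ : ∀ x, φ x = g x := fun x => rfl
  have key := congrArg (fun T => T φ) (Lp.fourier_toTemperedDistribution_eq (h2.toLp f))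
  simp only [TemperedDistribution.fourier_apply, Lp.toTemperedDistribution_apply] at key
  have e1 : ∫ x, g x • (𝓕 (h2.toLp f) : Lp ℂ 2 (volume : Measure ℝ)) x
      = ∫ x, φ x • (𝓕 (h2.toLp f) : Lp ℂ 2 (volume : Measure ℝ)) x := by
    simp [hφ]
  have e2 : ∫ x, g x • 𝓕 f x = ∫ x, φ x • 𝓕 f x := by simp [hφ]
  rw [e1, e2, ← key, ← integral_fourier_smul_eq_flip h1 φ.integrable]
  refine integral_congr_ae ?_
  filter_upwards [h2.coeFn_toLp] with x hx
  rw [hx, SchwartzMap.fourier_coe]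

theorem lintegral_enorm_sq_fourier_le {f : ℝ → ℂ} (h1 : Integrable f) :
    ∫⁻ x, ‖𝓕 f x‖ₑ ^ (2 : ℝ) ≤ ∫⁻ x, ‖f x‖ₑ ^ (2 : ℝ) := by
  by_cases htop : ∫⁻ x, ‖f x‖ₑ ^ (2 : ℝ) = ⊤
  · rw [htop]; exact le_top
  have h2 : MemLp f 2 := by
    refine ⟨h1.1, ?_⟩
    rw [eLpNorm_lt_top_iff_lintegral_rpow_enorm_lt_top (by norm_num) (by norm_num)]
    simpa using lt_top_iff_ne_top.2 htop
  have hn : ‖(𝓕 (h2.toLp f) : Lp ℂ 2 (volume : Measure ℝ))‖ₑ = ‖h2.toLp f‖ₑ := by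
    rw [enorm_eq_iff_norm_eq]; exact Lp.norm_fourier_eq _
  rw [Lp.enorm_def, Lp.enorm_def, eLpNorm_congr_ae (fourier_toLp_ae_eq h1 h2),
    eLpNorm_congr_ae h2.coeFn_toLp, eLpNorm_eq_lintegral_rpow_enorm_toReal (by norm_num) (by norm_num),
    eLpNorm_eq_lintegral_rpow_enorm_toReal (by norm_num) (by norm_num)] at hn
  have := ENNReal.rpow_left_injective (x := 1 / (2 : ENNReal).toReal) (by norm_num) hn
  simp only [ENNReal.toReal_ofNat] at this
  exact this.le

/-- Plancherel's theorem on a vertical line, as an inequality for Mellin transforms. -/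
theorem lintegral_enorm_sq_mellin_le {f : ℝ → ℂ} {σ : ℝ} (hf : MellinConvergent f σ) :
    ∫⁻ t : ℝ, ‖mellin f (σ + t * Complex.I)‖ₑ ^ (2 : ℝ) ≤
      ENNReal.ofReal (2 * Real.pi) *
        ∫⁻ x in Ioi (0 : ℝ), ‖f x‖ₑ ^ (2 : ℝ) * ENNReal.ofReal (x ^ (2 * σ - 1)) := by
  set h : ℝ → ℂ := fun u => Real.exp (-σ * u) • f (Real.exp (-u)) with hh
  have hm : ∀ t : ℝ, mellin f (σ + t * Complex.I) = 𝓕 h ((2 * Real.pi)⁻¹ * t) := by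
    intro t
    rw [mellin_eq_fourier]
    simp [hh, div_eq_inv_mul]
  have hpi : (0 : ℝ) < 2 * Real.pi := by positivity
  have himg : (fun u : ℝ => Real.exp (-u)) '' univ = Ioi 0 := by
    rw [← Function.comp_def Real.exp Neg.neg, image_comp, image_univ_of_surjective neg_surjective,
      image_univ, Real.range_exp]
  have hder : ∀ u ∈ (univ : Set ℝ),
      HasDerivWithinAt (fun u : ℝ => Real.exp (-u)) (-Real.exp (-u)) univ u := fun u _ => by
    simpa using ((hasDerivAt_neg u).exp).hasDerivWithinAt (s := univ)
  have hinj : InjOn (fun u : ℝ => Real.exp (-u)) univ := fun x _ y _ hxy => by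
    simpa using Real.exp_injective hxy
  have hint : Integrable h := by
    have := hf
    rw [MellinConvergent, ← himg,
      integrableOn_image_iff_integrableOn_abs_deriv_smul MeasurableSet.univ hder hinj,
      integrableOn_univ] at this
    refine this.congr (Eventually.of_forall fun u => ?_)
    simp only [hh, abs_neg, Real.abs_exp]
    rw [← Complex.ofReal_one, ← Complex.ofReal_sub, ← Complex.ofReal_cpow (Real.exp_pos _).le]
    simp only [Complex.real_smul, smul_eq_mul, ← mul_assoc, ← Complex.ofReal_mul]
    congr 2
    rw [← Real.exp_mul, ← Real.exp_add]
    congr 1; ring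
  calc ∫⁻ t : ℝ, ‖mellin f (σ + t * Complex.I)‖ₑ ^ (2 : ℝ)
      = ∫⁻ t : ℝ, ‖𝓕 h ((2 * Real.pi)⁻¹ * t)‖ₑ ^ (2 : ℝ) := by simp_rw [hm]
    _ = ENNReal.ofReal (2 * Real.pi) * ∫⁻ t : ℝ, ‖𝓕 h t‖ₑ ^ (2 : ℝ) := by
        have hr : (fun t : ℝ => (2 * Real.pi)⁻¹ * t) '' univ = univ :=
          image_univ_of_surjective (mul_left_surjective₀ (inv_ne_zero hpi.ne'))
        have := lintegral_image_eq_lintegral_abs_deriv_mul (s := univ) MeasurableSet.univ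
          (fun t _ => ((hasDerivAt_id t).const_mul (2 * Real.pi)⁻¹).hasDerivWithinAt)
          (mul_right_injective₀ (inv_ne_zero hpi.ne')).injOn (fun t => ‖𝓕 h t‖ₑ ^ (2 : ℝ))
        simp only [id_eq] at this
        rw [hr, Measure.restrict_univ, lintegral_const_mul' _ _ ENNReal.ofReal_ne_top] at this
        rw [this, ← mul_assoc, ← ENNReal.ofReal_mul hpi.le, mul_one,
          abs_of_pos (inv_pos.2 hpi), mul_inv_cancel₀ hpi.ne', ENNReal.ofReal_one, one_mul]
    _ ≤ ENNReal.ofReal (2 * Real.pi) * ∫⁻ t : ℝ, ‖h t‖ₑ ^ (2 : ℝ) := by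
        exact mul_le_mul_right (lintegral_enorm_sq_fourier_le hint) _
    _ = _ := by
        congr 1
        rw [← himg, lintegral_image_eq_lintegral_abs_deriv_mul MeasurableSet.univ hder hinj,
          Measure.restrict_univ]
        refine lintegral_congr fun u => ?_
        have hx := Real.exp_pos (-u)
        simp only [hh, abs_neg, Real.abs_exp, enorm_smul]
        rw [ENNReal.mul_rpow_of_nonneg _ _ (by norm_num), Real.enorm_of_nonneg (Real.exp_pos _).le,
          ENNReal.ofReal_rpow_of_pos (Real.exp_pos _), mul_comm (‖f _‖ₑ ^ (2 : ℝ)), ← mul_assoc,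
          ← ENNReal.ofReal_mul hx.le]
        congr 2
        rw [← Real.exp_mul, ← Real.exp_mul, ← Real.exp_add]
        congr 1; ring

end EpsteinZeta

namespace EpsteinZeta
open Set

/-! ### A lower bound for the Gamma function -/

/-- On the line `Re s = 1 / 2` the reflection formula gives the size of the Gamma function exactly.
-/
theorem norm_sq_Gamma_half_add (t : ℝ) :
    ‖Complex.Gamma ((1 / 2 : ℝ) + t * Complex.I)‖ ^ 2 = Real.pi / Real.cosh (Real.pi * t) := by
  set z : ℂ := (1 / 2 : ℝ) + t * Complex.I with hz
  have h1 : 1 - z = (starRingEnd ℂ) z := by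
    apply Complex.ext <;> simp [hz]; norm_num
  have h := Complex.Gamma_mul_Gamma_one_sub z
  rw [h1, Complex.Gamma_conj, Complex.mul_conj, Complex.normSq_eq_norm_sq] at h
  have h2 : Complex.sin (Real.pi * z) = (Real.cosh (Real.pi * t) : ℝ) := by
    rw [show (Real.pi : ℂ) * z = (Real.pi * t : ℝ) * Complex.I + Real.pi / 2 by
      simp only [hz]; push_cast; ring, Complex.sin_add_pi_div_two, Complex.cos_mul_I,
      Complex.ofReal_cosh]
  rw [h2, ← Complex.ofReal_div] at h
  exact_mod_cast h

/-- Each factor of the Gauss product grows by at most this much when the real part is moved from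
`1 / 2` to `1 / 2 + a`. -/
theorem gamma_factor_le {a t : ℝ} (ha : 0 ≤ a) (ht : 1 ≤ t) (j : ℕ) :
    (1 / 2 + a + j) ^ 2 + t ^ 2 ≤ ((1 / 2 + j) ^ 2 + t ^ 2) *
      Real.exp (a * (Real.log ((j + 1) ^ 2 + t ^ 2) - Real.log (j ^ 2 + t ^ 2)) +
        (4 * a + 2 * a ^ 2) * (1 / (j + 1) ^ 2)) := by
  have hj : (0 : ℝ) ≤ j := j.cast_nonneg
  set x : ℝ := 1 / 2 + j with hx
  have hA : 0 < x ^ 2 + t ^ 2 := by positivity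
  have hB : 0 < (j : ℝ) ^ 2 + t ^ 2 := by positivity
  have hC : 0 < ((j : ℝ) + 1) ^ 2 + t ^ 2 := by positivity
  have ht2 : 1 ≤ t ^ 2 := by nlinarith
  -- The logarithm of the quotient of the factors is about `2 a x / (x² + t²)`. Its main part is
  -- bounded by a telescoping difference of logarithms, the rest by a summable term.
  have hinv : 1 / (x ^ 2 + t ^ 2) ≤ 2 * (1 / ((j : ℝ) + 1) ^ 2) := by
    rw [← mul_div_assoc, mul_one, div_le_div_iff₀ hA (by positivity)]
    nlinarith
  have hlog : 2 * x / (((j : ℝ) + 1) ^ 2 + t ^ 2) ≤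
      Real.log ((j + 1) ^ 2 + t ^ 2) - Real.log (j ^ 2 + t ^ 2) := by
    rw [← Real.log_div hC.ne' hB.ne']
    refine le_trans (le_of_eq ?_) (Real.one_sub_inv_le_log_of_pos (div_pos hC hB))
    rw [inv_div, eq_sub_iff_add_eq, ← add_div, div_eq_one_iff_eq hC.ne']
    ring
  have hdiff : 2 * x / (x ^ 2 + t ^ 2) ≤
      2 * x / (((j : ℝ) + 1) ^ 2 + t ^ 2) + 2 * (1 / (x ^ 2 + t ^ 2)) := by
    rw [← mul_div_assoc, mul_one, div_add_div _ _ hC.ne' hA.ne',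
      div_le_div_iff₀ hA (by positivity)]
    have h3 : 2 * x * ((((j : ℝ) + 1) ^ 2 + t ^ 2)) ≤
        2 * x * (x ^ 2 + t ^ 2) + (((j : ℝ) + 1) ^ 2 + t ^ 2) * 2 := by
      rw [show (j : ℝ) = x - 1 / 2 by rw [hx]; ring]
      have hx0 : 0 ≤ x := by positivity
      nlinarith
    nlinarith
  have hexp : a * (2 * x / (x ^ 2 + t ^ 2)) + a ^ 2 * (1 / (x ^ 2 + t ^ 2)) ≤
      a * (Real.log ((j + 1) ^ 2 + t ^ 2) - Real.log (j ^ 2 + t ^ 2)) +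
        (4 * a + 2 * a ^ 2) * (1 / (j + 1) ^ 2) := by
    nlinarith [mul_le_mul_of_nonneg_left (hdiff.trans (add_le_add hlog
      (mul_le_mul_of_nonneg_left hinv zero_le_two))) ha,
      mul_le_mul_of_nonneg_left hinv (sq_nonneg a)]
  calc (1 / 2 + a + j) ^ 2 + t ^ 2
      = (x ^ 2 + t ^ 2) * (a * (2 * x / (x ^ 2 + t ^ 2)) + a ^ 2 * (1 / (x ^ 2 + t ^ 2)) + 1) := by
        field_simp; rw [hx]; ring
    _ ≤ _ := by
        gcongr
        exact (Real.add_one_le_exp _).trans (Real.exp_le_exp.2 hexp)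

theorem gamma_prod_le {a t : ℝ} (ha : 0 ≤ a) (ht : 1 ≤ t) (N : ℕ) :
    ∏ j ∈ Finset.range N, ((1 / 2 + a + j) ^ 2 + t ^ 2) ≤
      (∏ j ∈ Finset.range N, ((1 / 2 + (j : ℝ)) ^ 2 + t ^ 2)) *
      Real.exp (a * (Real.log (N ^ 2 + t ^ 2) - Real.log (t ^ 2)) +
        (4 * a + 2 * a ^ 2) * ∑ j ∈ Finset.range N, 1 / ((j : ℝ) + 1) ^ 2) := by
  induction N with
  | zero => simp
  | succ N ih =>
    rw [Finset.prod_range_succ, Finset.prod_range_succ, Finset.sum_range_succ]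
    refine (mul_le_mul ih (gamma_factor_le ha ht N) (by positivity) (by positivity)).trans
      (le_of_eq ?_)
    rw [mul_mul_mul_comm, ← Real.exp_add]
    push_cast
    congr 2
    ring

theorem norm_sq_GammaSeq (σ t : ℝ) {n : ℕ} (hn : n ≠ 0) :
    ‖Complex.GammaSeq (σ + t * Complex.I) n‖ ^ 2 =
      ((n : ℝ) ^ σ * n.factorial) ^ 2 / ∏ j ∈ Finset.range (n + 1), ((σ + j) ^ 2 + t ^ 2) := by
  rw [Complex.GammaSeq, norm_div, norm_mul, Complex.norm_natCast_cpow_of_pos (Nat.pos_of_ne_zero hn),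
    norm_prod, div_pow, ← Finset.prod_pow]
  congr 1
  · simp
  · refine Finset.prod_congr rfl fun j _ => ?_
    rw [← Complex.normSq_eq_norm_sq, Complex.normSq_apply]
    simp; ring

/-- Lower bound for the Gamma function in a vertical strip, of the exact order given by Stirling's
formula. -/
theorem exists_le_norm_sq_Gamma (β : ℝ) : ∃ c : ℝ, 0 < c ∧ ∀ σ t : ℝ, 1 / 2 ≤ σ → σ ≤ β → 1 ≤ t →
    c * t ^ (2 * σ - 1) * Real.exp (-(Real.pi * t)) ≤
      ‖Complex.Gamma (σ + t * Complex.I)‖ ^ 2 := by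
  have hsum : Summable fun j : ℕ => 1 / ((j : ℝ) + 1) ^ 2 := by
    have := (summable_nat_add_iff 1).2 (Real.summable_one_div_nat_pow.2 one_lt_two)
    exact_mod_cast this
  set Z := ∑' j : ℕ, 1 / ((j : ℝ) + 1) ^ 2
  refine ⟨Real.exp (-((4 * |β| + 2 * |β| ^ 2) * Z)) * Real.pi, by positivity, ?_⟩
  intro σ t hσ hβ ht
  have hZ : 0 ≤ Z := tsum_nonneg fun j => by positivity
  obtain ⟨a, ha, rfl⟩ : ∃ a : ℝ, 0 ≤ a ∧ σ = 1 / 2 + a := ⟨σ - 1 / 2, by linarith, by ring⟩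
  have haβ : a ≤ |β| := by linarith [le_abs_self β]
  have ht0 : 0 < t := by linarith
  set K := (4 * |β| + 2 * |β| ^ 2) * Z with hK
  -- Compare the Gauss products at `1 / 2 + a + i t` and at `1 / 2 + i t`, then let `n → ∞`; the
  -- factor `t ^ (2 a)` comes from the end of the telescoping sum at `j = 0`.
  have key : ∀ᶠ n : ℕ in atTop,
      ‖Complex.GammaSeq ((1 / 2 : ℝ) + t * Complex.I) n‖ ^ 2 * (Real.exp (-K) *
        (((n : ℝ) ^ 2 / ((n + 1) ^ 2 + t ^ 2)) ^ a * (t ^ 2) ^ a)) ≤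
      ‖Complex.GammaSeq ((1 / 2 + a : ℝ) + t * Complex.I) n‖ ^ 2 := by
    filter_upwards [eventually_ne_atTop 0] with n hn
    have hn' : (0 : ℝ) < n := by exact_mod_cast Nat.pos_of_ne_zero hn
    rw [norm_sq_GammaSeq _ _ hn, norm_sq_GammaSeq _ _ hn]
    have hP0 : 0 < ∏ j ∈ Finset.range (n + 1), ((1 / 2 + (j : ℝ)) ^ 2 + t ^ 2) :=
      Finset.prod_pos fun j _ => by positivity
    have hP1 : 0 < ∏ j ∈ Finset.range (n + 1), ((1 / 2 + a + (j : ℝ)) ^ 2 + t ^ 2) :=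
      Finset.prod_pos fun j _ => by positivity
    have hle := gamma_prod_le ha ht (n + 1)
    set P0 := ∏ j ∈ Finset.range (n + 1), ((1 / 2 + (j : ℝ)) ^ 2 + t ^ 2)
    set P1 := ∏ j ∈ Finset.range (n + 1), ((1 / 2 + a + (j : ℝ)) ^ 2 + t ^ 2)
    have hS : (4 * a + 2 * a ^ 2) * ∑ j ∈ Finset.range (n + 1), 1 / ((j : ℝ) + 1) ^ 2 ≤ K := by
      rw [hK]
      have : a ^ 2 ≤ |β| ^ 2 := by gcongr
      gcongr
      exact hsum.sum_le_tsum _ fun j _ => by positivity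
    set M : ℝ := ((n : ℝ) + 1) ^ 2 + t ^ 2 with hM
    have hMpos : 0 < M := by positivity
    have hle2 : P1 ≤ P0 * (Real.exp K * (M ^ a / (t ^ 2) ^ a)) := by
      refine hle.trans (mul_le_mul_of_nonneg_left ?_ hP0.le)
      rw [Real.exp_add, mul_comm]
      refine mul_le_mul (Real.exp_le_exp.2 hS) (le_of_eq ?_) (by positivity) (by positivity)
      rw [mul_sub, Real.exp_sub, mul_comm a, mul_comm a, ← Real.rpow_def_of_pos (by positivity),
        ← Real.rpow_def_of_pos (by positivity)]
      push_cast; rfl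
    rw [Real.rpow_add hn', Real.div_rpow (by positivity) hMpos.le, div_mul_eq_mul_div,
      div_le_div_iff₀ hP0 hP1]
    have hnn : (((n : ℝ) ^ 2) ^ a) = ((n : ℝ) ^ a) ^ 2 := by
      rw [← Real.rpow_natCast, ← Real.rpow_natCast, ← Real.rpow_mul hn'.le, ← Real.rpow_mul hn'.le,
        mul_comm]
    rw [hnn]
    have hta : 0 < (t ^ 2) ^ a := by positivity
    have hMa : 0 < M ^ a := by positivity
    calc _ ≤ ((n : ℝ) ^ (1 / 2 : ℝ) * n.factorial) ^ 2 *
          (Real.exp (-K) * (((n : ℝ) ^ a) ^ 2 / M ^ a * (t ^ 2) ^ a)) *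
          (P0 * (Real.exp K * (M ^ a / (t ^ 2) ^ a))) := by gcongr
      _ = ((n : ℝ) ^ (1 / 2 : ℝ) * n.factorial) ^ 2 * ((n : ℝ) ^ a) ^ 2 * P0 *
          (Real.exp (-K) * Real.exp K) := by field_simp
      _ = _ := by rw [← Real.exp_add, neg_add_cancel, Real.exp_zero]; ring
  have hlim : Tendsto (fun n : ℕ => (n : ℝ) ^ 2 / ((n + 1) ^ 2 + t ^ 2)) atTop (𝓝 1) := by
    have h1 : Tendsto (fun n : ℕ => 1 / (n : ℝ)) atTop (𝓝 0) := tendsto_one_div_atTop_nhds_zero_nat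
    have : Tendsto (fun n : ℕ => 1 / ((1 + 1 / (n : ℝ)) ^ 2 + t ^ 2 * (1 / (n : ℝ)) ^ 2)) atTop
        (𝓝 (1 / ((1 + 0) ^ 2 + t ^ 2 * 0 ^ 2))) := by
      refine Tendsto.div tendsto_const_nhds ?_ (by norm_num)
      exact ((tendsto_const_nhds.add h1).pow 2).add ((h1.pow 2).const_mul _)
    simp only [add_zero, one_pow, ne_eq, OfNat.ofNat_ne_zero, not_false_eq_true, zero_pow,
      mul_zero, div_one] at this
    refine this.congr' ?_
    filter_upwards [eventually_ne_atTop 0] with n hn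
    have hn' : (n : ℝ) ≠ 0 := by exact_mod_cast hn
    field_simp
  have hfin := le_of_tendsto_of_tendsto
    ((((Complex.GammaSeq_tendsto_Gamma _).norm.pow 2).mul
      (((hlim.rpow_const (p := a) (Or.inl one_ne_zero)).mul_const ((t ^ 2) ^ a)).const_mul
        (Real.exp (-K)))))
    ((Complex.GammaSeq_tendsto_Gamma _).norm.pow 2) key
  refine le_trans ?_ hfin
  rw [norm_sq_Gamma_half_add, Real.one_rpow, one_mul, ← Real.rpow_natCast t 2,
    ← Real.rpow_mul ht0.le]
  have hcosh : Real.cosh (Real.pi * t) ≤ Real.exp (Real.pi * t) := by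
    rw [Real.cosh_eq]
    have : Real.exp (-(Real.pi * t)) ≤ Real.exp (Real.pi * t) :=
      Real.exp_le_exp.2 (by nlinarith [Real.pi_pos])
    linarith
  have h1 : Real.exp (-(Real.pi * t)) ≤ 1 / Real.cosh (Real.pi * t) := by
    rw [Real.exp_neg, ← one_div]
    exact one_div_le_one_div_of_le (Real.cosh_pos _) hcosh
  rw [show 2 * (1 / 2 + a) - 1 = ((2 : ℕ) : ℝ) * a by push_cast; ring]
  calc _ = Real.pi * Real.exp (-(Real.pi * t)) * (Real.exp (-K) * t ^ (((2 : ℕ) : ℝ) * a)) := by ring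
    _ ≤ Real.pi * (1 / Real.cosh (Real.pi * t)) * (Real.exp (-K) * t ^ (((2 : ℕ) : ℝ) * a)) := by
        gcongr
    _ = _ := by ring

end EpsteinZeta

namespace EpsteinZeta
open Set

/-! ### Exponential series and Parseval's identity on vertical lines -/

/-- The general Dirichlet series `∑ a_m e^{-l m z}` in the half plane `Re z > 0`. -/
def expSeries (a : ℕ → ℂ) (l : ℝ) (z : ℂ) : ℂ := ∑' m : ℕ, a m * Complex.exp (-(l * m) * z)

/-- The coefficients `a` grow subexponentially, so that `∑ a_m e^{-l m z}` converges absolutely for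
`Re z > 0`. -/
def Subexponential (a : ℕ → ℂ) : Prop := ∀ x : ℝ, 0 < x → Summable fun m : ℕ => ‖a m‖ * Real.exp (-x * m)

theorem norm_expSeries_term (a : ℕ → ℂ) (l : ℝ) (z : ℂ) (m : ℕ) :
    ‖a m * Complex.exp (-(l * m) * z)‖ = ‖a m‖ * Real.exp (-(l * z.re) * m) := by
  rw [norm_mul, Complex.norm_exp]
  congr 2
  simp; ring

theorem Subexponential.summable {a : ℕ → ℂ} (ha : Subexponential a) {l : ℝ} (hl : 0 < l) {z : ℂ}
    (hz : 0 < z.re) : Summable fun m : ℕ => a m * Complex.exp (-(l * m) * z) := by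
  refine Summable.of_norm ?_
  simp_rw [norm_expSeries_term]
  exact ha _ (mul_pos hl hz)

theorem Subexponential.sub {a b : ℕ → ℂ} (ha : Subexponential a) (hb : Subexponential b) :
    Subexponential (a - b) := fun x hx => by
  refine Summable.of_nonneg_of_le (fun m => by positivity) (fun m => ?_) ((ha x hx).add (hb x hx))
  rw [← add_mul]
  exact mul_le_mul_of_nonneg_right (norm_sub_le _ _) (Real.exp_pos _).le

theorem expSeries_sub {a b : ℕ → ℂ} (ha : Subexponential a) (hb : Subexponential b) {l : ℝ}
    (hl : 0 < l) {z : ℂ} (hz : 0 < z.re) :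
    expSeries (a - b) l z = expSeries a l z - expSeries b l z := by
  simp only [expSeries, Pi.sub_apply, sub_mul]
  exact (ha.summable hl hz).tsum_sub (hb.summable hl hz)

theorem norm_expSeries_le {a : ℕ → ℂ} (ha : Subexponential a) {l : ℝ} (hl : 0 < l) {z : ℂ}
    (hz : 0 < z.re) : ‖expSeries a l z‖ ≤ ∑' m : ℕ, ‖a m‖ * Real.exp (-(l * z.re) * m) := by
  refine (norm_tsum_le_tsum_norm (ha.summable hl hz).norm).trans (le_of_eq ?_)
  simp_rw [norm_expSeries_term]

/-- Exponential decay as `Re z → ∞`. -/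
theorem exists_norm_expSeries_le {a : ℕ → ℂ} (ha : Subexponential a) (ha0 : a 0 = 0) {l : ℝ}
    (hl : 0 < l) {x₀ : ℝ} (hx₀ : 0 < x₀) :
    ∃ C : ℝ, 0 ≤ C ∧ ∀ z : ℂ, x₀ ≤ z.re → ‖expSeries a l z‖ ≤ C * Real.exp (-(l / 2) * z.re) := by
  have hs : Summable fun m : ℕ => ‖a m‖ * Real.exp (-(l * x₀ / 2) * m) := ha _ (by positivity)
  refine ⟨∑' m : ℕ, ‖a m‖ * Real.exp (-(l * x₀ / 2) * m),
    tsum_nonneg fun m => by positivity, fun z hz => ?_⟩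
  · refine (norm_expSeries_le ha hl (hx₀.trans_le hz)).trans ?_
    rw [← tsum_mul_right]
    refine (ha _ (mul_pos hl (hx₀.trans_le hz))).tsum_le_tsum (fun m => ?_) (hs.mul_right _)
    rcases Nat.eq_zero_or_pos m with rfl | hm
    · simp [ha0]
    rw [mul_assoc, ← Real.exp_add]
    refine mul_le_mul_of_nonneg_left (Real.exp_le_exp.2 ?_) (norm_nonneg _)
    have hm' : (1 : ℝ) ≤ m := by exact_mod_cast hm
    nlinarith [mul_le_mul_of_nonneg_left hm' (mul_pos hl (hx₀.trans_le hz)).le,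
      mul_le_mul_of_nonneg_left hz (mul_nonneg hl.le (zero_le_one.trans hm'))]

theorem differentiableOn_expSeries {a : ℕ → ℂ} (ha : Subexponential a) {l : ℝ} (hl : 0 < l) :
    DifferentiableOn ℂ (expSeries a l) {z | 0 < z.re} := by
  intro z hz
  have hz : 0 < z.re := hz
  have hopen : IsOpen {w : ℂ | z.re / 2 < w.re} := isOpen_lt continuous_const Complex.continuous_re
  have := Complex.differentiableOn_tsum_of_summable_norm
    (F := fun (m : ℕ) (w : ℂ) => a m * Complex.exp (-(l * m) * w))
    (ha (l * (z.re / 2)) (by positivity)) (fun m => by fun_prop) hopen (fun m w hw => by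
      rw [norm_expSeries_term]
      have hw : z.re / 2 < w.re := hw
      gcongr)
  exact ((this z (by simpa using hz)).differentiableAt
    (hopen.mem_nhds (by simpa using hz))).differentiableWithinAt

theorem continuousOn_expSeries {a : ℕ → ℂ} (ha : Subexponential a) {l : ℝ} (hl : 0 < l) :
    ContinuousOn (expSeries a l) {z | 0 < z.re} := (differentiableOn_expSeries ha hl).continuousOn

/-- Parseval's identity over one period, of arbitrary length and starting point. -/
theorem lintegral_period {P : ℝ} (hP : 0 < P) {c : ℕ → ℂ} (hc : Summable fun m => ‖c m‖) (t : ℝ) :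
    ∫⁻ u in Ioc t (t + P),
      ‖∑' m : ℕ, c m * Complex.exp (-(2 * Real.pi * Complex.I * m * u / P))‖ₑ ^ (2 : ℝ) =
    ENNReal.ofReal P * ∑' m : ℕ, ‖c m‖ₑ ^ (2 : ℝ) := by
  have : Fact (0 < P) := ⟨hP⟩
  set e : ℕ → C(AddCircle P, ℂ) := fun m => fourier (-(m : ℤ)) with he
  have hsum : Summable fun m => c m • e m := by
    refine Summable.of_norm ?_
    simp_rw [norm_smul, he, fourier_norm, mul_one]; exact hc
  set F : C(AddCircle P, ℂ) := ∑' m, c m • e m with hF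
  have hFv : ∀ u : ℝ, F (u : AddCircle P) =
      ∑' m : ℕ, c m * Complex.exp (-(2 * Real.pi * Complex.I * m * u / P)) := by
    intro u
    have h0 := (hsum.hasSum.mapL (ContinuousMap.evalCLM ℂ (u : AddCircle P))).tsum_eq
    rw [← hF] at h0
    refine h0.symm.trans (tsum_congr fun m => ?_)
    simp only [ContinuousMap.evalCLM_apply, ContinuousMap.smul_apply, he, fourier_coe_apply,
      smul_eq_mul]
    congr 2; push_cast; ring
  have h1 : ∫⁻ u in Ioc t (t + P),
      ‖∑' m : ℕ, c m * Complex.exp (-(2 * Real.pi * Complex.I * m * u / P))‖ₑ ^ (2 : ℝ) =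
      ∫⁻ b : AddCircle P, ‖F b‖ₑ ^ (2 : ℝ) := by
    rw [← AddCircle.lintegral_preimage P t]
    simp_rw [hFv]
  rw [h1, AddCircle.volume_eq_smul_haarAddCircle, lintegral_smul_measure, smul_eq_mul]
  congr 1
  set T := ContinuousMap.toLp (E := ℂ) 2 (AddCircle.haarAddCircle (T := P)) ℂ with hT
  have hG : HasSum (fun m => c m • fourierLp (T := P) 2 (-(m : ℤ))) (T F) := by
    have := hsum.hasSum.mapL T
    simpa [he, fourierLp] using this
  have horth := orthonormal_fourier (T := P)
  have hcoef : ∀ n : ℕ, inner ℂ (fourierLp (T := P) 2 (-(n : ℤ))) (T F) = c n := by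
    intro n
    have h2 := hG.mapL (innerSL ℂ (fourierLp (T := P) 2 (-(n : ℤ))))
    refine h2.unique ?_
    have h3 := hasSum_single (f := fun m : ℕ => (innerSL ℂ (fourierLp (T := P) 2 (-(n : ℤ))))
      (c m • fourierLp (T := P) 2 (-(m : ℤ)))) n (fun m hm => by
        simp only [innerSL_apply_apply, inner_smul_right]
        rw [horth.2 (by simpa using hm.symm), mul_zero])
    have h4 : (innerSL ℂ (fourierLp (T := P) 2 (-(n : ℤ))))
        (c n • fourierLp (T := P) 2 (-(n : ℤ))) = c n := by
      rw [innerSL_apply_apply, inner_smul_right, inner_self_eq_norm_sq_to_K, horth.1]; simp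
    rwa [h4] at h3
  have hnorm : HasSum (fun m => ‖c m‖ ^ 2) (‖T F‖ ^ 2) := by
    have h2 := hG.mapL (innerSL ℂ (T F))
    simp only [innerSL_apply_apply, inner_smul_right] at h2
    rw [inner_self_eq_norm_sq_to_K] at h2
    have h3 : ∀ m, c m * inner ℂ (T F) (fourierLp (T := P) 2 (-(m : ℤ))) =
        ((‖c m‖ ^ 2 : ℝ) : ℂ) := fun m => by
      rw [← inner_conj_symm, hcoef, Complex.mul_conj, Complex.normSq_eq_norm_sq]
    simp_rw [h3] at h2
    rw [← Complex.hasSum_ofReal]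
    simpa using h2
  have hlp : ‖T F‖ₑ ^ (2 : ℝ) = ∫⁻ b : AddCircle P, ‖F b‖ₑ ^ (2 : ℝ) ∂AddCircle.haarAddCircle := by
    rw [Lp.enorm_def, eLpNorm_congr_ae (ContinuousMap.coeFn_toLp _ _),
      eLpNorm_eq_lintegral_rpow_enorm_toReal (by norm_num) (by norm_num), ← ENNReal.rpow_mul]
    simp
  rw [← hlp]
  have h4 := ENNReal.ofReal_tsum_of_nonneg (fun m => sq_nonneg ‖c m‖) hnorm.summable
  rw [hnorm.tsum_eq] at h4
  have h5 : ∀ {E : Type} [NormedAddCommGroup E] (x : E), ‖x‖ₑ ^ (2 : ℝ) = ENNReal.ofReal (‖x‖ ^ 2) := by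
    intro E _ x
    rw [← ofReal_norm, ENNReal.ofReal_rpow_of_nonneg (norm_nonneg _) (by norm_num)]
    norm_num
  simp_rw [h5]
  exact h4

/-- Parseval's identity on a vertical line, as an upper bound over an interval of arbitrary
length. -/
theorem lintegral_expSeries_le {d : ℕ → ℂ} (hd : Subexponential d) {l : ℝ} (hl : 0 < l) {x : ℝ}
    (hx : 0 < x) (c : ℝ) {U : ℝ} (hU : 0 ≤ U) :
    ∫⁻ u in Ioc c (c + U), ‖expSeries d l (x + u * Complex.I)‖ₑ ^ (2 : ℝ) ≤
      ENNReal.ofReal (U + 2 * Real.pi / l) *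
        ∑' m : ℕ, ‖d m‖ₑ ^ (2 : ℝ) * ENNReal.ofReal (Real.exp (-(2 * l * x) * m)) := by
  set P := 2 * Real.pi / l with hP
  have hPpos : 0 < P := by positivity
  set S := ∑' m : ℕ, ‖d m‖ₑ ^ (2 : ℝ) * ENNReal.ofReal (Real.exp (-(2 * l * x) * m)) with hS
  have hper : ∀ t : ℝ, ∫⁻ u in Ioc t (t + P), ‖expSeries d l (x + u * Complex.I)‖ₑ ^ (2 : ℝ) =
      ENNReal.ofReal P * S := by
    intro t
    have hsum : Summable fun m : ℕ => ‖d m * (Real.exp (-(l * x) * m) : ℝ)‖ := by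
      have := hd (l * x) (mul_pos hl hx)
      simpa only [norm_mul, Complex.norm_real, Real.norm_eq_abs, Real.abs_exp] using this
    have := lintegral_period hPpos hsum t
    convert this using 2
    · funext u
      simp only [expSeries]
      congr 3
      funext m
      rw [mul_assoc, Complex.ofReal_exp, ← Complex.exp_add]
      congr 2
      rw [hP]
      push_cast
      have : (Real.pi : ℂ) ≠ 0 := by exact_mod_cast Real.pi_ne_zero
      have hl' : (l : ℂ) ≠ 0 := by exact_mod_cast hl.ne'
      field_simp
      ring
    · rw [hS]
      refine tsum_congr fun m => ?_
      rw [enorm_mul, ENNReal.mul_rpow_of_nonneg _ _ (by norm_num)]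
      congr 1
      rw [← ofReal_norm, Complex.norm_real, Real.norm_eq_abs, Real.abs_exp,
        ENNReal.ofReal_rpow_of_pos (Real.exp_pos _), ← Real.exp_mul]
      congr 2; ring
  have hN : ∀ N : ℕ, ∫⁻ u in Ioc c (c + N * P), ‖expSeries d l (x + u * Complex.I)‖ₑ ^ (2 : ℝ) =
      N * (ENNReal.ofReal P * S) := by
    intro N
    induction N with
    | zero => simp
    | succ N ih =>
      have hNP : 0 ≤ (N : ℝ) * P := by positivity
      have : Ioc c (c + ((N + 1 : ℕ) : ℝ) * P) = Ioc c (c + N * P) ∪ Ioc (c + N * P) (c + N * P + P) := by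
        rw [Ioc_union_Ioc_eq_Ioc (by linarith) (by linarith)]
        congr 1; push_cast; ring
      rw [this, lintegral_union measurableSet_Ioc
        (Set.disjoint_left.2 fun u hu hu' => not_lt.2 hu.2 hu'.1), ih, hper]
      push_cast; ring
  have hceil : U ≤ ⌈U / P⌉₊ * P := by
    rw [← div_le_iff₀ hPpos]; exact Nat.le_ceil _
  have hceil' : ⌈U / P⌉₊ * P ≤ U + P := by
    have := (Nat.ceil_lt_add_one (div_nonneg hU hPpos.le)).le
    calc _ ≤ (U / P + 1) * P := by gcongr
      _ = U + P := by field_simp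
  calc _ ≤ ∫⁻ u in Ioc c (c + ⌈U / P⌉₊ * P), ‖expSeries d l (x + u * Complex.I)‖ₑ ^ (2 : ℝ) :=
        lintegral_mono_set (Ioc_subset_Ioc_right (by linarith))
    _ = ⌈U / P⌉₊ * (ENNReal.ofReal P * S) := hN _
    _ ≤ _ := by
      rw [← mul_assoc, ← ENNReal.ofReal_natCast, ← ENNReal.ofReal_mul (by positivity)]
      gcongr

end EpsteinZeta

namespace EpsteinZeta
open Set ENNReal

/-! ### Averages over sectors -/

/-- The squared modulus of `∑ a_m e^{-l m z}`, extended by `0` outside the right half plane so as to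
be measurable everywhere. -/
def sqNorm (a : ℕ → ℂ) (l : ℝ) : ℂ → ℝ≥0∞ :=
  {z : ℂ | 0 < z.re}.indicator fun z => ‖expSeries a l z‖ₑ ^ (2 : ℝ)

theorem sqNorm_of_pos {a : ℕ → ℂ} {l : ℝ} {z : ℂ} (hz : 0 < z.re) :
    sqNorm a l z = ‖expSeries a l z‖ₑ ^ (2 : ℝ) := indicator_of_mem (by simpa using hz) _

theorem measurable_sqNorm {a : ℕ → ℂ} (ha : Subexponential a) {l : ℝ} (hl : 0 < l) :
    Measurable (sqNorm a l) := by
  classical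
  have hm : MeasurableSet {z : ℂ | 0 < z.re} := measurableSet_lt measurable_const Complex.measurable_re
  have h : ContinuousOn (fun z => ‖expSeries a l z‖ₑ ^ (2 : ℝ)) {z : ℂ | 0 < z.re} :=
    (ENNReal.continuous_rpow_const.comp continuous_enorm).comp_continuousOn
      (continuousOn_expSeries ha hl)
  have := h.measurable_piecewise (g := 0) continuousOn_const hm
  rwa [piecewise_eq_indicator] at this

/-- The weighted square sum of the coefficients on the line `Re z = x`. -/
def lineSum (d : ℕ → ℂ) (l x : ℝ) : ℝ≥0∞ :=
  ∑' m : ℕ, ‖d m‖ₑ ^ (2 : ℝ) * ENNReal.ofReal (Real.exp (-(2 * l * x) * m))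

/-- The part of the sector `x > 0`, `v > 0` where `z = x (1 + i v)` satisfies `|z| ≥ 1`. -/
def outer : Set (ℝ × ℝ) := {p | 1 ≤ p.1 ^ 2 * (1 + p.2 ^ 2)}

theorem measurableSet_outer : MeasurableSet outer :=
  measurableSet_le measurable_const (by fun_prop)

/-- The square mean of an exponential series over a segment of the vertical line `Re z = x`. -/
theorem lintegral_sqNorm_le {d : ℕ → ℂ} (hd : Subexponential d) {l : ℝ} (hl : 0 < l) {x : ℝ}
    (hx : 0 < x) {T : ℝ} (hT : 0 < T) {e : ℝ} (he : e = 1 ∨ e = -1) :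
    ∫⁻ v in Ioo 0 T, sqNorm d l (x + (e * (x * v) : ℝ) * Complex.I) ≤
      ENNReal.ofReal (T + 2 * Real.pi / l / x) * lineSum d l x := by
  have hex : e * x ≠ 0 := mul_ne_zero (by rcases he with rfl | rfl <;> norm_num) hx.ne'
  have habs : |e * x| = x := by rcases he with rfl | rfl <;> simp [abs_of_pos hx]
  have hder : ∀ v ∈ Ioo 0 T, HasDerivWithinAt (fun v => e * x * v) (e * x) (Ioo 0 T) v := fun v _ => by
    simpa using ((hasDerivAt_id v).const_mul (e * x)).hasDerivWithinAt
  have hcv := lintegral_image_eq_lintegral_abs_deriv_mul measurableSet_Ioo hder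
    (mul_right_injective₀ hex).injOn (fun u => sqNorm d l (x + u * Complex.I))
  simp only [habs] at hcv
  rw [lintegral_const_mul' _ _ ENNReal.ofReal_ne_top] at hcv
  obtain ⟨c, hc⟩ : ∃ c, (fun v => e * x * v) '' Ioo 0 T ⊆ Ioc c (c + x * T) := by
    rcases he with rfl | rfl
    · refine ⟨0, ?_⟩
      rintro _ ⟨v, hv, rfl⟩
      have := mul_pos hx hv.1
      have := mul_lt_mul_of_pos_left hv.2 hx
      constructor <;> simp <;> linarith
    · refine ⟨-(x * T), ?_⟩
      rintro _ ⟨v, hv, rfl⟩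
      have := mul_pos hx hv.1
      have := mul_lt_mul_of_pos_left hv.2 hx
      constructor <;> simp <;> linarith
  have hle : ENNReal.ofReal x * ∫⁻ v in Ioo 0 T, sqNorm d l (x + (e * (x * v) : ℝ) * Complex.I) ≤
      ENNReal.ofReal (x * T + 2 * Real.pi / l) * lineSum d l x := by
    have h1 := lintegral_expSeries_le hd hl hx c (mul_pos hx hT).le
    calc _ = ∫⁻ u in (fun v => e * x * v) '' Ioo 0 T, sqNorm d l (x + u * Complex.I) := by
          rw [hcv]; simp_rw [mul_assoc]
      _ ≤ ∫⁻ u in Ioc c (c + x * T), sqNorm d l (x + u * Complex.I) := lintegral_mono_set hc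
      _ = ∫⁻ u in Ioc c (c + x * T), ‖expSeries d l (x + u * Complex.I)‖ₑ ^ (2 : ℝ) := by
          refine lintegral_congr fun u => sqNorm_of_pos (by simpa using hx)
      _ ≤ _ := h1
  have hx' : ENNReal.ofReal x ≠ 0 := by simpa using hx
  rw [← ENNReal.mul_le_mul_iff_right hx' ENNReal.ofReal_ne_top, ← mul_assoc,
    ← ENNReal.ofReal_mul hx.le]
  convert hle using 3
  field_simp

/-- Averages over the slopes `v < T` of the points of the line `Re z = x`, restricted to `|z| ≥ 1`:
they are bounded by the square sum, uniformly in `x` and `T`. -/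
theorem lintegral_outer_sqNorm_le {d : ℕ → ℂ} (hd : Subexponential d) {l : ℝ} (hl : 0 < l) {x : ℝ}
    (hx : 0 < x) {T : ℝ} (hT : 1 ≤ T) {e : ℝ} (he : e = 1 ∨ e = -1) :
    ENNReal.ofReal (1 / T) * ∫⁻ v in Ioo 0 T, outer.indicator
      (fun p : ℝ × ℝ => sqNorm d l (p.1 + (e * (p.1 * p.2) : ℝ) * Complex.I)) (x, v) ≤
      ENNReal.ofReal (1 + 4 * Real.pi / l) * lineSum d l x := by
  have hT0 : 0 < T := by linarith
  by_cases h : 1 ≤ 2 * T * x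
  · have h1 := lintegral_sqNorm_le hd hl hx hT0 he
    calc _ ≤ ENNReal.ofReal (1 / T) *
          ∫⁻ v in Ioo 0 T, sqNorm d l (x + (e * (x * v) : ℝ) * Complex.I) := by
          refine mul_le_mul_right (lintegral_mono fun v => ?_) _
          exact indicator_le_self _ _ _
      _ ≤ ENNReal.ofReal (1 / T) * (ENNReal.ofReal (T + 2 * Real.pi / l / x) * lineSum d l x) := by
          gcongr
      _ ≤ _ := by
          rw [← mul_assoc, ← ENNReal.ofReal_mul (by positivity)]
          gcongr
          rw [mul_add, one_div_mul_cancel hT0.ne']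
          gcongr
          rw [one_div, inv_mul_le_iff₀ hT0, div_le_iff₀ hx]
          have : 0 < 2 * Real.pi / l := by positivity
          calc 2 * Real.pi / l = 2 * Real.pi / l * 1 := by ring
            _ ≤ 2 * Real.pi / l * (2 * T * x) := by gcongr
            _ = _ := by ring
  -- For `2 T x < 1` the line `Re z = x` stays in `|z| < 1` as long as `v < T`, so that the factor
  -- `1 / x` in the number of periods never exceeds `2 T`.
  · have hz : ∫⁻ v in Ioo 0 T, outer.indicator
        (fun p : ℝ × ℝ => sqNorm d l (p.1 + (e * (p.1 * p.2) : ℝ) * Complex.I)) (x, v) = 0 := by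
      rw [setLIntegral_congr_fun (g := fun _ => 0) measurableSet_Ioo]
      · simp
      · intro v hv
        refine indicator_of_notMem (fun hmem => h ?_) _
        have hmem : 1 ≤ x ^ 2 * (1 + v ^ 2) := hmem
        have h2 : v ^ 2 ≤ T ^ 2 := by have := hv.1; have := hv.2; nlinarith
        have h3 : x ^ 2 * (1 + v ^ 2) ≤ (2 * T * x) ^ 2 := by
          have : x ^ 2 * (1 + v ^ 2) ≤ x ^ 2 * (4 * T ^ 2) :=
            mul_le_mul_of_nonneg_left (by nlinarith) (sq_nonneg x)
          linarith [this, mul_pow (2 * T) x 2]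
        have h4 : 0 ≤ 2 * T * x := by positivity
        nlinarith
    rw [hz]; simp

/-- The average over `(0, T)` of a bounded function tending to `0` tends to `0`. -/
theorem tendsto_average_zero {f : ℝ → ℝ≥0∞} {M : ℝ≥0∞} (hM : M ≠ ∞) (hf : ∀ v, 0 < v → f v ≤ M)
    (hlim : Tendsto f atTop (𝓝 0)) :
    Tendsto (fun T : ℝ => ENNReal.ofReal (1 / T) * ∫⁻ v in Ioo 0 T, f v) atTop (𝓝 0) := by
  rw [ENNReal.tendsto_nhds_zero]
  intro ε hε
  have hε2 : 0 < ε / 2 := ENNReal.half_pos hε.ne'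
  obtain ⟨R, hR⟩ := eventually_atTop.1 ((ENNReal.tendsto_nhds_zero.1 hlim) (ε / 2) hε2)
  set R' := max R 0
  have hlim2 : Tendsto (fun T : ℝ => ENNReal.ofReal (1 / T) * (M * ENNReal.ofReal R')) atTop (𝓝 0) := by
    have h0 : Tendsto (fun T : ℝ => ENNReal.ofReal (1 / T)) atTop (𝓝 0) := by
      have := ENNReal.tendsto_ofReal (tendsto_const_nhds.div_atTop tendsto_id :
        Tendsto (fun T : ℝ => 1 / T) atTop (𝓝 0))
      simpa using this
    have := ENNReal.Tendsto.mul_const (b := M * ENNReal.ofReal R') h0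
      (Or.inr (ENNReal.mul_ne_top hM ENNReal.ofReal_ne_top))
    simpa using this
  filter_upwards [(ENNReal.tendsto_nhds_zero.1 hlim2) (ε / 2) hε2, eventually_gt_atTop 0] with T hT hT0
  have hle : ∫⁻ v in Ioo 0 T, f v ≤ M * ENNReal.ofReal R' + ε / 2 * ENNReal.ofReal T := by
    have hsub : Ioo 0 T ⊆ Ioc 0 R' ∪ Ioc R' (max R' T) := by
      intro v hv
      by_cases h : v ≤ R'
      · exact Or.inl ⟨hv.1, h⟩
      · exact Or.inr ⟨not_le.1 h, hv.2.le.trans (le_max_right _ _)⟩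
    have hR0 : 0 ≤ R' := le_max_right _ _
    calc _ ≤ ∫⁻ v in Ioc 0 R' ∪ (Ioc R' (max R' T)), f v := lintegral_mono_set hsub
      _ ≤ (∫⁻ v in Ioc 0 R', f v) + ∫⁻ v in Ioc R' (max R' T), f v := lintegral_union_le _ _ _
      _ ≤ (∫⁻ v in Ioc 0 R', M) + ∫⁻ v in Ioc R' (max R' T), ε / 2 := by
          refine add_le_add (setLIntegral_mono measurable_const fun v hv => hf v hv.1)
            (setLIntegral_mono measurable_const fun v hv => hR v ?_)
          exact (le_max_left _ _).trans hv.1.le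
      _ ≤ _ := by
          rw [setLIntegral_const, setLIntegral_const, Real.volume_Ioc, Real.volume_Ioc, sub_zero]
          gcongr
          rcases le_total R' T with h | h
          · rw [max_eq_right h]; linarith
          · rw [max_eq_left h]; linarith
  calc _ ≤ ENNReal.ofReal (1 / T) * (M * ENNReal.ofReal R' + ε / 2 * ENNReal.ofReal T) := by gcongr
    _ = ENNReal.ofReal (1 / T) * (M * ENNReal.ofReal R') +
        ε / 2 * (ENNReal.ofReal (1 / T) * ENNReal.ofReal T) := by ring
    _ ≤ ε / 2 + ε / 2 := by
        gcongr
        rw [← ENNReal.ofReal_mul (by positivity), one_div_mul_cancel hT0.ne']; simp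
    _ = ε := ENNReal.add_halves ε

/-- The average over the slopes `v ∈ (0, T)` of the integral of `K (x, v)` along the ray
`z = x (1 + i v)`, `x > 0`, with respect to the weight `w`. -/
def sectorAvg (w : ℝ → ℝ≥0∞) (K : ℝ × ℝ → ℝ≥0∞) (T : ℝ) : ℝ≥0∞ :=
  ENNReal.ofReal (1 / T) * ∫⁻ v in Ioo 0 T, ∫⁻ x in Ioi 0, K (x, v) * w x

theorem sectorAvg_mono {w : ℝ → ℝ≥0∞} {K K' : ℝ × ℝ → ℝ≥0∞} {T : ℝ}
    (h : ∀ x, 0 < x → ∀ v, 0 < v → K (x, v) ≤ K' (x, v)) : sectorAvg w K T ≤ sectorAvg w K' T := by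
  refine mul_le_mul_right (setLIntegral_mono' measurableSet_Ioo fun v hv =>
    setLIntegral_mono' measurableSet_Ioi fun x hx => ?_) _
  exact mul_le_mul_left (h x hx v hv.1) _

theorem sectorAvg_add {w : ℝ → ℝ≥0∞} (hw : Measurable w) {K : ℝ × ℝ → ℝ≥0∞} (hK : Measurable K)
    (K' : ℝ × ℝ → ℝ≥0∞) (T : ℝ) :
    sectorAvg w (fun p => K p + K' p) T = sectorAvg w K T + sectorAvg w K' T := by
  unfold sectorAvg
  rw [← mul_add, ← lintegral_add_left]
  · congr 1
    refine lintegral_congr fun v => ?_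
    rw [← lintegral_add_left]
    · simp_rw [add_mul]
    · fun_prop
  · have : Measurable fun p : ℝ × ℝ => K (p.2, p.1) * w p.2 := by fun_prop
    exact this.lintegral_prod_right'

theorem sectorAvg_const_mul (w : ℝ → ℝ≥0∞) {c : ℝ≥0∞} (hc : c ≠ ∞) (K : ℝ × ℝ → ℝ≥0∞) (T : ℝ) :
    sectorAvg w (fun p => c * K p) T = c * sectorAvg w K T := by
  unfold sectorAvg
  simp_rw [mul_assoc, lintegral_const_mul' _ _ hc]
  ring

theorem sectorAvg_eq_lintegral {w : ℝ → ℝ≥0∞} (hw : Measurable w) (hwt : ∀ x, w x ≠ ∞)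
    {K : ℝ × ℝ → ℝ≥0∞} (hK : Measurable K) (T : ℝ) :
    sectorAvg w K T =
      ∫⁻ x in Ioi 0, (ENNReal.ofReal (1 / T) * ∫⁻ v in Ioo 0 T, K (x, v)) * w x := by
  rw [sectorAvg, lintegral_lintegral_swap (by
      refine Measurable.aemeasurable ?_
      exact (hK.comp measurable_swap).mul (hw.comp measurable_snd)),
      ← lintegral_const_mul' _ _ ENNReal.ofReal_ne_top]
  refine lintegral_congr fun x => ?_
  rw [lintegral_mul_const' _ _ (hwt x), mul_assoc]

theorem sectorAvg_le {w : ℝ → ℝ≥0∞} (hw : Measurable w) (hwt : ∀ x, w x ≠ ∞)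
    {K : ℝ × ℝ → ℝ≥0∞} (hK : Measurable K) {B : ℝ → ℝ≥0∞} {T : ℝ}
    (hle : ∀ x : ℝ, 0 < x → ENNReal.ofReal (1 / T) * ∫⁻ v in Ioo 0 T, K (x, v) ≤ B x) :
    sectorAvg w K T ≤ ∫⁻ x in Ioi 0, B x * w x := by
  rw [sectorAvg_eq_lintegral hw hwt hK]
  exact setLIntegral_mono' measurableSet_Ioi fun x hx => mul_le_mul_left (hle x hx) _

/-- Sector averages tend to `0` as soon as they do so on each line, with an integrable majorant. -/
theorem tendsto_sectorAvg_zero {K : ℝ × ℝ → ℝ≥0∞} (hK : Measurable K) {B w : ℝ → ℝ≥0∞}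
    (hw : Measurable w) (hwt : ∀ x, w x ≠ ∞) (hB : ∫⁻ x in Ioi 0, B x * w x ≠ ∞)
    (hle : ∀ T : ℝ, 1 ≤ T → ∀ x : ℝ, 0 < x →
      ENNReal.ofReal (1 / T) * ∫⁻ v in Ioo 0 T, K (x, v) ≤ B x)
    (hlim : ∀ x : ℝ, 0 < x →
      Tendsto (fun T : ℝ => ENNReal.ofReal (1 / T) * ∫⁻ v in Ioo 0 T, K (x, v)) atTop (𝓝 0)) :
    Tendsto (sectorAvg w K) atTop (𝓝 0) := by
  rw [show sectorAvg w K = _ from funext (sectorAvg_eq_lintegral hw hwt hK),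
    ← lintegral_zero (μ := volume.restrict (Ioi (0 : ℝ)))]
  refine tendsto_lintegral_filter_of_dominated_convergence (fun x => B x * w x) ?_ ?_ hB ?_
  · refine Eventually.of_forall fun T => Measurable.mul (Measurable.const_mul ?_ _) hw
    exact hK.lintegral_prod_right'
  · filter_upwards [eventually_ge_atTop 1] with T hT
    filter_upwards [self_mem_ae_restrict measurableSet_Ioi] with x hx
    exact mul_le_mul_left (hle T hT x hx) _
  · filter_upwards [self_mem_ae_restrict measurableSet_Ioi] with x hx
    have := ENNReal.Tendsto.mul_const (b := w x) (hlim x hx) (Or.inr (hwt x))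
    simpa using this

end EpsteinZeta

namespace EpsteinZeta
open Set ENNReal

/-! ### Weights and square sums -/

theorem lintegral_rpow_mul_exp {a r : ℝ} (ha : 0 < a) (hr : 0 < r) :
    ∫⁻ x in Ioi (0 : ℝ), ENNReal.ofReal (x ^ (a - 1) * Real.exp (-(r * x))) =
      ENNReal.ofReal ((1 / r) ^ a * Real.Gamma a) := by
  have h := Real.integral_rpow_mul_exp_neg_mul_Ioi ha hr
  have hpos : 0 < (1 / r) ^ a * Real.Gamma a := by
    have := Real.Gamma_pos_of_pos ha; positivity
  have hint : IntegrableOn (fun x : ℝ => x ^ (a - 1) * Real.exp (-(r * x))) (Ioi 0) := by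
    by_contra hn
    rw [integral_undef hn] at h
    exact hpos.ne h
  rw [← h, ofReal_integral_eq_lintegral_ofReal hint]
  filter_upwards [self_mem_ae_restrict measurableSet_Ioi] with x hx
  have hx : 0 < x := hx
  positivity

/-- The weight `x ^ (2 α - 1) + x ^ (2 β - 1)`, a common majorant of the weights
`x ^ (2 σ - 1)` for `α ≤ σ ≤ β`. -/
def weight (α β x : ℝ) : ℝ≥0∞ :=
  ENNReal.ofReal (x ^ (2 * α - 1)) + ENNReal.ofReal (x ^ (2 * β - 1))

theorem measurable_weight (α β : ℝ) : Measurable (weight α β) := by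
  unfold weight; fun_prop

theorem weight_ne_top (α β x : ℝ) : weight α β x ≠ ∞ := by simp [weight]

theorem rpow_le_weight {α β σ x : ℝ} (hα : α ≤ σ) (hβ : σ ≤ β) (hx : 0 < x) :
    ENNReal.ofReal (x ^ (2 * σ - 1)) ≤ weight α β x := by
  rcases le_total x 1 with h | h
  · refine le_trans (ENNReal.ofReal_le_ofReal ?_) le_self_add
    exact Real.rpow_le_rpow_of_exponent_ge hx h (by linarith)
  · refine le_trans (ENNReal.ofReal_le_ofReal ?_) le_add_self
    exact Real.rpow_le_rpow_of_exponent_le h (by linarith)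

theorem lintegral_exp_mul_weight {α β r : ℝ} (hα : 0 < α) (hβ : 0 < β) (hr : 0 < r) :
    ∫⁻ x in Ioi (0 : ℝ), ENNReal.ofReal (Real.exp (-(r * x))) * weight α β x =
      ENNReal.ofReal ((1 / r) ^ (2 * α) * Real.Gamma (2 * α)) +
        ENNReal.ofReal ((1 / r) ^ (2 * β) * Real.Gamma (2 * β)) := by
  rw [← lintegral_rpow_mul_exp (by positivity) hr, ← lintegral_rpow_mul_exp (by positivity) hr,
    ← lintegral_add_left (by fun_prop)]
  refine setLIntegral_congr_fun measurableSet_Ioi fun x hx => ?_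
  have hx : 0 < x := hx
  rw [weight, mul_add, ← ENNReal.ofReal_mul (Real.exp_pos _).le,
    ← ENNReal.ofReal_mul (Real.exp_pos _).le, mul_comm (Real.exp _), mul_comm (Real.exp _)]

/-- The weighted integral over all lines of the square sums is a square sum with weight
`m ^ (-2 α)`, up to a constant depending only on `α`, `β`, `l`. -/
theorem exists_lintegral_lineSum_le {α β l : ℝ} (hα : 0 < α) (hβ : α ≤ β) (hl : 0 < l) :
    ∃ C : ℝ, 0 ≤ C ∧ ∀ d : ℕ → ℂ, d 0 = 0 →
      ∫⁻ x in Ioi (0 : ℝ), lineSum d l x * weight α β x ≤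
        ENNReal.ofReal C * ∑' m : ℕ, ‖d m‖ₑ ^ (2 : ℝ) * ENNReal.ofReal ((m : ℝ) ^ (-2 * α)) := by
  have hβ0 : 0 < β := by linarith
  have hGα := Real.Gamma_pos_of_pos (show 0 < 2 * α by linarith)
  have hGβ := Real.Gamma_pos_of_pos (show 0 < 2 * β by linarith)
  refine ⟨(1 / (2 * l)) ^ (2 * α) * Real.Gamma (2 * α) +
    (1 / (2 * l)) ^ (2 * β) * Real.Gamma (2 * β), by positivity, fun d hd => ?_⟩
  unfold lineSum
  simp_rw [← ENNReal.tsum_mul_right]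
  rw [lintegral_tsum (fun m => by
    have := measurable_weight α β
    fun_prop), ← ENNReal.tsum_mul_left]
  refine ENNReal.tsum_le_tsum fun m => ?_
  rcases Nat.eq_zero_or_pos m with rfl | hm
  · simp [hd]
  have hm1 : (1 : ℝ) ≤ m := by exact_mod_cast hm
  have hm0 : (0 : ℝ) < m := by linarith
  simp_rw [mul_assoc]
  rw [lintegral_const_mul' _ _ (by simp), mul_left_comm]
  refine mul_le_mul_right ?_ _
  have := lintegral_exp_mul_weight hα hβ0 (r := 2 * l * m) (by positivity)
  calc _ = ∫⁻ x in Ioi (0 : ℝ), ENNReal.ofReal (Real.exp (-(2 * l * m * x))) * weight α β x := by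
        refine lintegral_congr fun x => ?_
        congr 3; ring
    _ = _ := this
    _ ≤ _ := by
        rw [← ENNReal.ofReal_add (by positivity) (by positivity), ← ENNReal.ofReal_mul (by positivity)]
        refine ENNReal.ofReal_le_ofReal ?_
        have e : ∀ s : ℝ, (1 / (2 * l * m)) ^ s = (1 / (2 * l)) ^ s * (m : ℝ) ^ (-s) := fun s => by
          rw [Real.rpow_neg hm0.le, ← Real.inv_rpow hm0.le, ← Real.mul_rpow (by positivity) (by positivity)]
          congr 1; field_simp
        have e2 : (m : ℝ) ^ (-(2 * β)) ≤ (m : ℝ) ^ (-2 * α) :=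
          Real.rpow_le_rpow_of_exponent_le hm1 (by linarith)
        rw [e, e, add_mul, mul_right_comm, mul_right_comm _ (_ ^ (-(2 * β))), ← neg_mul 2 α]
        gcongr

/-- A coefficient sequence whose Dirichlet series converges absolutely somewhere grows
subexponentially. -/
theorem subexponential_of_summable {a : ℕ → ℂ} (ha0 : a 0 = 0) {s : ℝ}
    (h : Summable fun m : ℕ => ‖a m‖ * (m : ℝ) ^ (-s)) : Subexponential a := by
  intro x hx
  have hlim : Tendsto (fun y : ℝ => y ^ s * Real.exp (-x * y)) atTop (𝓝 0) :=
    tendsto_rpow_mul_exp_neg_mul_atTop_nhds_zero s x hx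
  have hb := (hlim.comp tendsto_natCast_atTop_atTop).bddAbove_range
  obtain ⟨C, hC⟩ := hb
  refine Summable.of_nonneg_of_le (fun m => by positivity) (fun m => ?_) (h.mul_right C)
  rcases Nat.eq_zero_or_pos m with rfl | hm
  · simp [ha0]
  have hm0 : (0 : ℝ) < m := by exact_mod_cast hm
  have h1 : (m : ℝ) ^ s * Real.exp (-x * m) ≤ C := hC ⟨m, rfl⟩
  calc ‖a m‖ * Real.exp (-x * m)
      = ‖a m‖ * (m : ℝ) ^ (-s) * ((m : ℝ) ^ s * Real.exp (-x * m)) := by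
        rw [Real.rpow_neg hm0.le]; field_simp
    _ ≤ _ := by gcongr

/-- If `∑ |b_m| m^{-ε}` converges, then `∑ b_m e^{-l m z}` grows at most like `(Re z)^{-ε}` near the
imaginary axis. -/
theorem exists_norm_expSeries_le_rpow {b : ℕ → ℂ} (hb0 : b 0 = 0) {ε : ℝ} (hε0 : 0 < ε) (hε1 : ε ≤ 1)
    (h : Summable fun m : ℕ => ‖b m‖ * (m : ℝ) ^ (-ε)) {l : ℝ} (hl : 0 < l) :
    ∃ C : ℝ, 0 ≤ C ∧ ∀ z : ℂ, 0 < z.re → ‖expSeries b l z‖ ≤ C * z.re ^ (-ε) := by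
  have hsub := subexponential_of_summable hb0 h
  refine ⟨(∑' m : ℕ, ‖b m‖ * (m : ℝ) ^ (-ε)) * (1 + 1 / l),
    mul_nonneg (tsum_nonneg fun m => by positivity) (by positivity), fun z hz => ?_⟩
  refine (norm_expSeries_le hsub hl hz).trans ?_
  rw [mul_assoc, ← tsum_mul_right]
  refine (hsub _ (mul_pos hl hz)).tsum_le_tsum (fun m => ?_) (h.mul_right _)
  rcases Nat.eq_zero_or_pos m with rfl | hm
  · simp [hb0]
  have hm0 : (0 : ℝ) < m := by exact_mod_cast hm
  rw [mul_assoc]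
  refine mul_le_mul_of_nonneg_left ?_ (norm_nonneg _)
  set x := z.re
  have hy : 0 < (m : ℝ) * x := by positivity
  have h1 : ((m : ℝ) * x) ^ ε ≤ 1 + m * x := by
    rcases le_total ((m : ℝ) * x) 1 with h | h
    · have := Real.rpow_le_one hy.le h hε0.le; linarith
    · have := Real.rpow_le_rpow_of_exponent_le h hε1
      rw [Real.rpow_one] at this; linarith
  have h2 : 1 + (m : ℝ) * x ≤ (1 + 1 / l) * Real.exp (l * x * m) := by
    have := Real.add_one_le_exp (l * x * m)
    calc 1 + (m : ℝ) * x ≤ (1 + 1 / l) * (l * x * m + 1) := by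
          have : (1 + 1 / l) * (l * x * m + 1) = 1 + m * x + (l * x * m + 1 / l) := by
            field_simp; ring
          rw [this]
          have : 0 ≤ l * x * m + 1 / l := by positivity
          linarith
      _ ≤ _ := by gcongr
  have h3 : Real.exp (-(l * x) * m) ≤ (1 + 1 / l) * ((m : ℝ) * x) ^ (-ε) := by
    rw [Real.rpow_neg hy.le, neg_mul, Real.exp_neg, ← div_eq_mul_inv,
      inv_le_iff_one_le_mul₀ (Real.exp_pos _), div_mul_eq_mul_div, one_le_div (by positivity)]
    exact h1.trans h2
  refine h3.trans (le_of_eq ?_)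
  rw [Real.mul_rpow hm0.le hz.le]; ring

end EpsteinZeta

namespace EpsteinZeta
open Set ENNReal

/-! ### Theta series with a functional equation -/

/-- The data of a Dirichlet series `∑ a_m m^{-s}` with a functional equation of degree two: the
theta series `κ + ∑ a_m e^{-l m z}` is a modular form of weight one, with respect to `z ↦ 1 / z`,
and the square sums converge as they do under the Ramanujan hypothesis. -/
structure SelfDual (a : ℕ → ℂ) (l : ℝ) (κ : ℂ) : Prop where
  zero : a 0 = 0
  pos : 0 < l
  summable_sq : ∀ σ : ℝ, 1 / 2 < σ → Summable fun m : ℕ => ‖a m‖ ^ 2 * (m : ℝ) ^ (-2 * σ)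
  feq : ∀ z : ℂ, 0 < z.re → κ + expSeries a l z⁻¹ = z * (κ + expSeries a l z)

namespace SelfDual

variable {a : ℕ → ℂ} {l : ℝ} {κ : ℂ}

theorem summable (ha : SelfDual a l κ) {s : ℝ} (hs : 1 < s) :
    Summable fun m : ℕ => ‖a m‖ * (m : ℝ) ^ (-s) := by
  have h1 := ha.summable_sq (s / 2) (by linarith)
  have h2 : Summable fun m : ℕ => (m : ℝ) ^ (-s) := Real.summable_nat_rpow.2 (by linarith)
  refine Summable.of_nonneg_of_le (fun m => by positivity) (fun m => ?_) (h1.add h2)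
  rw [show -2 * (s / 2) = -s by ring, ← add_one_mul]
  refine mul_le_mul_of_nonneg_right ?_ (by positivity)
  nlinarith [sq_nonneg (‖a m‖ - 1), norm_nonneg (a m)]

theorem subexponential (ha : SelfDual a l κ) : Subexponential a :=
  subexponential_of_summable ha.zero (ha.summable one_lt_two)

end SelfDual

/-- A coefficient sequence whose Dirichlet series converges absolutely for `Re s > 0`. -/
structure AbsConvergent (b : ℕ → ℂ) : Prop where
  zero : b 0 = 0
  summable : ∀ ε : ℝ, 0 < ε → Summable fun m : ℕ => ‖b m‖ * (m : ℝ) ^ (-ε)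

theorem AbsConvergent.subexponential {b : ℕ → ℂ} (hb : AbsConvergent b) : Subexponential b :=
  subexponential_of_summable hb.zero (hb.summable 1 one_pos)

/-- The difference of the theta series of `a` and `b`, corrected by `κ e^{-l z} / z`, which removes
the pole of the Mellin transform at `s = 1`. -/
def thetaDiff (a b : ℕ → ℂ) (l : ℝ) (κ z : ℂ) : ℂ :=
  expSeries a l z - expSeries b l z - κ * Complex.exp (-l * z) / z

theorem enorm_sq (z : ℂ) : ‖z‖ₑ ^ (2 : ℝ) = ENNReal.ofReal (‖z‖ ^ 2) := by
  rw [← ofReal_norm, ENNReal.ofReal_rpow_of_nonneg (norm_nonneg _) (by norm_num)]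
  norm_num

theorem enorm_sq_add_le (z w : ℂ) : ‖z + w‖ₑ ^ (2 : ℝ) ≤ 2 * (‖z‖ₑ ^ (2 : ℝ) + ‖w‖ₑ ^ (2 : ℝ)) := by
  simp_rw [enorm_sq]
  rw [← ENNReal.ofReal_add (by positivity) (by positivity),
    show (2 : ℝ≥0∞) = ENNReal.ofReal 2 by simp, ← ENNReal.ofReal_mul (by norm_num)]
  refine ENNReal.ofReal_le_ofReal ?_
  have := norm_add_le z w
  nlinarith [norm_nonneg (z + w), sq_nonneg (‖z‖ - ‖w‖), norm_nonneg z, norm_nonneg w]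

theorem norm_sq_ray (x v : ℝ) : ‖(x : ℂ) + (x * v : ℝ) * Complex.I‖ ^ 2 = x ^ 2 * (1 + v ^ 2) := by
  rw [← Complex.normSq_eq_norm_sq, Complex.normSq_apply]; simp; ring

theorem inv_ray {x : ℝ} (hx : 0 < x) (v : ℝ) :
    ((x : ℂ) + (x * v : ℝ) * Complex.I)⁻¹ =
      ((x * (1 + v ^ 2))⁻¹ : ℝ) + (-1 * ((x * (1 + v ^ 2))⁻¹ * v) : ℝ) * Complex.I := by
  have hv : 0 < 1 + v ^ 2 := by positivity
  refine inv_eq_of_mul_eq_one_right ?_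
  have hv' : (1 + (v : ℂ) ^ 2) ≠ 0 := by exact_mod_cast hv.ne'
  have hx' : (x : ℂ) ≠ 0 := by exact_mod_cast hx.ne'
  push_cast
  field_simp
  linear_combination (-(v : ℂ) ^ 2) * Complex.I_sq

/-- The corrected difference is the series of `a - b` up to the pole term, which is small for
`|z| ≥ 1`. -/
theorem enorm_thetaDiff_sq_le_sqNorm_add {a b : ℕ → ℂ} (ha : Subexponential a) (hb : Subexponential b)
    {l : ℝ} (hl : 0 < l) (κ : ℂ) {z : ℂ} (hz : 0 < z.re) :
    ‖thetaDiff a b l κ z‖ₑ ^ (2 : ℝ) ≤ 2 * (sqNorm (a - b) l z +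
      ENNReal.ofReal (‖κ‖ ^ 2 * Real.exp (-(2 * l * z.re)) * (‖z‖ ^ 2)⁻¹)) := by
  rw [thetaDiff, ← expSeries_sub ha hb hl hz, sub_eq_add_neg]
  refine (enorm_sq_add_le _ _).trans ?_
  rw [sqNorm_of_pos hz, enorm_neg, enorm_sq (κ * _ / z)]
  gcongr
  rw [norm_div, norm_mul, div_pow, mul_pow, Complex.norm_exp, ← Real.exp_nat_mul, div_eq_mul_inv]
  gcongr
  simp; linarith

/-- Near the origin, the functional equation expresses the theta series at `z` by its value at
`1 / z`. -/
theorem SelfDual.exists_enorm_thetaDiff_sq_le {a b : ℕ → ℂ} {l : ℝ} {κ : ℂ} (ha : SelfDual a l κ)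
    (hb : AbsConvergent b) {ε : ℝ} (hε : 0 < ε) (hε1 : ε ≤ 1) :
    ∃ C : ℝ, 0 ≤ C ∧ ∀ z : ℂ, 0 < z.re → ‖z‖ < 1 → ‖thetaDiff a b l κ z‖ₑ ^ (2 : ℝ) ≤
      2 * (ENNReal.ofReal ((‖z‖ ^ 2)⁻¹) * sqNorm a l z⁻¹ +
        ENNReal.ofReal (C * z.re ^ (-2 * ε))) := by
  have hl := ha.pos
  obtain ⟨C, hC0, hC⟩ := exists_norm_expSeries_le_rpow hb.zero hε hε1 (hb.summable ε hε) hl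
  refine ⟨(‖κ‖ * (l * Real.exp l) + ‖κ‖ + C) ^ 2, by positivity, fun z hz hz1 => ?_⟩
  have hz0 : z ≠ 0 := by rintro rfl; simp at hz
  have hnz : 0 < ‖z‖ := norm_pos_iff.2 hz0
  -- The functional equation turns the series of `a` into its value at `1 / z`; the pole it creates
  -- is cancelled by the correction term, and everything else is `O((Re z) ^ (-ε))`.
  have hA : expSeries a l z = z⁻¹ * (κ + expSeries a l z⁻¹) - κ := by
    rw [ha.feq z hz]; field_simp; ring
  have hG : thetaDiff a b l κ z = z⁻¹ * expSeries a l z⁻¹ +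
      (κ * (1 - Complex.exp (-l * z)) / z - κ - expSeries b l z) := by
    rw [thetaDiff, hA]; field_simp; ring
  have hzi : 0 < (z⁻¹).re := by
    rw [Complex.inv_re]; exact div_pos hz (Complex.normSq_pos.2 hz0)
  rw [hG]
  refine (enorm_sq_add_le _ _).trans ?_
  rw [sqNorm_of_pos hzi, enorm_sq, enorm_sq, enorm_sq, norm_mul, norm_inv, mul_pow, inv_pow,
    ENNReal.ofReal_mul (by positivity)]
  gcongr
  have hre1 : z.re ≤ 1 := (Complex.re_le_norm z).trans hz1.le
  have h1 : (1 : ℝ) ≤ z.re ^ (-ε) := Real.one_le_rpow_of_pos_of_le_one_of_nonpos hz hre1 (by linarith)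
  have hexp : ‖κ * (1 - Complex.exp (-l * z)) / z‖ ≤ ‖κ‖ * (l * Real.exp l) := by
    have h2 : ‖1 - Complex.exp (-l * z)‖ ≤ l * ‖z‖ * Real.exp (l * ‖z‖) := by
      have := Complex.norm_exp_sub_sum_le_norm_mul_exp (-l * z) 1
      simp only [Finset.range_one, Finset.sum_singleton, pow_zero, Nat.factorial_zero,
        Nat.cast_one, div_one, pow_one] at this
      rw [norm_sub_rev]
      refine this.trans (le_of_eq ?_)
      rw [norm_mul, norm_neg, Complex.norm_real, Real.norm_of_nonneg hl.le]
    rw [norm_div, norm_mul, div_le_iff₀ hnz, mul_assoc]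
    refine mul_le_mul_of_nonneg_left (h2.trans ?_) (norm_nonneg _)
    rw [mul_right_comm]
    gcongr
    nlinarith
  have hsum : ‖κ * (1 - Complex.exp (-l * z)) / z - κ - expSeries b l z‖ ≤
      (‖κ‖ * (l * Real.exp l) + ‖κ‖ + C) * z.re ^ (-ε) := by
    refine (norm_sub_le _ _).trans ?_
    rw [add_mul]
    refine add_le_add ((norm_sub_le _ _).trans ?_) (hC z hz)
    have h0 : 0 ≤ ‖κ‖ * (l * Real.exp l) + ‖κ‖ := by positivity
    calc _ ≤ ‖κ‖ * (l * Real.exp l) + ‖κ‖ := add_le_add hexp le_rfl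
      _ ≤ _ := le_mul_of_one_le_right h0 h1
  calc _ ≤ ((‖κ‖ * (l * Real.exp l) + ‖κ‖ + C) * z.re ^ (-ε)) ^ 2 := by gcongr
    _ = _ := by
      rw [mul_pow, ← Real.rpow_natCast (z.re ^ (-ε)), ← Real.rpow_mul hz.le]
      congr 2; push_cast; ring

/-- The inversion `z ↦ 1 / z` maps the part `|z| < 1` of a ray to the part `|z| > 1` of the
conjugate ray. -/
theorem lintegral_inner_le {f : ℂ → ℝ≥0∞} {α β : ℝ} (hβ : α ≤ β) (v : ℝ) :
    ∫⁻ x in Ioi (0 : ℝ), outerᶜ.indicator (fun p : ℝ × ℝ =>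
        ENNReal.ofReal ((p.1 ^ 2 * (1 + p.2 ^ 2))⁻¹) *
          f ((p.1 : ℂ) + (p.1 * p.2 : ℝ) * Complex.I)⁻¹) (x, v) * weight α β x ≤
    ∫⁻ y in Ioi (0 : ℝ), outer.indicator (fun p : ℝ × ℝ =>
        f ((p.1 : ℂ) + (-1 * (p.1 * p.2) : ℝ) * Complex.I) *
          ENNReal.ofReal ((p.1 ^ 2 * (1 + p.2 ^ 2)) ^ (-(2 * α - 1)))) (y, v) * weight α β y := by
  set k := 1 + v ^ 2 with hk
  have hk0 : 0 < k := by positivity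
  have himg : (fun y : ℝ => (y * k)⁻¹) '' Ioi 0 = Ioi 0 := by
    ext x
    constructor
    · rintro ⟨y, hy, rfl⟩
      have hy : 0 < y := hy
      exact mem_Ioi.2 (by positivity)
    · intro hx
      have hx : 0 < x := hx
      exact ⟨(x * k)⁻¹, mem_Ioi.2 (by positivity), by field_simp⟩
  have hder : ∀ y ∈ Ioi (0 : ℝ), HasDerivWithinAt (fun y : ℝ => (y * k)⁻¹) (-k / (y * k) ^ 2)
      (Ioi 0) y := fun y hy => by
    have hy : 0 < y := hy
    simpa only [id_eq, one_mul] using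
      (((hasDerivAt_id y).mul_const k).fun_inv (mul_pos hy hk0).ne').hasDerivWithinAt
  have hinj : InjOn (fun y : ℝ => (y * k)⁻¹) (Ioi 0) := fun x _ y _ hxy => by
    simpa [hk0.ne'] using hxy
  conv_lhs => rw [← himg]
  rw [lintegral_image_eq_lintegral_abs_deriv_mul measurableSet_Ioi hder hinj]
  refine setLIntegral_mono' measurableSet_Ioi fun y hy => ?_
  have hy : 0 < y := hy
  have hyk : 0 < y * k := by positivity
  by_cases hin : ((y * k)⁻¹, v) ∈ outerᶜ
  swap
  · rw [indicator_of_notMem hin]; simp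
  have hlt : ((y * k)⁻¹) ^ 2 * k < 1 := not_le.1 hin
  have hone : 1 ≤ y ^ 2 * k := by
    by_contra hcon
    push Not at hcon
    have : ((y * k)⁻¹) ^ 2 * k = (y ^ 2 * k)⁻¹ := by field_simp
    rw [this] at hlt
    exact absurd (one_lt_inv₀ (by positivity) |>.2 hcon) (not_lt.2 hlt.le)
  have hout : (y, v) ∈ outer := hone
  rw [indicator_of_mem hin, indicator_of_mem hout]
  simp only
  rw [inv_ray (by positivity), ← hk]
  have e1 : ((y * k)⁻¹ * k)⁻¹ = y := by field_simp
  rw [e1]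
  have e2 : ENNReal.ofReal |-k / (y * k) ^ 2| * ENNReal.ofReal ((((y * k)⁻¹) ^ 2 * k)⁻¹) = 1 := by
    rw [← ENNReal.ofReal_mul (abs_nonneg _), neg_div, abs_neg, abs_of_pos (by positivity)]
    rw [show k / (y * k) ^ 2 * (((y * k)⁻¹) ^ 2 * k)⁻¹ = 1 by field_simp]
    simp
  have e3 : weight α β ((y * k)⁻¹) ≤
      ENNReal.ofReal ((y ^ 2 * k) ^ (-(2 * α - 1))) * weight α β y := by
    have e4 : ∀ s : ℝ, α ≤ s → ENNReal.ofReal (((y * k)⁻¹) ^ (2 * s - 1)) ≤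
        ENNReal.ofReal ((y ^ 2 * k) ^ (-(2 * α - 1))) * ENNReal.ofReal (y ^ (2 * s - 1)) := by
      intro s hs
      rw [← ENNReal.ofReal_mul (by positivity)]
      refine ENNReal.ofReal_le_ofReal ?_
      calc ((y * k)⁻¹) ^ (2 * s - 1) = (y ^ 2 * k) ^ (-(2 * s - 1)) * y ^ (2 * s - 1) := by
            rw [Real.rpow_neg (by positivity), ← Real.inv_rpow (by positivity),
              ← Real.mul_rpow (by positivity) hy.le]
            congr 1; field_simp
        _ ≤ _ := by
            gcongr
    rw [weight, weight, mul_add (ENNReal.ofReal _)]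
    exact add_le_add (e4 α le_rfl) (e4 β hβ)
  calc _ = (ENNReal.ofReal |-k / (y * k) ^ 2| * ENNReal.ofReal ((((y * k)⁻¹) ^ 2 * k)⁻¹)) *
        (f ((y : ℂ) + (-1 * (y * v) : ℝ) * Complex.I) * weight α β ((y * k)⁻¹)) := by ring
    _ ≤ f ((y : ℂ) + (-1 * (y * v) : ℝ) * Complex.I) *
        (ENNReal.ofReal ((y ^ 2 * k) ^ (-(2 * α - 1))) * weight α β y) := by
        rw [e2, one_mul]; gcongr
    _ = _ := by ring

end EpsteinZeta

namespace EpsteinZeta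
open Set ENNReal

/-! ### Mean squares of the theta difference over sectors -/

theorem lintegral_lineSum_ne_top {α β l : ℝ} (hα : 0 < α) (hβ : α ≤ β) (hl : 0 < l) {d : ℕ → ℂ}
    (hd0 : d 0 = 0) (hd : Summable fun m : ℕ => ‖d m‖ ^ 2 * (m : ℝ) ^ (-2 * α)) :
    ∫⁻ x in Ioi (0 : ℝ), lineSum d l x * weight α β x ≠ ∞ := by
  obtain ⟨C, -, hC⟩ := exists_lintegral_lineSum_le hα hβ hl
  refine ne_top_of_le_ne_top (ENNReal.mul_ne_top ENNReal.ofReal_ne_top ?_) (hC d hd0)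
  have := ENNReal.ofReal_tsum_of_nonneg (fun m => by positivity) hd
  have h2 : ∀ m : ℕ, ‖d m‖ₑ ^ (2 : ℝ) * ENNReal.ofReal ((m : ℝ) ^ (-2 * α)) =
      ENNReal.ofReal (‖d m‖ ^ 2 * (m : ℝ) ^ (-2 * α)) := fun m => by
    rw [enorm_sq, ENNReal.ofReal_mul (by positivity)]
  simp_rw [h2, ← this]
  exact ENNReal.ofReal_ne_top

theorem tendsto_ofReal_rpow_neg {x c : ℝ} (hx : 0 < x) (hc : 0 < c) :
    Tendsto (fun v : ℝ => ENNReal.ofReal ((x ^ 2 * (1 + v ^ 2)) ^ (-c))) atTop (𝓝 0) := by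
  have h1 : Tendsto (fun v : ℝ => x ^ 2 * (1 + v ^ 2)) atTop atTop := by
    refine Tendsto.const_mul_atTop (by positivity) ?_
    exact tendsto_atTop_add_const_left _ _ (tendsto_pow_atTop two_ne_zero)
  have := ENNReal.tendsto_ofReal ((tendsto_rpow_neg_atTop hc).comp h1)
  simpa using this

variable {a : ℕ → ℂ} {l : ℝ} {κ : ℂ} {α β : ℝ}

/-- The image under `z ↦ 1 / z` of the part `|z| < 1` of the theta series is negligible, because for
`α > 1 / 2` the inverted weight decreases along each line `Re z = x`. -/
theorem SelfDual.tendsto_sectorAvg_inverted (ha : SelfDual a l κ) (hα : 1 / 2 < α) (hβ : α ≤ β) :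
    Tendsto (sectorAvg (weight α β) (outer.indicator (fun p : ℝ × ℝ =>
        sqNorm a l ((p.1 : ℂ) + (-1 * (p.1 * p.2) : ℝ) * Complex.I) *
          ENNReal.ofReal ((p.1 ^ 2 * (1 + p.2 ^ 2)) ^ (-(2 * α - 1)))))) atTop (𝓝 0) := by
  have hm := measurable_sqNorm ha.subexponential ha.pos
  have hS := lintegral_lineSum_ne_top (l := l) (by linarith) hβ ha.pos ha.zero (ha.summable_sq α hα)
  refine tendsto_sectorAvg_zero (B := fun x => ENNReal.ofReal (1 + 4 * Real.pi / l) * lineSum a l x)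
    (Measurable.indicator (by fun_prop) measurableSet_outer)
    (measurable_weight α β) (weight_ne_top α β) ?_ ?_ ?_
  · simp_rw [mul_assoc]
    rw [lintegral_const_mul' _ _ ENNReal.ofReal_ne_top]
    exact ENNReal.mul_ne_top ENNReal.ofReal_ne_top hS
  · intro T hT x hx
    refine le_trans (mul_le_mul_right (lintegral_mono fun v => ?_) _)
      (lintegral_outer_sqNorm_le ha.subexponential ha.pos hx hT (Or.inr rfl))
    by_cases h : (x, v) ∈ outer
    · rw [indicator_of_mem h, indicator_of_mem h]
      refine mul_le_of_le_one_right' ?_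
      rw [← ENNReal.ofReal_one]
      exact ENNReal.ofReal_le_ofReal (Real.rpow_le_one_of_one_le_of_nonpos h (by linarith))
    · rw [indicator_of_notMem h, indicator_of_notMem h]
  · intro x hx
    obtain ⟨C, hC0, hC⟩ := exists_norm_expSeries_le ha.subexponential ha.zero ha.pos hx
    set M := ENNReal.ofReal ((C * Real.exp (-(l / 2) * x)) ^ 2)
    have hsq : ∀ v : ℝ, sqNorm a l ((x : ℂ) + (-1 * (x * v) : ℝ) * Complex.I) ≤ M := by
      intro v
      rw [sqNorm_of_pos (by simpa using hx), enorm_sq]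
      refine ENNReal.ofReal_le_ofReal ?_
      have := hC ((x : ℂ) + (-1 * (x * v) : ℝ) * Complex.I) (by simp)
      have h2 : ((x : ℂ) + (-1 * (x * v) : ℝ) * Complex.I).re = x := by simp
      rw [h2] at this
      gcongr
    refine tendsto_average_zero (M := M) ENNReal.ofReal_ne_top (fun v _ => ?_) ?_
    · by_cases h : (x, v) ∈ outer
      · rw [indicator_of_mem h]
        refine le_trans (mul_le_of_le_one_right' ?_) (hsq v)
        rw [← ENNReal.ofReal_one]
        exact ENNReal.ofReal_le_ofReal (Real.rpow_le_one_of_one_le_of_nonpos h (by linarith))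
      · rw [indicator_of_notMem h]; exact zero_le
    · have hlim := ENNReal.Tendsto.const_mul (a := M)
        (tendsto_ofReal_rpow_neg hx (show 0 < 2 * α - 1 by linarith)) (Or.inr ENNReal.ofReal_ne_top)
      rw [mul_zero] at hlim
      refine tendsto_of_tendsto_of_tendsto_of_le_of_le tendsto_const_nhds hlim
        (fun _ => zero_le) fun v => ?_
      refine (indicator_le_self _ _ _).trans ?_
      exact mul_le_mul_left (hsq v) _

theorem ofReal_one_div_mul_lintegral_le {T : ℝ} (hT : 1 ≤ T) {f : ℝ → ℝ≥0∞} {M : ℝ≥0∞}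
    (hf : ∀ v, f v ≤ M) : ENNReal.ofReal (1 / T) * ∫⁻ v in Ioo 0 T, f v ≤ M := by
  have hT0 : 0 < T := by linarith
  calc _ ≤ ENNReal.ofReal (1 / T) * ∫⁻ _ in Ioo 0 T, M := by
        gcongr; exact hf _
    _ = M := by
        rw [setLIntegral_const, Real.volume_Ioo, sub_zero, mul_left_comm,
          ← ENNReal.ofReal_mul (by positivity), one_div_mul_cancel hT0.ne']
        simp

/-- The pole term is negligible in the part `|z| ≥ 1` of the sectors. -/
theorem tendsto_sectorAvg_pole (hl : 0 < l) (κ : ℂ) (hα : 0 < α) (hβ : α ≤ β) :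
    Tendsto (sectorAvg (weight α β) (outer.indicator (fun p : ℝ × ℝ =>
        ENNReal.ofReal (‖κ‖ ^ 2 * Real.exp (-(2 * l * p.1)) * (p.1 ^ 2 * (1 + p.2 ^ 2))⁻¹))))
      atTop (𝓝 0) := by
  have hle : ∀ x v : ℝ, outer.indicator (fun p : ℝ × ℝ =>
        ENNReal.ofReal (‖κ‖ ^ 2 * Real.exp (-(2 * l * p.1)) * (p.1 ^ 2 * (1 + p.2 ^ 2))⁻¹)) (x, v) ≤
      ENNReal.ofReal (‖κ‖ ^ 2 * Real.exp (-(2 * l * x))) := by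
    intro x v
    by_cases h : (x, v) ∈ outer
    · rw [indicator_of_mem h]
      exact ENNReal.ofReal_le_ofReal (mul_le_of_le_one_right (by positivity) (inv_le_one_of_one_le₀ h))
    · rw [indicator_of_notMem h]; exact zero_le
  refine tendsto_sectorAvg_zero
    (B := fun x => ENNReal.ofReal (‖κ‖ ^ 2 * Real.exp (-(2 * l * x))))
    (Measurable.indicator (by fun_prop) measurableSet_outer)
    (measurable_weight α β) (weight_ne_top α β) ?_ ?_ ?_
  · simp_rw [ENNReal.ofReal_mul (sq_nonneg ‖κ‖), mul_assoc]
    rw [lintegral_const_mul' _ _ ENNReal.ofReal_ne_top]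
    simp_rw [← mul_assoc]
    rw [lintegral_exp_mul_weight hα (by linarith) (by positivity)]
    simp [ENNReal.mul_ne_top]
  · intro T hT x hx
    exact ofReal_one_div_mul_lintegral_le hT (hle x)
  · intro x hx
    refine tendsto_average_zero ENNReal.ofReal_ne_top (fun v _ => hle x v) ?_
    have hlim := ENNReal.Tendsto.const_mul (a := ENNReal.ofReal (‖κ‖ ^ 2 * Real.exp (-(2 * l * x))))
        (tendsto_ofReal_rpow_neg hx one_pos) (Or.inr ENNReal.ofReal_ne_top)
    rw [mul_zero] at hlim
    refine tendsto_of_tendsto_of_tendsto_of_le_of_le tendsto_const_nhds hlim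
        (fun _ => zero_le) fun v => ?_
    refine (indicator_le_self _ _ _).trans (le_of_eq ?_)
    rw [← ENNReal.ofReal_mul (by positivity), Real.rpow_neg_one]

/-- The terms of size `(Re z) ^ (-ε)` are negligible in the part `|z| < 1` of the sectors, which
each line `Re z = x` leaves after a bounded range of slopes. -/
theorem tendsto_sectorAvg_inner (C : ℝ) {ε : ℝ} (hC : 0 ≤ C) (hε : ε < α) (hβ : α ≤ β) :
    Tendsto (sectorAvg (weight α β) (outerᶜ.indicator (fun p : ℝ × ℝ =>
        ENNReal.ofReal (C * p.1 ^ (-2 * ε))))) atTop (𝓝 0) := by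
  have hinn : ∀ x v : ℝ, 0 < x → (x, v) ∈ outerᶜ → x < 1 ∧ v < 1 / x := by
    intro x v hx h
    have h : x ^ 2 * (1 + v ^ 2) < 1 := not_le.1 h
    constructor
    · nlinarith [sq_nonneg (x * v)]
    · rw [lt_div_iff₀ hx]; nlinarith [sq_nonneg (x * v - 1)]
  refine tendsto_sectorAvg_zero
    (B := (Iio 1).indicator fun x => ENNReal.ofReal (C * x ^ (-2 * ε)))
    (Measurable.indicator (by fun_prop) measurableSet_outer.compl)
    (measurable_weight α β) (weight_ne_top α β) ?_ ?_ ?_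
  · have h1 : ∀ x ∈ Ioi (0 : ℝ), (Iio 1).indicator (fun x => ENNReal.ofReal (C * x ^ (-2 * ε))) x *
        weight α β x = (Iio (1 : ℝ)).indicator (fun x => ENNReal.ofReal (C * x ^ (2 * α - 2 * ε - 1) +
          C * x ^ (2 * β - 2 * ε - 1))) x := by
      intro x hx
      have hx : 0 < x := hx
      by_cases h : x ∈ Iio (1 : ℝ)
      · rw [indicator_of_mem h, indicator_of_mem h, weight, mul_add,
          ← ENNReal.ofReal_mul (by positivity), ← ENNReal.ofReal_mul (by positivity),
          ENNReal.ofReal_add (by positivity) (by positivity), mul_assoc, mul_assoc,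
          ← Real.rpow_add hx, ← Real.rpow_add hx]
        congr 4 <;> ring
      · rw [indicator_of_notMem h, indicator_of_notMem h, zero_mul]
    rw [setLIntegral_congr_fun measurableSet_Ioi h1, lintegral_indicator measurableSet_Iio,
      Measure.restrict_restrict measurableSet_Iio, Iio_inter_Ioi]
    have hint : IntegrableOn (fun x : ℝ => C * x ^ (2 * α - 2 * ε - 1) +
          C * x ^ (2 * β - 2 * ε - 1)) (Ioo 0 1) := by
      refine Integrable.add (Integrable.const_mul ?_ _) (Integrable.const_mul ?_ _)
      · exact (intervalIntegral.integrableOn_Ioo_rpow_iff one_pos).2 (by linarith)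
      · exact (intervalIntegral.integrableOn_Ioo_rpow_iff one_pos).2 (by linarith)
    exact hint.lintegral_lt_top.ne
  · intro T hT x hx
    refine ofReal_one_div_mul_lintegral_le hT fun v => ?_
    by_cases h : (x, v) ∈ outerᶜ
    · rw [indicator_of_mem h, indicator_of_mem (show x ∈ Iio 1 from (hinn x v hx h).1)]
    · rw [indicator_of_notMem h]; exact zero_le
  · intro x hx
    refine tendsto_average_zero (M := ENNReal.ofReal (C * x ^ (-2 * ε))) ENNReal.ofReal_ne_top
      (fun v _ => indicator_le_self _ _ _) ?_
    refine tendsto_const_nhds.congr' ?_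
    filter_upwards [eventually_ge_atTop (1 / x)] with v hv
    rw [indicator_of_notMem]
    exact fun h => absurd (hinn x v hx h).2 (not_lt.2 hv)

/-- The sector averages of the corrected difference of theta series are asymptotically dominated by
the square sums of the coefficients of the difference. -/
theorem SelfDual.exists_sectorAvg_le (ha : SelfDual a l κ) {b : ℕ → ℂ} (hb : AbsConvergent b)
    (hα : 1 / 2 < α) (hβ : α ≤ β) :
    ∃ E : ℝ → ℝ≥0∞, Tendsto E atTop (𝓝 0) ∧ ∀ T : ℝ, 1 ≤ T →
      sectorAvg (weight α β) (fun p =>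
        ‖thetaDiff a b l κ ((p.1 : ℂ) + (p.1 * p.2 : ℝ) * Complex.I)‖ₑ ^ (2 : ℝ)) T ≤
      2 * (ENNReal.ofReal (1 + 4 * Real.pi / l) *
        ∫⁻ x in Ioi (0 : ℝ), lineSum (a - b) l x * weight α β x) + E T := by
  -- Any `ε ≤ 1` with `0 < ε < α` serves here.
  obtain ⟨C, hC0, hC⟩ := ha.exists_enorm_thetaDiff_sq_le hb (ε := 1 / 4) (by norm_num) (by norm_num)
  have hd := ha.subexponential.sub hb.subexponential
  have hw := measurable_weight α β
  have hwt := weight_ne_top α β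
  -- For `|z| ≥ 1`: the main term `K₁` and the pole term `K₂`. For `|z| < 1`: the remaining terms
  -- `K₃` and the inverted theta series `K₄`, which the substitution `z ↦ 1 / z` turns into `K₅`.
  set K₁ : ℝ × ℝ → ℝ≥0∞ := outer.indicator (fun p : ℝ × ℝ =>
    sqNorm (a - b) l (p.1 + (1 * (p.1 * p.2) : ℝ) * Complex.I)) with hK₁
  set K₂ : ℝ × ℝ → ℝ≥0∞ := outer.indicator (fun p : ℝ × ℝ =>
    ENNReal.ofReal (‖κ‖ ^ 2 * Real.exp (-(2 * l * p.1)) * (p.1 ^ 2 * (1 + p.2 ^ 2))⁻¹)) with hK₂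
  set K₃ : ℝ × ℝ → ℝ≥0∞ := outerᶜ.indicator (fun p : ℝ × ℝ =>
    ENNReal.ofReal (C * p.1 ^ (-2 * (1 / 4 : ℝ)))) with hK₃
  set K₄ : ℝ × ℝ → ℝ≥0∞ := outerᶜ.indicator (fun p : ℝ × ℝ =>
    ENNReal.ofReal ((p.1 ^ 2 * (1 + p.2 ^ 2))⁻¹) *
      sqNorm a l ((p.1 : ℂ) + (p.1 * p.2 : ℝ) * Complex.I)⁻¹) with hK₄
  set K₅ : ℝ × ℝ → ℝ≥0∞ := outer.indicator (fun p : ℝ × ℝ =>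
    sqNorm a l ((p.1 : ℂ) + (-1 * (p.1 * p.2) : ℝ) * Complex.I) *
      ENNReal.ofReal ((p.1 ^ 2 * (1 + p.2 ^ 2)) ^ (-(2 * α - 1)))) with hK₅
  have hmd := measurable_sqNorm hd ha.pos
  have hm₁ : Measurable K₁ := Measurable.indicator (by fun_prop) measurableSet_outer
  have hm₂ : Measurable K₂ := Measurable.indicator (by fun_prop) measurableSet_outer
  have hm₃ : Measurable K₃ := Measurable.indicator (by fun_prop) measurableSet_outer.compl
  refine ⟨fun T => 2 * (sectorAvg (weight α β) K₂ T + (sectorAvg (weight α β) K₃ T +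
    sectorAvg (weight α β) K₅ T)), ?_, fun T hT => ?_⟩
  · have := ENNReal.Tendsto.const_mul (a := 2)
      ((tendsto_sectorAvg_pole ha.pos κ (by linarith) hβ).add
        ((tendsto_sectorAvg_inner C (ε := 1 / 4) hC0 (by linarith) hβ).add
          (ha.tendsto_sectorAvg_inverted hα hβ))) (Or.inr (by simp))
    rwa [add_zero, add_zero, mul_zero] at this
  · have hpt : ∀ x : ℝ, 0 < x → ∀ v : ℝ, 0 < v →
        ‖thetaDiff a b l κ ((x : ℂ) + (x * v : ℝ) * Complex.I)‖ₑ ^ (2 : ℝ) ≤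
        2 * (K₁ (x, v) + (K₂ (x, v) + (K₃ (x, v) + K₄ (x, v)))) := by
      intro x hx v hv
      have hre : ((x : ℂ) + (x * v : ℝ) * Complex.I).re = x := by simp
      by_cases h : (x, v) ∈ outer
      · have h' : (x, v) ∉ outerᶜ := fun hc => hc h
        rw [hK₁, hK₂, hK₃, hK₄, indicator_of_mem h, indicator_of_mem h, indicator_of_notMem h',
          indicator_of_notMem h', add_zero, add_zero]
        have := enorm_thetaDiff_sq_le_sqNorm_add ha.subexponential hb.subexponential ha.pos κ
          (z := (x : ℂ) + (x * v : ℝ) * Complex.I) (by rw [hre]; exact hx)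
        rw [hre, norm_sq_ray] at this
        simpa only [one_mul] using this
      · have h' : (x, v) ∈ outerᶜ := h
        rw [hK₁, hK₂, hK₃, hK₄, indicator_of_mem h', indicator_of_mem h', indicator_of_notMem h,
          indicator_of_notMem h, zero_add, zero_add, add_comm (ENNReal.ofReal (C * _))]
        have hlt : x ^ 2 * (1 + v ^ 2) < 1 := not_le.1 h
        have := hC ((x : ℂ) + (x * v : ℝ) * Complex.I) (by rw [hre]; exact hx)
          (by rw [← norm_sq_ray] at hlt; nlinarith [norm_nonneg ((x : ℂ) + (x * v : ℝ) * Complex.I)])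
        rwa [hre, norm_sq_ray] at this
    have h₁ : sectorAvg (weight α β) K₁ T ≤ ENNReal.ofReal (1 + 4 * Real.pi / l) *
        ∫⁻ x in Ioi (0 : ℝ), lineSum (a - b) l x * weight α β x := by
      refine (sectorAvg_le hw hwt hm₁ fun x hx =>
        lintegral_outer_sqNorm_le hd ha.pos hx hT (Or.inl rfl)).trans (le_of_eq ?_)
      simp_rw [mul_assoc]
      rw [lintegral_const_mul' _ _ ENNReal.ofReal_ne_top]
    have h₄ : sectorAvg (weight α β) K₄ T ≤ sectorAvg (weight α β) K₅ T :=
      mul_le_mul_right (lintegral_mono fun v => lintegral_inner_le hβ v) _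
    refine (sectorAvg_mono (K' := fun p => 2 * (K₁ p + (K₂ p + (K₃ p + K₄ p)))) hpt).trans ?_
    rw [sectorAvg_const_mul _ (by simp), sectorAvg_add hw hm₁, sectorAvg_add hw hm₂,
      sectorAvg_add hw hm₃, mul_add]
    exact add_le_add (mul_le_mul_right h₁ _)
      (mul_le_mul_right (add_le_add le_rfl (add_le_add le_rfl h₄)) _)

end EpsteinZeta

namespace EpsteinZeta
open Set

/-! ### Mellin transforms along rotated rays -/

theorem integrableOn_rpow_mul_exp {σ r : ℝ} (hσ : 0 < σ) (hr : 0 < r) :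
    IntegrableOn (fun x : ℝ => x ^ (σ - 1) * Real.exp (-(r * x))) (Ioi 0) := by
  have h := lintegral_rpow_mul_exp hσ hr
  refine ⟨by fun_prop, ?_⟩
  rw [hasFiniteIntegral_iff_ofReal, h]
  · exact ENNReal.ofReal_lt_top
  · filter_upwards [self_mem_ae_restrict measurableSet_Ioi] with x hx
    have hx : 0 < x := hx
    positivity

theorem norm_cpow_mul_exp {s r : ℂ} {x : ℝ} (hx : 0 < x) :
    ‖(x : ℂ) ^ (s - 1) * Complex.exp (-r * x)‖ = x ^ (s.re - 1) * Real.exp (-(r.re * x)) := by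
  rw [norm_mul, Complex.norm_cpow_eq_rpow_re_of_pos hx, Complex.norm_exp]
  simp

theorem integrableOn_cpow_mul_exp {s r : ℂ} (hs : 0 < s.re) (hr : 0 < r.re) :
    IntegrableOn (fun x : ℝ => (x : ℂ) ^ (s - 1) * Complex.exp (-r * x)) (Ioi 0) := by
  refine (integrableOn_rpow_mul_exp hs hr).mono' (by fun_prop) ?_
  filter_upwards [self_mem_ae_restrict measurableSet_Ioi] with x hx
  rw [norm_cpow_mul_exp hx]

theorem differentiableAt_integral_cpow_mul_exp {s r : ℂ} (hs : 0 < s.re) (hr : 0 < r.re) :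
    DifferentiableAt ℂ
      (fun r : ℂ => ∫ x : ℝ in Ioi 0, (x : ℂ) ^ (s - 1) * Complex.exp (-r * x)) r := by
  have hopen : {w : ℂ | r.re / 2 < w.re} ∈ 𝓝 r :=
    (isOpen_lt continuous_const Complex.continuous_re).mem_nhds (by simpa using hr)
  refine (hasDerivAt_integral_of_dominated_loc_of_deriv_le
    (F := fun (r : ℂ) (x : ℝ) => (x : ℂ) ^ (s - 1) * Complex.exp (-r * x))
    (F' := fun (r : ℂ) (x : ℝ) => (x : ℂ) ^ (s - 1) * (Complex.exp (-r * x) * (-x)))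
    (bound := fun x : ℝ => x ^ (s.re + 1 - 1) * Real.exp (-(r.re / 2 * x)))
    hopen ?_ (integrableOn_cpow_mul_exp hs hr) (by fun_prop) ?_
    (integrableOn_rpow_mul_exp (by linarith) (by linarith)) ?_).2.differentiableAt
  · exact Eventually.of_forall fun w => by fun_prop
  · filter_upwards [self_mem_ae_restrict measurableSet_Ioi] with x hx w hw
    have hx : 0 < x := hx
    have hw : r.re / 2 < w.re := hw
    rw [← mul_assoc, norm_mul, norm_cpow_mul_exp hx, norm_neg, Complex.norm_real,
      Real.norm_of_nonneg hx.le, mul_right_comm, ← Real.rpow_add_one hx.ne']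
    rw [sub_add_cancel, show s.re + 1 - 1 = s.re by ring]
    refine mul_le_mul_of_nonneg_left (Real.exp_le_exp.2 ?_) (by positivity)
    nlinarith
  · refine Eventually.of_forall fun x w _ => ?_
    refine HasDerivAt.const_mul _ (HasDerivAt.cexp ?_)
    simpa using ((hasDerivAt_id w).neg.mul_const (x : ℂ))

/-- The Mellin transform of `x ↦ e^{-r x}` for complex `r` with positive real part. -/
theorem integral_cpow_mul_exp {s r : ℂ} (hs : 0 < s.re) (hr : 0 < r.re) :
    ∫ x : ℝ in Ioi 0, (x : ℂ) ^ (s - 1) * Complex.exp (-r * x) = r ^ (-s) * Complex.Gamma s := by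
  set U : Set ℂ := {w | 0 < w.re} with hU
  have hUo : IsOpen U := isOpen_lt continuous_const Complex.continuous_re
  have hUc : IsPreconnected U := (convex_halfSpace_re_gt 0).isPreconnected
  have h1 : AnalyticOnNhd ℂ
      (fun r : ℂ => ∫ x : ℝ in Ioi 0, (x : ℂ) ^ (s - 1) * Complex.exp (-r * x)) U :=
    DifferentiableOn.analyticOnNhd (fun w hw =>
      (differentiableAt_integral_cpow_mul_exp hs hw).differentiableWithinAt) hUo
  have h2 : AnalyticOnNhd ℂ (fun r : ℂ => r ^ (-s) * Complex.Gamma s) U := by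
    refine DifferentiableOn.analyticOnNhd (fun w hw => ?_) hUo
    have : w ∈ Complex.slitPlane := Or.inl hw
    exact ((differentiableAt_id.cpow_const this).mul_const _).differentiableWithinAt
  refine h1.eqOn_of_preconnected_of_frequently_eq h2 hUc (z₀ := 1) (by simp [hU]) ?_ hr
  have hreal : ∀ t : ℝ, 0 < t →
      ∫ x : ℝ in Ioi 0, (x : ℂ) ^ (s - 1) * Complex.exp (-(t : ℂ) * x) =
        (t : ℂ) ^ (-s) * Complex.Gamma s := by
    intro t ht
    have := Complex.integral_cpow_mul_exp_neg_mul_Ioi hs ht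
    simp_rw [neg_mul]
    rw [this, one_div, Complex.inv_cpow _ _ (by rw [Complex.arg_ofReal_of_nonneg ht.le]; exact Real.pi_pos.ne),
      Complex.cpow_neg]
  have htend : Tendsto (fun n : ℕ => ((1 + 1 / ((n : ℝ) + 1) : ℝ) : ℂ)) atTop (𝓝[≠] 1) := by
    refine tendsto_nhdsWithin_iff.2 ⟨?_, Eventually.of_forall fun n => ?_⟩
    · have := (tendsto_const_nhds (x := (1 : ℝ))).add (tendsto_one_div_add_atTop_nhds_zero_nat (𝕜 := ℝ))
      rw [add_zero] at this
      exact (Complex.continuous_ofReal.tendsto 1).comp this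
    · have : (0 : ℝ) < 1 / ((n : ℝ) + 1) := by positivity
      simp only [mem_compl_iff, mem_singleton_iff]
      intro h
      have h' : (1 + 1 / ((n : ℝ) + 1) : ℝ) = 1 := by exact_mod_cast h
      linarith
  exact htend.frequently (Frequently.of_forall fun n => hreal _ (by positivity))

/-- The Mellin transform along a ray of an exponential series is its Dirichlet series. -/
theorem hasSum_mellin_expSeries {a : ℕ → ℂ} (ha0 : a 0 = 0) {l : ℝ} (hl : 0 < l) {s : ℂ}
    (hs : 0 < s.re) (ha : Summable fun m : ℕ => ‖a m‖ * (m : ℝ) ^ (-s.re)) {r : ℂ} (hr : 0 < r.re) :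
    HasSum (fun m : ℕ => a m * (((l * m : ℝ) : ℂ) * r) ^ (-s) * Complex.Gamma s)
      (mellin (fun x : ℝ => expSeries a l (x * r)) s) := by
  have hsub := subexponential_of_summable ha0 ha
  set f : ℕ → ℝ → ℂ := fun m x => (x : ℂ) ^ (s - 1) * (a m * Complex.exp (-(l * m) * (x * r))) with hf
  have hf' : ∀ m x, f m x = a m * ((x : ℂ) ^ (s - 1) * Complex.exp (-((l * m : ℝ) * r) * x)) := by
    intro m x
    simp only [hf]
    rw [mul_left_comm]
    congr 3; push_cast; ring
  have hre : ∀ m : ℕ, m ≠ 0 → 0 < (((l * m : ℝ) : ℂ) * r).re := by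
    intro m hm
    have : (0 : ℝ) < m := by exact_mod_cast Nat.pos_of_ne_zero hm
    rw [Complex.re_ofReal_mul]; positivity
  have hint : ∀ m, Integrable (f m) (volume.restrict (Ioi 0)) := by
    intro m
    rcases eq_or_ne m 0 with rfl | hm
    · rw [show f 0 = fun _ => 0 by funext x; simp [hf', ha0]]
      exact integrable_zero _ _ _
    · rw [funext (hf' m)]
      exact (integrableOn_cpow_mul_exp hs (hre m hm)).const_mul _
  have hval : ∀ m, ∫ x in Ioi 0, f m x = a m * (((l * m : ℝ) : ℂ) * r) ^ (-s) * Complex.Gamma s := by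
    intro m
    rcases eq_or_ne m 0 with rfl | hm
    · simp [hf', ha0]
    · simp_rw [hf']
      rw [integral_const_mul, integral_cpow_mul_exp hs (hre m hm), mul_assoc]
  have hnorm : Summable fun m => ∫ x in Ioi 0, ‖f m x‖ := by
    have : ∀ m : ℕ, ∫ x in Ioi 0, ‖f m x‖ =
        ‖a m‖ * (m : ℝ) ^ (-s.re) * ((1 / (l * r.re)) ^ s.re * Real.Gamma s.re) := by
      intro m
      rcases eq_or_ne m 0 with rfl | hm
      · simp [hf', ha0]
      have hm0 : (0 : ℝ) < m := by exact_mod_cast Nat.pos_of_ne_zero hm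
      have h1 : ∀ x ∈ Ioi (0 : ℝ), ‖f m x‖ =
          ‖a m‖ * (x ^ (s.re - 1) * Real.exp (-((l * m * r.re) * x))) := by
        intro x hx
        rw [hf', norm_mul, norm_cpow_mul_exp hx, Complex.re_ofReal_mul]
      rw [setIntegral_congr_fun measurableSet_Ioi h1, integral_const_mul,
        Real.integral_rpow_mul_exp_neg_mul_Ioi hs (by positivity), mul_assoc ‖a m‖]
      congr 1
      rw [← mul_assoc, Real.rpow_neg hm0.le, ← Real.inv_rpow hm0.le,
        ← Real.mul_rpow (by positivity) (by positivity)]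
      congr 2; field_simp
    simp_rw [this]
    exact ha.mul_right _
  have := hasSum_integral_of_summable_integral_norm hint hnorm
  simp_rw [hval] at this
  suffices h : mellin (fun x : ℝ => expSeries a l (x * r)) s = ∫ x in Ioi 0, ∑' m, f m x by
    rw [h]; exact this
  unfold mellin
  refine setIntegral_congr_fun measurableSet_Ioi fun x hx => ?_
  have hx : 0 < x := hx
  simp only [smul_eq_mul, hf]
  rw [tsum_mul_left]; rfl

end EpsteinZeta

namespace EpsteinZeta
open Set Asymptotics

/-! ### Analytic continuation of the Dirichlet series -/

theorem norm_dirichletTerm {a : ℕ → ℂ} (ha0 : a 0 = 0) (s : ℂ) (m : ℕ) :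
    ‖a m * (m : ℂ) ^ (-s)‖ = ‖a m‖ * (m : ℝ) ^ (-s.re) := by
  rcases eq_or_ne m 0 with rfl | hm
  · simp [ha0]
  · rw [norm_mul, Complex.norm_natCast_cpow_of_pos (Nat.pos_of_ne_zero hm), Complex.neg_re]

theorem norm_dirichletTerm_le {a : ℕ → ℂ} (ha0 : a 0 = 0) {s : ℂ} {σ : ℝ} (hs : σ ≤ s.re) (m : ℕ) :
    ‖a m * (m : ℂ) ^ (-s)‖ ≤ ‖a m‖ * (m : ℝ) ^ (-σ) := by
  rw [norm_dirichletTerm ha0]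
  rcases eq_or_ne m 0 with rfl | hm
  · simp [ha0]
  · have : (1 : ℝ) ≤ m := by exact_mod_cast Nat.one_le_iff_ne_zero.2 hm
    gcongr

theorem ofReal_mul_cpow {x : ℝ} (hx : 0 < x) {z : ℂ} (hz : z ≠ 0) (s : ℂ) :
    ((x : ℂ) * z) ^ s = (x : ℂ) ^ s * z ^ s := by
  have hx' : (x : ℂ) ≠ 0 := by exact_mod_cast hx.ne'
  rw [Complex.cpow_def_of_ne_zero (mul_ne_zero hx' hz), Complex.cpow_def_of_ne_zero hx',
    Complex.cpow_def_of_ne_zero hz, Complex.log_ofReal_mul hx hz, Complex.ofReal_log hx.le, add_mul,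
    Complex.exp_add]

theorem cpow_mul_natCast {l : ℝ} (hl : 0 < l) (m : ℕ) {r : ℂ} (hr : r ≠ 0) (s : ℂ) (hm : m ≠ 0) :
    (((l * m : ℝ) : ℂ) * r) ^ (-s) = (m : ℂ) ^ (-s) * (l * r) ^ (-s) := by
  have hm0 : (0 : ℝ) < m := by exact_mod_cast Nat.pos_of_ne_zero hm
  have hl0 : (l : ℂ) ≠ 0 := by exact_mod_cast hl.ne'
  rw [← Complex.ofReal_natCast, ← ofReal_mul_cpow hm0 (mul_ne_zero hl0 hr)]
  push_cast; ring_nf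

/-- Along a ray, the Mellin transform of the exponential series is the Dirichlet series times a
gamma factor. -/
theorem mellin_expSeries {a : ℕ → ℂ} (ha0 : a 0 = 0) {l : ℝ} (hl : 0 < l) {s : ℂ}
    (hs : 0 < s.re) (ha : Summable fun m : ℕ => ‖a m‖ * (m : ℝ) ^ (-s.re)) {r : ℂ} (hr : 0 < r.re) :
    mellin (fun x : ℝ => expSeries a l (x * r)) s =
      (l * r) ^ (-s) * Complex.Gamma s * ∑' m : ℕ, a m * (m : ℂ) ^ (-s) := by
  rw [← (hasSum_mellin_expSeries ha0 hl hs ha hr).tsum_eq, ← tsum_mul_left]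
  refine tsum_congr fun m => ?_
  rcases eq_or_ne m 0 with rfl | hm
  · simp [ha0]
  · rw [cpow_mul_natCast hl m (by rintro rfl; simp at hr) s hm]; ring

theorem isBigO_expSeries_atTop {a : ℕ → ℂ} (ha : Subexponential a) (ha0 : a 0 = 0) {l : ℝ}
    (hl : 0 < l) {r : ℂ} (hr : 0 < r.re) :
    (fun x : ℝ => expSeries a l (x * r)) =O[atTop] fun x : ℝ => Real.exp (-(l / 2 * r.re) * x) := by
  obtain ⟨C, hC0, hC⟩ := exists_norm_expSeries_le ha ha0 hl hr
  refine IsBigO.of_bound C ?_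
  filter_upwards [eventually_ge_atTop (1 : ℝ)] with x hx
  have := hC (x * r) (by rw [Complex.re_ofReal_mul]; nlinarith)
  rw [Complex.re_ofReal_mul] at this
  rw [Real.norm_of_nonneg (Real.exp_pos _).le]
  convert this using 3; ring

theorem continuousOn_expSeries_ray {a : ℕ → ℂ} (ha : Subexponential a) {l : ℝ}
    (hl : 0 < l) {r : ℂ} (hr : 0 < r.re) :
    ContinuousOn (fun x : ℝ => expSeries a l (x * r)) (Ioi 0) :=
  (continuousOn_expSeries ha hl).comp (f := fun x : ℝ => (x : ℂ) * r) (by fun_prop) fun x hx => by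
    have hx : 0 < x := hx
    simp only [mem_ofPred_eq, Complex.re_ofReal_mul]; positivity

namespace SelfDual

variable {a b : ℕ → ℂ} {l : ℝ} {κ : ℂ}

/-- The theta series on the positive real axis, as a pair of functions with a functional
equation. -/
def fePair (ha : SelfDual a l κ) : WeakFEPair ℂ :=
  have hi : LocallyIntegrableOn (fun x : ℝ => κ + expSeries a l x) (Ioi 0) := by
    refine ContinuousOn.locallyIntegrableOn ?_ measurableSet_Ioi
    have := continuousOn_expSeries_ray ha.subexponential ha.pos (r := 1) (by simp)
    simp only [mul_one] at this
    exact continuousOn_const.add this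
  have ht (r : ℝ) : (fun x : ℝ => κ + expSeries a l x - κ) =O[atTop] (· ^ r) := by
    simp only [add_sub_cancel_left]
    have := isBigO_expSeries_atTop ha.subexponential ha.zero ha.pos (r := 1) (by simp)
    simp only [mul_one] at this
    exact this.trans (isLittleO_exp_neg_mul_rpow_atTop
      (by simpa using ha.pos) _).isBigO
  { f := fun x => κ + expSeries a l x
    g := fun x => κ + expSeries a l x
    k := 1
    ε := 1
    f₀ := κ
    g₀ := κ
    hf_int := hi
    hg_int := hi
    hk := one_pos
    hε := one_ne_zero
    h_feq := fun x hx => by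
      have := ha.feq x (by simpa using hx)
      simpa using this
    hf_top := ht
    hg_top := ht }

/-- The Dirichlet series extends to `ℂ ∖ {1}`, with at most a simple pole at `1`. -/
theorem exists_continuation (ha : SelfDual a l κ) :
    ∃ H : ℂ → ℂ, Differentiable ℂ H ∧
      IsContinuation (fun (m : ℕ) s => a m * (m : ℂ) ^ (-s)) fun s => H s / (s - 1) := by
  set P := ha.fePair with hP
  have hl : (l : ℂ) ≠ 0 := by exact_mod_cast ha.pos.ne'
  -- `Γ(s) l^{-s} F(s) = Λ₀(s) - κ / s + κ / (s - 1)`, solved for `(s - 1) F(s)`. The zero of `1 /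
  -- Γ` at `0` removes the pole there, in the form `1 / (s Γ(s)) = 1 / Γ(s + 1)`.
  have hH : Differentiable ℂ (fun s : ℂ => (l : ℂ) ^ s *
      (P.Λ₀ s * (s - 1) * (Complex.Gamma s)⁻¹ - κ * (s - 1) * (Complex.Gamma (s + 1))⁻¹ +
        κ * (Complex.Gamma s)⁻¹)) := by
    have h1 := P.differentiable_Λ₀
    have h2 : Differentiable ℂ fun s : ℂ => (Complex.Gamma s)⁻¹ := Complex.differentiable_one_div_Gamma
    have h3 : Differentiable ℂ fun s : ℂ => (Complex.Gamma (s + 1))⁻¹ :=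
      h2.comp (differentiable_id.add_const 1)
    have h4 : Differentiable ℂ fun s : ℂ => (l : ℂ) ^ s := differentiable_id.const_cpow (Or.inl hl)
    fun_prop
  refine ⟨_, hH, ?_, fun s hs => ?_⟩
  · intro s hs
    have hs : s - 1 ≠ 0 := sub_ne_zero.2 hs
    exact ((hH s).fun_div ((differentiableAt_id (x := s)).sub_const 1) hs).differentiableWithinAt
  · have hs0 : 0 < s.re := by linarith
    have hsum := ha.summable hs
    have h1 := mellin_expSeries ha.zero ha.pos hs0 hsum (r := 1) (by simp)
    have h2 := (P.hasMellin (s := s) (by simpa [hP, fePair] using hs)).2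
    have h3 : mellin (fun x => P.f x - P.f₀) s = mellin (fun x : ℝ => expSeries a l (x * 1)) s := by
      simp [hP, fePair]
    have hval : ∑' m : ℕ, a m * (m : ℂ) ^ (-s) = (l : ℂ) ^ s *
      (P.Λ₀ s * (s - 1) * (Complex.Gamma s)⁻¹ - κ * (s - 1) * (Complex.Gamma (s + 1))⁻¹ +
        κ * (Complex.Gamma s)⁻¹) / (s - 1) := by
      rw [h3, h1, mul_one] at h2
      have hk : P.Λ s = P.Λ₀ s - (1 / s) * κ - (1 / (1 - s)) * κ := by
        simp [WeakFEPair.Λ, hP, fePair]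
      rw [hk] at h2
      have hs1 : s - 1 ≠ 0 := by
        intro h; rw [sub_eq_zero.1 h] at hs; simp at hs
      have hs1' : 1 - s ≠ 0 := by
        intro h; apply hs1; linear_combination -h
      have hsn : s ≠ 0 := by rintro rfl; simp at hs0
      have hG : Complex.Gamma s ≠ 0 := Complex.Gamma_ne_zero_of_re_pos hs0
      have hls : (l : ℂ) ^ s ≠ 0 := by simp [Complex.cpow_eq_zero_iff, hl]
      rw [Complex.Gamma_add_one s hsn]
      rw [Complex.cpow_neg] at h2
      generalize ∑' m : ℕ, a m * (m : ℂ) ^ (-s) = S at h2 ⊢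
      generalize P.Λ₀ s = Y at h2 ⊢
      have hS : S = (l : ℂ) ^ s * (Y - 1 / s * κ - 1 / (1 - s) * κ) / Complex.Gamma s := by
        rw [← h2]; field_simp
      rw [hS, show 1 - s = -(s - 1) by ring]
      field_simp
      ring
    beta_reduce
    rw [← hval]
    refine (Summable.of_norm ?_).hasSum
    simp_rw [norm_dirichletTerm ha.zero]
    exact hsum

end SelfDual

/-- The Dirichlet series `∑ b_m m^{-s}`. -/
def dirichletSeries (b : ℕ → ℂ) (s : ℂ) : ℂ := ∑' m : ℕ, b m * (m : ℂ) ^ (-s)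

theorem AbsConvergent.differentiableAt {b : ℕ → ℂ} (hb : AbsConvergent b) {s : ℂ} (hs : 0 < s.re) :
    DifferentiableAt ℂ (dirichletSeries b) s := by
  have ho : IsOpen {w : ℂ | s.re / 2 < w.re} := isOpen_lt continuous_const Complex.continuous_re
  refine (Complex.differentiableOn_tsum_of_summable_norm (hb.summable (s.re / 2) (by linarith))
    (fun m => ?_) ho fun m w hw => norm_dirichletTerm_le hb.zero (le_of_lt hw) m).differentiableAt
    (ho.mem_nhds (by simpa using hs))
  rcases eq_or_ne m 0 with rfl | hm
  · simp [hb.zero]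
  · exact (differentiable_id.neg.const_cpow (Or.inl (by exact_mod_cast hm))).differentiableOn.const_mul _

end EpsteinZeta

namespace EpsteinZeta
open Set Asymptotics

/-! ### The Mellin transform of the corrected theta difference -/

theorem continuousOn_thetaDiff_ray {a b : ℕ → ℂ} (ha : Subexponential a) (hb : Subexponential b)
    {l : ℝ} (hl : 0 < l) (κ : ℂ) {r : ℂ} (hr : 0 < r.re) :
    ContinuousOn (fun x : ℝ => thetaDiff a b l κ (x * r)) (Ioi 0) := by
  have hr0 : r ≠ 0 := by rintro rfl; simp at hr
  refine ((continuousOn_expSeries_ray ha hl hr).sub (continuousOn_expSeries_ray hb hl hr)).sub ?_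
  refine ContinuousOn.div (by fun_prop) (by fun_prop) fun x hx => ?_
  have hx : 0 < x := hx
  exact mul_ne_zero (by exact_mod_cast hx.ne') hr0

theorem isBigO_thetaDiff_atTop {a b : ℕ → ℂ} (ha : Subexponential a) (ha0 : a 0 = 0)
    (hb : Subexponential b) (hb0 : b 0 = 0) {l : ℝ} (hl : 0 < l) (κ : ℂ) {r : ℂ} (hr : 0 < r.re) :
    (fun x : ℝ => thetaDiff a b l κ (x * r)) =O[atTop]
      fun x : ℝ => Real.exp (-(l / 2 * r.re) * x) := by
  have hr0 : r ≠ 0 := by rintro rfl; simp at hr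
  refine ((isBigO_expSeries_atTop ha ha0 hl hr).sub (isBigO_expSeries_atTop hb hb0 hl hr)).sub ?_
  refine IsBigO.of_bound (‖κ‖ / ‖r‖) ?_
  filter_upwards [eventually_ge_atTop (1 : ℝ)] with x hx
  have hx0 : (0 : ℝ) < x := by linarith
  rw [Real.norm_of_nonneg (Real.exp_pos _).le, norm_div, norm_mul, norm_mul, Complex.norm_exp,
    Complex.norm_real, Real.norm_of_nonneg hx0.le]
  rw [mul_div_right_comm]
  have hrn : 0 < ‖r‖ := norm_pos_iff.2 hr0
  refine mul_le_mul ?_ (Real.exp_le_exp.2 ?_) (Real.exp_pos _).le (by positivity)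
  · exact div_le_div_of_nonneg_left (norm_nonneg _) hrn (by nlinarith)
  · have : (-(l : ℂ) * (x * r)).re = -(l * r.re * x) := by
      simp; ring
    rw [this]
    have : 0 ≤ l * r.re * x := by positivity
    nlinarith

/-- On a fixed ray the inverted theta series is exponentially small near the origin, so the
corrected difference is `O(x ^ (-ε))` for every `ε > 0`. This is what makes its Mellin transform
converge for `Re s > 0`. -/
theorem SelfDual.isBigO_thetaDiff_zero {a b : ℕ → ℂ} {l : ℝ} {κ : ℂ} (ha : SelfDual a l κ)
    (hb : AbsConvergent b) {ε : ℝ} (hε : 0 < ε) (hε1 : ε ≤ 1) {r : ℂ} (hr : 0 < r.re) :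
    (fun x : ℝ => thetaDiff a b l κ (x * r)) =O[𝓝[>] 0] fun x : ℝ => x ^ (-ε) := by
  have hr0 : r ≠ 0 := by rintro rfl; simp at hr
  have hrn : 0 < ‖r‖ := norm_pos_iff.2 hr0
  have hl := ha.pos
  have hri : 0 < (r⁻¹).re := by
    rw [Complex.inv_re]; exact div_pos hr (Complex.normSq_pos.2 hr0)
  obtain ⟨C, hC0, hC⟩ := ha.exists_enorm_thetaDiff_sq_le hb hε hε1
  obtain ⟨D, hD0, hD⟩ := exists_norm_expSeries_le ha.subexponential ha.zero hl hri
  set c := l * (r⁻¹).re with hc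
  have hc0 : 0 < c := by positivity
  set M := 2 * ((‖r‖ ^ 2)⁻¹ * (D ^ 2 * (2 / c ^ 2)) + C * r.re ^ (-2 * ε)) with hM
  have hM0 : 0 ≤ M := by positivity
  refine IsBigO.of_bound (Real.sqrt M) ?_
  have hmem : Ioo (0 : ℝ) (min 1 ‖r‖⁻¹) ∈ 𝓝[>] (0 : ℝ) := Ioo_mem_nhdsGT (by positivity)
  filter_upwards [hmem] with x hx
  have hx0 : 0 < x := hx.1
  have hx1 : x < 1 := hx.2.trans_le (min_le_left _ _)
  have hxr : ‖(x : ℂ) * r‖ = x * ‖r‖ := by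
    rw [norm_mul, Complex.norm_real, Real.norm_of_nonneg hx0.le]
  have hxr1 : ‖(x : ℂ) * r‖ < 1 := by
    rw [hxr]
    calc x * ‖r‖ < ‖r‖⁻¹ * ‖r‖ := by gcongr; exact hx.2.trans_le (min_le_right _ _)
      _ = 1 := by field_simp
  have hre : ((x : ℂ) * r).re = x * r.re := Complex.re_ofReal_mul _ _
  have hrei : (((x : ℂ) * r)⁻¹).re = x⁻¹ * (r⁻¹).re := by
    rw [mul_inv, ← Complex.ofReal_inv, Complex.re_ofReal_mul]
  have key := hC (x * r) (by rw [hre]; positivity) hxr1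
  rw [sqNorm_of_pos (by rw [hrei]; positivity), enorm_sq, enorm_sq,
    ← ENNReal.ofReal_mul (by positivity),
    ← ENNReal.ofReal_add (by positivity) (by rw [hre]; positivity),
    show (2 : ENNReal) = ENNReal.ofReal 2 by simp, ← ENNReal.ofReal_mul (by norm_num),
    ENNReal.ofReal_le_ofReal_iff (by rw [hre]; positivity)] at key
  have hA : ‖expSeries a l (x * r)⁻¹‖ ≤ D * Real.exp (-(c / 2 * x⁻¹)) := by
    have := hD (x * r)⁻¹ (by
      rw [hrei]; exact le_mul_of_one_le_left hri.le (one_le_inv₀ hx0 |>.2 hx1.le))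
    rw [hrei] at this
    convert this using 3
    rw [hc]; ring
  have hA2 : ‖expSeries a l (x * r)⁻¹‖ ^ 2 ≤ D ^ 2 * (2 / c ^ 2 * x ^ 2) := by
    calc _ ≤ (D * Real.exp (-(c / 2 * x⁻¹))) ^ 2 := by gcongr
      _ = D ^ 2 * Real.exp (-(c * x⁻¹)) := by
        rw [mul_pow, ← Real.exp_nat_mul]; congr 2; push_cast; ring
      _ ≤ _ := by
        gcongr
        have h := Real.quadratic_le_exp_of_nonneg (x := c * x⁻¹) (by positivity)
        have h2 : (c * x⁻¹) ^ 2 / 2 ≤ Real.exp (c * x⁻¹) := by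
          have : 0 < c * x⁻¹ := by positivity
          linarith
        rw [Real.exp_neg]
        refine (inv_anti₀ (by positivity) h2).trans (le_of_eq ?_)
        field_simp
  have h1 : (1 : ℝ) ≤ x ^ (-2 * ε) := Real.one_le_rpow_of_pos_of_le_one_of_nonpos hx0 hx1.le (by linarith)
  have hfin : ‖thetaDiff a b l κ (x * r)‖ ^ 2 ≤ M * x ^ (-2 * ε) := by
    refine key.trans ?_
    rw [hM, mul_assoc, add_mul, hre, Real.mul_rpow hx0.le hr.le]
    refine mul_le_mul_of_nonneg_left (add_le_add ?_ (le_of_eq (by ring))) (by norm_num)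
    calc _ ≤ (‖(x : ℂ) * r‖ ^ 2)⁻¹ * (D ^ 2 * (2 / c ^ 2 * x ^ 2)) := by gcongr
      _ = (‖r‖ ^ 2)⁻¹ * (D ^ 2 * (2 / c ^ 2)) := by rw [hxr]; field_simp
      _ ≤ _ := le_mul_of_one_le_right (by positivity) h1
  rw [Real.norm_of_nonneg (by positivity)]
  refine (sq_le_sq₀ (norm_nonneg _) (by positivity)).1 ?_
  rw [mul_pow, Real.sq_sqrt hM0, ← Real.rpow_natCast (x ^ (-ε)), ← Real.rpow_mul hx0.le,
    show -ε * ((2 : ℕ) : ℝ) = -2 * ε by push_cast; ring]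
  exact hfin

section

variable {a b : ℕ → ℂ} {l : ℝ} {κ : ℂ}

theorem SelfDual.mellinConvergent_thetaDiff (ha : SelfDual a l κ) (hb : AbsConvergent b) {r : ℂ}
    (hr : 0 < r.re) {s : ℂ} (hs : 0 < s.re) :
    MellinConvergent (fun x : ℝ => thetaDiff a b l κ (x * r)) s := by
  have hl := ha.pos
  refine mellinConvergent_of_isBigO_rpow_exp (a := l / 2 * r.re) (b := min 1 (s.re / 2)) (by positivity)
    ((continuousOn_thetaDiff_ray ha.subexponential hb.subexponential hl κ hr).locallyIntegrableOn
      measurableSet_Ioi)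
    (isBigO_thetaDiff_atTop ha.subexponential ha.zero hb.subexponential hb.zero hl κ hr)
    (ha.isBigO_thetaDiff_zero hb (by positivity) (min_le_left _ _) hr)
    ((min_le_right _ _).trans_lt (by linarith))

theorem SelfDual.differentiableAt_mellin_thetaDiff (ha : SelfDual a l κ) (hb : AbsConvergent b)
    {r : ℂ} (hr : 0 < r.re) {s : ℂ} (hs : 0 < s.re) :
    DifferentiableAt ℂ (mellin (fun x : ℝ => thetaDiff a b l κ (x * r))) s := by
  have hl := ha.pos
  refine mellin_differentiableAt_of_isBigO_rpow_exp (a := l / 2 * r.re) (b := min 1 (s.re / 2))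
    (by positivity)
    ((continuousOn_thetaDiff_ray ha.subexponential hb.subexponential hl κ hr).locallyIntegrableOn
      measurableSet_Ioi)
    (isBigO_thetaDiff_atTop ha.subexponential ha.zero hb.subexponential hb.zero hl κ hr)
    (ha.isBigO_thetaDiff_zero hb (by positivity) (min_le_left _ _) hr)
    ((min_le_right _ _).trans_lt (by linarith))

/-- The Mellin transform of the correction term accounts for the pole at `1`. -/
theorem hasMellin_exp_div (κ : ℂ) {l : ℝ} (hl : 0 < l) {r : ℂ} (hr : 0 < r.re) {s : ℂ}
    (hs : 1 < s.re) :
    HasMellin (fun x : ℝ => κ * Complex.exp (-l * (x * r)) / (x * r)) s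
      ((l * r) ^ (-s) * Complex.Gamma s * (κ * l / (s - 1))) := by
  have hr0 : r ≠ 0 := by rintro rfl; simp at hr
  have hl0 : (l : ℂ) ≠ 0 := by exact_mod_cast hl.ne'
  have hlr : 0 < ((l : ℂ) * r).re := by rw [Complex.re_ofReal_mul]; positivity
  have hs1 : 0 < (s - 1).re := by simpa using hs
  have hsn : s - 1 ≠ 0 := by intro h; rw [h] at hs1; simp at hs1
  have heq : EqOn (fun x : ℝ => (κ / r) * ((x : ℂ) ^ (s - 1 - 1) * Complex.exp (-(l * r) * x)))
      (fun x : ℝ => (x : ℂ) ^ (s - 1) • (κ * Complex.exp (-l * (x * r)) / (x * r))) (Ioi 0) := by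
    intro x hx
    have hx : (x : ℂ) ≠ 0 := by exact_mod_cast (ne_of_gt hx)
    simp only [smul_eq_mul]
    rw [Complex.cpow_sub _ _ hx, Complex.cpow_one, show -(l * r) * (x : ℂ) = -l * (x * r) by ring]
    field_simp
  refine ⟨?_, ?_⟩
  · exact IntegrableOn.congr_fun ((integrableOn_cpow_mul_exp hs1 hlr).const_mul (κ / r)) heq
      measurableSet_Ioi
  · rw [mellin, ← setIntegral_congr_fun measurableSet_Ioi heq, integral_const_mul,
      integral_cpow_mul_exp hs1 hlr]
    have hG : Complex.Gamma s = (s - 1) * Complex.Gamma (s - 1) := by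
      rw [← Complex.Gamma_add_one _ hsn]; ring_nf
    rw [hG, show -(s - 1) = -s + 1 by ring, Complex.cpow_add _ _ (mul_ne_zero hl0 hr0),
      Complex.cpow_one]
    field_simp

/-- Along each ray, the Mellin transform of the corrected difference of the theta series is
holomorphic for `Re s > 0`; there it is the difference of the Dirichlet series, without its pole,
times a gamma factor. -/
theorem SelfDual.mellin_thetaDiff (ha : SelfDual a l κ) (hb : AbsConvergent b) {r : ℂ}
    (hr : 0 < r.re) {H : ℂ → ℂ} (hH : Differentiable ℂ H)
    (hF : IsContinuation (fun (m : ℕ) s => a m * (m : ℂ) ^ (-s)) fun s => H s / (s - 1)) {s : ℂ}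
    (hs : 0 < s.re) (hs1 : s ≠ 1) :
    mellin (fun x : ℝ => thetaDiff a b l κ (x * r)) s =
      (l * r) ^ (-s) * Complex.Gamma s * (H s / (s - 1) - κ * l / (s - 1) - dirichletSeries b s) := by
  have hl := ha.pos
  have hr0 : r ≠ 0 := by rintro rfl; simp at hr
  have hl0 : (l : ℂ) ≠ 0 := by exact_mod_cast hl.ne'
  set U : Set ℂ := {w | 0 < w.re} with hU
  have hUo : IsOpen U := isOpen_lt continuous_const Complex.continuous_re
  have hUc : IsPreconnected U := (convex_halfSpace_re_gt 0).isPreconnected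
  -- both sides, multiplied by `s - 1`, are holomorphic on the half plane, and agree for `Re s > 1`
  have h1 : AnalyticOnNhd ℂ
      (fun s => (s - 1) * mellin (fun x : ℝ => thetaDiff a b l κ (x * r)) s) U :=
    DifferentiableOn.analyticOnNhd (fun w hw => (DifferentiableAt.fun_mul
      ((differentiableAt_id (x := w)).sub_const 1)
      (ha.differentiableAt_mellin_thetaDiff hb hr hw)).differentiableWithinAt) hUo
  have h2 : AnalyticOnNhd ℂ (fun s => (l * r) ^ (-s) * Complex.Gamma s *
      (H s - κ * l - (s - 1) * dirichletSeries b s)) U := by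
    refine DifferentiableOn.analyticOnNhd (fun w hw => ?_) hUo
    have hw : 0 < w.re := hw
    have hG : DifferentiableAt ℂ Complex.Gamma w :=
      Complex.differentiableAt_Gamma _ fun m hm => by
        rw [hm] at hw; simp at hw; exact absurd hw (not_lt.2 (Nat.cast_nonneg m))
    have hp : DifferentiableAt ℂ (fun s : ℂ => ((l : ℂ) * r) ^ (-s)) w :=
      differentiableAt_id.neg.const_cpow (Or.inl (mul_ne_zero hl0 hr0))
    have hd := hb.differentiableAt hw
    have hHw := hH w
    exact (by fun_prop : DifferentiableAt ℂ _ w).differentiableWithinAt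
  have hloc : ∀ w : ℂ, 1 < w.re → (w - 1) * mellin (fun x : ℝ => thetaDiff a b l κ (x * r)) w =
      (l * r) ^ (-w) * Complex.Gamma w * (H w - κ * l - (w - 1) * dirichletSeries b w) := by
    intro w hw
    have hw0 : 0 < w.re := by linarith
    have hwn : w - 1 ≠ 0 := by intro h; rw [sub_eq_zero.1 h] at hw; simp at hw
    have hA := ha.summable hw
    have hB := hb.summable w.re hw0
    have hAB : Summable fun m : ℕ => ‖(a - b) m‖ * (m : ℝ) ^ (-w.re) := by
      refine Summable.of_nonneg_of_le (fun m => by positivity) (fun m => ?_) (hA.add hB)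
      rw [← add_mul]
      exact mul_le_mul_of_nonneg_right (norm_sub_le _ _) (by positivity)
    have hE := hasMellin_exp_div κ hl hr hw
    have hT := ha.mellinConvergent_thetaDiff hb hr hw0
    have hsum := (hasMellin_add hT hE.1).2
    have hfun : ∀ x ∈ Ioi (0 : ℝ), thetaDiff a b l κ (x * r) +
        κ * Complex.exp (-l * (x * r)) / (x * r) = expSeries (a - b) l (x * r) := by
      intro x hx
      have hx : 0 < x := hx
      rw [thetaDiff, expSeries_sub ha.subexponential hb.subexponential hl
        (by rw [Complex.re_ofReal_mul]; positivity)]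
      ring
    have hcongr : mellin (fun x : ℝ => thetaDiff a b l κ (x * r) +
        κ * Complex.exp (-l * (x * r)) / (x * r)) w =
        mellin (fun x : ℝ => expSeries (a - b) l (x * r)) w :=
      setIntegral_congr_fun measurableSet_Ioi fun x hx => by simp only [hfun x hx]
    rw [hcongr, mellin_expSeries (by simp [ha.zero, hb.zero]) hl hw0 hAB hr, hE.2] at hsum
    have hD : ∑' m : ℕ, (a - b) m * (m : ℂ) ^ (-w) = H w / (w - 1) - dirichletSeries b w := by
      have hb' : Summable fun m : ℕ => b m * (m : ℂ) ^ (-w) :=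
        Summable.of_norm (by simpa only [norm_dirichletTerm hb.zero] using hB)
      refine Eq.trans (tsum_congr fun m => ?_) ((hF.2 w hw).sub hb'.hasSum).tsum_eq
      simp [sub_mul]
    rw [hD] at hsum
    rw [eq_sub_of_add_eq hsum.symm]
    field_simp
    ring
  have hev : (fun s => (s - 1) * mellin (fun x : ℝ => thetaDiff a b l κ (x * r)) s) =ᶠ[𝓝 2]
      (fun s => (l * r) ^ (-s) * Complex.Gamma s *
        (H s - κ * l - (s - 1) * dirichletSeries b s)) := by
    filter_upwards [(isOpen_lt continuous_const Complex.continuous_re).mem_nhds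
      (show (2 : ℂ) ∈ {w : ℂ | 1 < w.re} by simp)] with w hw using hloc w hw
  have := h1.eqOn_of_preconnected_of_eventuallyEq h2 hUc (z₀ := 2) (by simp [hU]) hev hs
  have hsn : s - 1 ≠ 0 := sub_ne_zero.2 hs1
  simp only at this
  rw [eq_div_of_mul_eq hsn ((mul_comm _ _).trans this)]
  field_simp

end

end EpsteinZeta

namespace EpsteinZeta
open Set ENNReal

/-! ### From the sector to vertical lines -/

/-- The gamma factor of the ray through `1 + i v`, at the point `s`. -/
def rayFactor (l v : ℝ) (s : ℂ) : ℂ := ((l : ℂ) * (1 + v * Complex.I)) ^ (-s) * Complex.Gamma s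

theorem half_pi_sub_inv_le_arctan {v : ℝ} (hv : 0 < v) : Real.pi / 2 - v⁻¹ ≤ Real.arctan v := by
  have h := Real.arctan_inv_of_pos hv
  have h2 : Real.arctan v⁻¹ ≤ v⁻¹ := by
    have := Real.le_tan (x := Real.arctan v⁻¹) (Real.arctan_nonneg.2 (by positivity))
      (Real.arctan_lt_pi_div_two _)
    rwa [Real.tan_arctan] at this
  linarith

/-- The gamma factor decays like `e^{-(π/2 - arctan v) t}`, hence it is of order `t^{-1/2}` for
`v` of the same order as `t`. -/
theorem exists_le_norm_sq_rayFactor {l : ℝ} (hl : 0 < l) (β : ℝ) :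
    ∃ c : ℝ, 0 < c ∧ ∀ σ t v : ℝ, 1 / 2 ≤ σ → σ ≤ β → 1 ≤ t → t / 2 ≤ v → v ≤ t →
      c * t⁻¹ ≤ ‖rayFactor l v (σ + t * Complex.I)‖ ^ 2 := by
  obtain ⟨c, hc0, hc⟩ := exists_le_norm_sq_Gamma β
  refine ⟨c * (1 + 2 * l ^ 2) ^ (-β) * Real.exp (-4), by positivity, fun σ t v hσ hσβ ht h1 h2 => ?_⟩
  have hv : 0 < v := by linarith
  have ht0 : 0 < t := by linarith
  have hσ0 : 0 < σ := by linarith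
  have hr : (1 + v * Complex.I : ℂ) ≠ 0 := by
    intro h; have := congrArg Complex.re h; simp at this
  have hl0 : (l : ℂ) ≠ 0 := by exact_mod_cast hl.ne'
  -- `‖(l (1 + i v))^{-s}‖` involves `e^{t arg (1 + i v)}`, and the argument is `arctan v`.
  have harg : Complex.arg ((l : ℂ) * (1 + v * Complex.I)) = Real.arctan v := by
    rw [Complex.arg_real_mul _ hl, Complex.arg_of_re_nonneg (by simp), Real.arctan_eq_arcsin]
    congr 1
    rw [Complex.norm_def, Complex.normSq_apply]
    simp [sq]
  have hnorm : ‖(l : ℂ) * (1 + v * Complex.I)‖ ^ 2 = l ^ 2 * (1 + v ^ 2) := by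
    rw [← Complex.normSq_eq_norm_sq, Complex.normSq_apply]; simp; ring
  have hn0 : 0 < ‖(l : ℂ) * (1 + v * Complex.I)‖ := norm_pos_iff.2 (mul_ne_zero hl0 hr)
  have hp : ‖((l : ℂ) * (1 + v * Complex.I)) ^ (-(σ + t * Complex.I : ℂ))‖ ^ 2 =
      (l ^ 2 * (1 + v ^ 2)) ^ (-σ) * Real.exp (2 * t * Real.arctan v) := by
    rw [Complex.norm_cpow_of_ne_zero (mul_ne_zero hl0 hr), harg, div_pow, ← hnorm,
      ← Real.exp_nat_mul, div_eq_mul_inv, ← Real.exp_neg]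
    congr 1
    · rw [← Real.rpow_natCast, ← Real.rpow_natCast, ← Real.rpow_mul hn0.le, ← Real.rpow_mul hn0.le]
      simp; ring_nf
    · congr 1; simp; ring
  rw [rayFactor, norm_mul, mul_pow, hp]
  have hA : (1 + 2 * l ^ 2) ^ (-β) * t ^ (-(2 * σ)) ≤ (l ^ 2 * (1 + v ^ 2)) ^ (-σ) := by
    calc (1 + 2 * l ^ 2) ^ (-β) * t ^ (-(2 * σ)) ≤ (1 + 2 * l ^ 2) ^ (-σ) * t ^ (-(2 * σ)) := by
          gcongr
          nlinarith [sq_nonneg l]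
      _ = ((1 + 2 * l ^ 2) * t ^ 2) ^ (-σ) := by
          rw [Real.mul_rpow (by positivity) (by positivity), ← Real.rpow_natCast t 2,
            ← Real.rpow_mul ht0.le]
          congr 2; push_cast; ring
      _ ≤ _ := by
          refine Real.rpow_le_rpow_of_nonpos (by positivity) ?_ (by linarith)
          have : 1 + v ^ 2 ≤ 2 * t ^ 2 := by nlinarith
          nlinarith [sq_nonneg l, sq_nonneg t]
  -- `π / 2 - arctan v ≤ 1 / v ≤ 2 / t`.
  have hB : Real.exp (-4) * Real.exp (Real.pi * t) ≤ Real.exp (2 * t * Real.arctan v) := by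
    rw [← Real.exp_add]
    refine Real.exp_le_exp.2 ?_
    have h3 := half_pi_sub_inv_le_arctan hv
    have h4 : t * v⁻¹ ≤ 2 := by
      rw [← div_eq_mul_inv, div_le_iff₀ hv]; linarith
    nlinarith
  calc _ = ((1 + 2 * l ^ 2) ^ (-β) * t ^ (-(2 * σ))) * (Real.exp (-4) * Real.exp (Real.pi * t)) *
        (c * t ^ (2 * σ - 1) * Real.exp (-(Real.pi * t))) := by
        rw [Real.rpow_sub_one ht0.ne', Real.rpow_neg ht0.le, Real.exp_neg (Real.pi * t)]
        field_simp
    _ ≤ _ := by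
        gcongr
        exact hc σ t hσ hσβ ht

theorem continuousOn_rayFactor {l : ℝ} (hl : 0 < l) :
    ContinuousOn (fun p : ℝ × ℂ => rayFactor l p.1 p.2) {p | 0 < p.2.re} := by
  intro p hp
  have hp : 0 < p.2.re := hp
  have hslit : (l : ℂ) * (1 + p.1 * Complex.I) ∈ Complex.slitPlane := by
    left; simpa using hl
  have hG : ContinuousAt Complex.Gamma p.2 :=
    (Complex.differentiableAt_Gamma _ fun m hm => by
      rw [hm] at hp; simp at hp; exact absurd hp (not_lt.2 (Nat.cast_nonneg m))).continuousAt
  refine ContinuousAt.continuousWithinAt (ContinuousAt.mul ?_ ?_)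
  · exact ContinuousAt.cpow (by fun_prop) (by fun_prop) hslit
  · exact ContinuousAt.comp (f := fun p : ℝ × ℂ => p.2) hG continuousAt_snd

/-- The mean square on a vertical line of a function all of whose products with the gamma factors
of rays satisfy a Mellin-Plancherel inequality. -/
theorem lintegral_vertical_le {l : ℝ} (hl : 0 < l) {β σ c T : ℝ} (hσ : 1 / 2 ≤ σ) (hσβ : σ ≤ β)
    (hc0 : 0 < c) (hc : ∀ σ t v : ℝ, 1 / 2 ≤ σ → σ ≤ β → 1 ≤ t → t / 2 ≤ v → v ≤ t →
      c * t⁻¹ ≤ ‖rayFactor l v (σ + t * Complex.I)‖ ^ 2) {g : ℂ → ℂ}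
    (hg : ContinuousOn g {s | 0 < s.re ∧ s ≠ 1}) {J : ℝ → ℝ≥0∞}
    (hJ : ∀ v : ℝ, ∫⁻ t in Icc 1 T, ‖rayFactor l v (σ + t * Complex.I) *
      g (σ + t * Complex.I)‖ₑ ^ (2 : ℝ) ≤ J v) :
    ∫⁻ t in Icc 1 T, ‖g (σ + t * Complex.I)‖ₑ ^ (2 : ℝ) ≤
      ENNReal.ofReal (2 / c) * ∫⁻ v in Ioo 0 T, J v := by
  have hσ0 : 0 < σ := by linarith
  set Φ : ℝ → ℝ → ℝ≥0∞ := fun t v =>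
    ‖rayFactor l v (σ + t * Complex.I) * g (σ + t * Complex.I)‖ₑ ^ (2 : ℝ) with hΦ
  have hmeas : AEMeasurable (Function.uncurry Φ)
      ((volume.restrict (Icc 1 T)).prod (volume.restrict (Ioo 0 T))) := by
    rw [Measure.prod_restrict]
    refine ContinuousOn.aemeasurable ?_ (measurableSet_Icc.prod measurableSet_Ioo)
    have h1 : ContinuousOn (fun p : ℝ × ℝ => rayFactor l p.2 (σ + p.1 * Complex.I))
        (Icc 1 T ×ˢ Ioo 0 T) :=
      (continuousOn_rayFactor hl).comp
        (f := fun p : ℝ × ℝ => (p.2, (σ + p.1 * Complex.I : ℂ))) (by fun_prop) fun p _ => by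
          simpa using hσ0
    have h2 : ContinuousOn (fun p : ℝ × ℝ => g (σ + p.1 * Complex.I)) (Icc 1 T ×ˢ Ioo 0 T) :=
      hg.comp (f := fun p : ℝ × ℝ => (σ + p.1 * Complex.I : ℂ)) (by fun_prop) fun p hp => by
        refine ⟨by simpa using hσ0, fun h => ?_⟩
        have := congrArg Complex.im h
        simp only [Complex.add_im, Complex.ofReal_im, Complex.mul_im, Complex.ofReal_re,
          Complex.I_im, Complex.I_re, Complex.one_im] at this
        have h1 : 1 ≤ p.1 := hp.1.1
        linarith
    exact (ENNReal.continuous_rpow_const.comp_continuousOn (h1.mul h2).enorm)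
  -- The slopes `v ∈ (t / 2, t)` fill an interval of length `t / 2`, which compensates the factor
  -- `t⁻¹` in the lower bound for the gamma factor.
  have hlow : ∀ t ∈ Icc 1 T, ENNReal.ofReal (c / 2) * ‖g (σ + t * Complex.I)‖ₑ ^ (2 : ℝ) ≤
      ∫⁻ v in Ioo 0 T, Φ t v := by
    intro t ht
    have ht0 : 0 < t := by linarith [ht.1]
    calc _ = ∫⁻ v in Ioo (t / 2) t, ENNReal.ofReal (c * t⁻¹) * ‖g (σ + t * Complex.I)‖ₑ ^ (2 : ℝ) := by
          rw [setLIntegral_const, Real.volume_Ioo, mul_right_comm, ← ENNReal.ofReal_mul (by positivity)]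
          congr 2; field_simp; norm_num
      _ ≤ ∫⁻ v in Ioo (t / 2) t, Φ t v := by
          refine setLIntegral_mono' measurableSet_Ioo fun v hv => ?_
          simp only [hΦ]
          rw [enorm_mul, ENNReal.mul_rpow_of_nonneg _ _ (by norm_num), enorm_sq (rayFactor _ _ _)]
          gcongr
          exact hc σ t v hσ hσβ ht.1 hv.1.le hv.2.le
      _ ≤ _ := lintegral_mono_set (Ioo_subset_Ioo (by positivity) ht.2)
  have hmain : ENNReal.ofReal (c / 2) * ∫⁻ t in Icc 1 T, ‖g (σ + t * Complex.I)‖ₑ ^ (2 : ℝ) ≤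
      ∫⁻ v in Ioo 0 T, J v := by
    rw [← lintegral_const_mul' _ _ ENNReal.ofReal_ne_top]
    calc _ ≤ ∫⁻ t in Icc 1 T, ∫⁻ v in Ioo 0 T, Φ t v := setLIntegral_mono' measurableSet_Icc hlow
      _ = ∫⁻ v in Ioo 0 T, ∫⁻ t in Icc 1 T, Φ t v := lintegral_lintegral_swap hmeas
      _ ≤ _ := lintegral_mono fun v => hJ v
  calc _ = ENNReal.ofReal (2 / c) * (ENNReal.ofReal (c / 2) *
        ∫⁻ t in Icc 1 T, ‖g (σ + t * Complex.I)‖ₑ ^ (2 : ℝ)) := by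
        rw [← mul_assoc, ← ENNReal.ofReal_mul (by positivity), show 2 / c * (c / 2) = 1 by field_simp]
        simp
    _ ≤ _ := by gcongr

namespace SelfDual

variable {a b : ℕ → ℂ} {l : ℝ} {κ : ℂ}

/-- The mean square of the difference of the two Dirichlet series on vertical lines is controlled
by the mean square of the difference of the theta series over rays. -/
theorem exists_lintegral_vertical_le (ha : SelfDual a l κ) {α β : ℝ} (hα : 1 / 2 < α)
    {H : ℂ → ℂ} (hH : Differentiable ℂ H)
    (hF : IsContinuation (fun (m : ℕ) s => a m * (m : ℂ) ^ (-s)) fun s => H s / (s - 1)) :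
    ∃ C : ℝ, ∀ b, AbsConvergent b → ∀ T : ℝ, 1 ≤ T → ∀ σ ∈ Icc α β,
      ENNReal.ofReal (1 / T) * ∫⁻ t in Icc 1 T, ‖H (σ + t * Complex.I) / (σ + t * Complex.I - 1) -
        dirichletSeries b (σ + t * Complex.I)‖ₑ ^ (2 : ℝ) ≤
      ENNReal.ofReal C * sectorAvg (weight α β) (fun p =>
        ‖thetaDiff a b l κ ((p.1 : ℂ) + (p.1 * p.2 : ℝ) * Complex.I)‖ₑ ^ (2 : ℝ)) T +
      ENNReal.ofReal (2 * ‖κ * l‖ ^ 2) * ENNReal.ofReal (1 / T) := by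
  have hl := ha.pos
  obtain ⟨c, hc0, hc⟩ := exists_le_norm_sq_rayFactor hl β
  refine ⟨2 * (2 / c * (2 * Real.pi)), fun b hb T hT σ hσ => ?_⟩
  have hσ0 : 0 < σ := by linarith [hσ.1]
  -- The Mellin transform gives the mean square of `g`, from which the pole has been removed; that
  -- of the pole over `t ≥ 1` is bounded.
  set g : ℂ → ℂ := fun s => H s / (s - 1) - κ * l / (s - 1) - dirichletSeries b s with hg
  have hgc : ContinuousOn g {s | 0 < s.re ∧ s ≠ 1} := by
    intro s hs
    have h1 : s - 1 ≠ 0 := sub_ne_zero.2 hs.2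
    have h2 := (hb.differentiableAt hs.1).continuousAt
    have h3 := (hH s).continuousAt
    refine ContinuousAt.continuousWithinAt ?_
    refine (ContinuousAt.sub (h3.div (by fun_prop) h1)
      (ContinuousAt.div continuousAt_const (by fun_prop) h1)).sub h2
  have hne : ∀ t ∈ Icc 1 T, (σ + t * Complex.I : ℂ) ≠ 1 := by
    intro t ht h
    have := congrArg Complex.im h
    simp at this
    linarith [ht.1]
  have hJ : ∀ v : ℝ, ∫⁻ t in Icc 1 T, ‖rayFactor l v (σ + t * Complex.I) *
      g (σ + t * Complex.I)‖ₑ ^ (2 : ℝ) ≤ ENNReal.ofReal (2 * Real.pi) *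
        ∫⁻ x in Ioi (0 : ℝ), ‖thetaDiff a b l κ ((x : ℂ) + (x * v : ℝ) * Complex.I)‖ₑ ^ (2 : ℝ) *
          weight α β x := by
    intro v
    have hr : 0 < (1 + v * Complex.I : ℂ).re := by simp
    have hP := lintegral_enorm_sq_mellin_le
      (ha.mellinConvergent_thetaDiff hb hr (s := (σ : ℂ)) (by simpa using hσ0))
    calc _ ≤ ∫⁻ t : ℝ, ‖mellin (fun x : ℝ => thetaDiff a b l κ (x * (1 + v * Complex.I)))
          (σ + t * Complex.I)‖ₑ ^ (2 : ℝ) := by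
          refine (setLIntegral_mono' measurableSet_Icc fun t ht => le_of_eq ?_).trans
            (setLIntegral_le_lintegral _ _)
          rw [ha.mellin_thetaDiff hb hr hH hF (by simpa using hσ0) (hne t ht)]
          rfl
      _ ≤ _ := hP
      _ ≤ _ := by
          gcongr ENNReal.ofReal _ * ?_
          refine setLIntegral_mono' measurableSet_Ioi fun x hx => ?_
          have : (x : ℂ) * (1 + v * Complex.I) = (x : ℂ) + (x * v : ℝ) * Complex.I := by
            push_cast; ring
          rw [this]
          gcongr
          exact rpow_le_weight hσ.1 hσ.2 hx
  have hvert := lintegral_vertical_le hl (T := T) (by linarith [hσ.1]) hσ.2 hc0 hc hgc hJ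
  rw [lintegral_const_mul' _ _ ENNReal.ofReal_ne_top, ← mul_assoc,
    ← ENNReal.ofReal_mul (by positivity)] at hvert
  have hpole : ∫⁻ t in Icc 1 T, ‖κ * l / ((σ + t * Complex.I : ℂ) - 1)‖ₑ ^ (2 : ℝ) ≤
      ENNReal.ofReal (‖κ * l‖ ^ 2) := by
    have hT2 : IntegrableOn (fun t : ℝ => t ^ (-2 : ℝ)) (Ioi 1) :=
      integrableOn_Ioi_rpow_of_lt (by norm_num) one_pos
    calc _ ≤ ∫⁻ t in Icc 1 T, ENNReal.ofReal (‖κ * l‖ ^ 2 * t ^ (-2 : ℝ)) := by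
          refine setLIntegral_mono' measurableSet_Icc fun t ht => ?_
          have ht0 : 0 < t := by linarith [ht.1]
          rw [enorm_sq]
          refine ENNReal.ofReal_le_ofReal ?_
          rw [norm_div, div_pow, Real.rpow_neg ht0.le, div_eq_mul_inv]
          gcongr
          rw [show (2 : ℝ) = (2 : ℕ) by norm_num, Real.rpow_natCast]
          gcongr
          have := Complex.abs_im_le_norm ((σ + t * Complex.I : ℂ) - 1)
          simpa [abs_of_pos ht0] using this
      _ ≤ ∫⁻ t in Ici 1, ENNReal.ofReal (‖κ * l‖ ^ 2 * t ^ (-2 : ℝ)) :=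
          lintegral_mono_set Icc_subset_Ici_self
      _ = ∫⁻ t in Ioi 1, ENNReal.ofReal (‖κ * l‖ ^ 2 * t ^ (-2 : ℝ)) :=
          setLIntegral_congr Ioi_ae_eq_Ici.symm
      _ = ENNReal.ofReal (∫ t in Ioi (1 : ℝ), ‖κ * l‖ ^ 2 * t ^ (-2 : ℝ)) := by
          rw [ofReal_integral_eq_lintegral_ofReal (hT2.const_mul _)]
          filter_upwards [self_mem_ae_restrict measurableSet_Ioi] with t ht
          have : (0 : ℝ) < t := one_pos.trans ht
          positivity
      _ = _ := by
          rw [integral_const_mul, integral_Ioi_rpow_of_lt (by norm_num) one_pos]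
          norm_num
  have hmeas : AEMeasurable (fun t : ℝ => ‖κ * l / ((σ + t * Complex.I : ℂ) - 1)‖ₑ ^ (2 : ℝ))
      (volume.restrict (Icc 1 T)) := by fun_prop
  calc _ ≤ ENNReal.ofReal (1 / T) * ∫⁻ t in Icc 1 T, 2 * (‖g (σ + t * Complex.I)‖ₑ ^ (2 : ℝ) +
        ‖κ * l / ((σ + t * Complex.I : ℂ) - 1)‖ₑ ^ (2 : ℝ)) := by
        gcongr ENNReal.ofReal _ * ?_
        refine lintegral_mono fun t => ?_
        refine le_trans (le_of_eq ?_) (enorm_sq_add_le _ _)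
        simp only [hg]
        congr 2; ring
    _ = 2 * (ENNReal.ofReal (1 / T) * ∫⁻ t in Icc 1 T, ‖g (σ + t * Complex.I)‖ₑ ^ (2 : ℝ)) +
        2 * (ENNReal.ofReal (1 / T) *
          ∫⁻ t in Icc 1 T, ‖κ * l / ((σ + t * Complex.I : ℂ) - 1)‖ₑ ^ (2 : ℝ)) := by
        rw [lintegral_const_mul' _ _ (by simp), lintegral_add_right' _ hmeas]
        ring
    _ ≤ 2 * (ENNReal.ofReal (1 / T) * (ENNReal.ofReal (2 / c * (2 * Real.pi)) *
          ∫⁻ v in Ioo 0 T, ∫⁻ x in Ioi (0 : ℝ),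
            ‖thetaDiff a b l κ ((x : ℂ) + (x * v : ℝ) * Complex.I)‖ₑ ^ (2 : ℝ) * weight α β x)) +
        2 * (ENNReal.ofReal (1 / T) * ENNReal.ofReal (‖κ * l‖ ^ 2)) := by gcongr
    _ = _ := by
        rw [sectorAvg, ENNReal.ofReal_mul (p := 2) (by norm_num), ENNReal.ofReal_mul (p := 2) (by norm_num),
          show ENNReal.ofReal 2 = 2 by simp]
        ring

end SelfDual

end EpsteinZeta

namespace EpsteinZeta
open Set ENNReal

/-! ### Mean square approximation of a Dirichlet series with a functional equation -/

namespace SelfDual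

variable {a b : ℕ → ℂ} {l : ℝ} {κ : ℂ}

/-- The mean square of `F - ∑ b_m m^{-s}` over a vertical strip is at most a constant multiple of
`∑ |a_m - b_m|² m^{-2α}`, the constant not depending on `b`. -/
theorem exists_limsup_le (ha : SelfDual a l κ) {α β : ℝ} (hα : 1 / 2 < α) (hαβ : α ≤ β) {F : ℂ → ℂ}
    (hF : IsContinuation (fun (m : ℕ) s => a m * (m : ℂ) ^ (-s)) F) :
    ∃ C : ℝ≥0∞, C ≠ ∞ ∧ ∀ b, AbsConvergent b →
      limsup (fun T : ℝ => ENNReal.ofReal (1 / T) * ∫⁻ t in Icc 1 T, ∫⁻ σ in Icc α β,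
        ‖F (σ + t * Complex.I) - dirichletSeries b (σ + t * Complex.I)‖ₑ ^ (2 : ℝ)) atTop ≤
      C * ∑' m : ℕ, ‖a m - b m‖ₑ ^ (2 : ℝ) * ENNReal.ofReal ((m : ℝ) ^ (-2 * α)) := by
  obtain ⟨H, hH, hHc⟩ := ha.exists_continuation
  obtain ⟨C₁, hC₁⟩ := ha.exists_lintegral_vertical_le (β := β) hα hH hHc
  obtain ⟨C₂, -, hC₂⟩ := exists_lintegral_lineSum_le (by linarith : (0 : ℝ) < α) hαβ ha.pos
  set V := ENNReal.ofReal (β - α) with hV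
  refine ⟨V * (ENNReal.ofReal C₁ * (2 * (ENNReal.ofReal (1 + 4 * Real.pi / l) * ENNReal.ofReal C₂))),
    by finiteness, fun b hb => ?_⟩
  obtain ⟨E, hE0, hE⟩ := ha.exists_sectorAvg_le hb hα hαβ
  set S := ∑' m : ℕ, ‖a m - b m‖ₑ ^ (2 : ℝ) * ENNReal.ofReal ((m : ℝ) ^ (-2 * α)) with hS
  have hdiff := hC₂ (a - b) (by simp [ha.zero, hb.zero])
  simp only [Pi.sub_apply] at hdiff
  -- the mean square over the strip, for each `T`
  have hT : ∀ T : ℝ, 1 ≤ T → ENNReal.ofReal (1 / T) * ∫⁻ t in Icc 1 T, ∫⁻ σ in Icc α β,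
        ‖F (σ + t * Complex.I) - dirichletSeries b (σ + t * Complex.I)‖ₑ ^ (2 : ℝ) ≤
      V * (ENNReal.ofReal C₁ * (2 * (ENNReal.ofReal (1 + 4 * Real.pi / l) * ENNReal.ofReal C₂))) * S +
        V * (ENNReal.ofReal C₁ * E T + ENNReal.ofReal (2 * ‖κ * l‖ ^ 2) * ENNReal.ofReal (1 / T)) := by
    intro T hT
    have hne : ∀ t ∈ Icc 1 T, ∀ σ : ℝ, (σ + t * Complex.I : ℂ) ≠ 1 := by
      intro t ht σ h
      have := congrArg Complex.im h
      simp at this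
      linarith [ht.1]
    have hFH : ∀ t ∈ Icc 1 T, ∀ σ : ℝ, F (σ + t * Complex.I) =
        H (σ + t * Complex.I) / (σ + t * Complex.I - 1) := fun t ht σ =>
      hF.eqOn hHc (hne t ht σ)
    have hmeas : AEMeasurable (Function.uncurry fun t σ : ℝ =>
        ‖F (σ + t * Complex.I) - dirichletSeries b (σ + t * Complex.I)‖ₑ ^ (2 : ℝ))
        ((volume.restrict (Icc 1 T)).prod (volume.restrict (Icc α β))) := by
      rw [Measure.prod_restrict]
      refine ContinuousOn.aemeasurable ?_ (measurableSet_Icc.prod measurableSet_Icc)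
      have hcont : ContinuousOn (fun s => F s - dirichletSeries b s) {s | 0 < s.re ∧ s ≠ 1} := by
        intro s hs
        have h1 : ContinuousAt F s :=
          (hF.1.differentiableAt (isOpen_compl_singleton.mem_nhds hs.2)).continuousAt
        exact (h1.sub (hb.differentiableAt hs.1).continuousAt).continuousWithinAt
      have h2 : ContinuousOn (fun p : ℝ × ℝ => F (p.2 + p.1 * Complex.I) -
          dirichletSeries b (p.2 + p.1 * Complex.I)) (Icc 1 T ×ˢ Icc α β) :=
        hcont.comp (f := fun p : ℝ × ℝ => (p.2 + p.1 * Complex.I : ℂ)) (by fun_prop) fun p hp => by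
          refine ⟨?_, hne _ hp.1 _⟩
          have : α ≤ p.2 := hp.2.1
          simp; linarith
      exact ENNReal.continuous_rpow_const.comp_continuousOn h2.enorm
    rw [lintegral_lintegral_swap hmeas, ← lintegral_const_mul' _ _ ENNReal.ofReal_ne_top]
    calc _ ≤ ∫⁻ σ in Icc α β, (ENNReal.ofReal C₁ * (2 * (ENNReal.ofReal (1 + 4 * Real.pi / l) *
          (ENNReal.ofReal C₂ * S)) + E T) +
            ENNReal.ofReal (2 * ‖κ * l‖ ^ 2) * ENNReal.ofReal (1 / T)) := by
          refine setLIntegral_mono' measurableSet_Icc fun σ hσ => ?_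
          rw [setLIntegral_congr_fun (g := fun t : ℝ => ‖H (σ + t * Complex.I) /
            (σ + t * Complex.I - 1) - dirichletSeries b (σ + t * Complex.I)‖ₑ ^ (2 : ℝ))
            measurableSet_Icc fun t ht => by simp only [hFH t ht σ]]
          refine (hC₁ b hb T hT σ hσ).trans ?_
          gcongr ENNReal.ofReal _ * ?_ + _
          refine (hE T hT).trans ?_
          gcongr
      _ = _ := by
          rw [setLIntegral_const, Real.volume_Icc]
          ring
  refine (limsup_le_limsup (v := fun T : ℝ => V * (ENNReal.ofReal C₁ * (2 * (ENNReal.ofReal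
    (1 + 4 * Real.pi / l) * ENNReal.ofReal C₂))) * S + V * (ENNReal.ofReal C₁ * E T +
      ENNReal.ofReal (2 * ‖κ * l‖ ^ 2) * ENNReal.ofReal (1 / T)))
    ((eventually_ge_atTop (1 : ℝ)).mono hT)).trans ?_
  have h0 : Tendsto (fun T : ℝ => ENNReal.ofReal (1 / T)) atTop (𝓝 0) := by
    simpa using ENNReal.tendsto_ofReal (tendsto_const_nhds (x := (1 : ℝ)).div_atTop tendsto_id)
  have hlim : Tendsto (fun T : ℝ => V * (ENNReal.ofReal C₁ * (2 * (ENNReal.ofReal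
    (1 + 4 * Real.pi / l) * ENNReal.ofReal C₂))) * S + V * (ENNReal.ofReal C₁ * E T +
      ENNReal.ofReal (2 * ‖κ * l‖ ^ 2) * ENNReal.ofReal (1 / T))) atTop
      (𝓝 (V * (ENNReal.ofReal C₁ * (2 * (ENNReal.ofReal
    (1 + 4 * Real.pi / l) * ENNReal.ofReal C₂))) * S + V * (ENNReal.ofReal C₁ * 0 +
      ENNReal.ofReal (2 * ‖κ * l‖ ^ 2) * 0))) := by
    refine tendsto_const_nhds.add (ENNReal.Tendsto.const_mul ?_ (Or.inr ENNReal.ofReal_ne_top))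
    exact (ENNReal.Tendsto.const_mul hE0 (Or.inr ENNReal.ofReal_ne_top)).add
      (ENNReal.Tendsto.const_mul h0 (Or.inr ENNReal.ofReal_ne_top))
  rw [hlim.limsup_eq]
  simp

/-- Dirichlet series `b n` that approximate `a` in the square mean, and absolutely convergent for
`Re s > 0`, converge in the mean towards the continuation of the series of `a`. -/
theorem convergesInMean (ha : SelfDual a l κ) {F : ℂ → ℂ}
    (hF : IsContinuation (fun (m : ℕ) s => a m * (m : ℂ) ^ (-s)) F) {b : ℕ → ℕ → ℂ}
    (hb : ∀ n, AbsConvergent (b n))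
    (hlim : ∀ α : ℝ, 1 / 2 < α → Tendsto (fun n => ∑' m : ℕ, ‖a m - b n m‖ₑ ^ (2 : ℝ) *
      ENNReal.ofReal ((m : ℝ) ^ (-2 * α))) atTop (𝓝 0)) {f : ℕ → ℂ → ℂ}
    (hf : ∀ n s, 0 < s.re → f n s = dirichletSeries (b n) s) :
    ConvergesInMean 2 ((1 / 2 : ℝ) : EReal) ⊤ f F := by
  intro α β hα hαβ _
  have hα : 1 / 2 < α := by exact_mod_cast hα
  obtain ⟨C, hC, h⟩ := ha.exists_limsup_le hα hαβ.le hF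
  have h0 := ENNReal.Tendsto.const_mul (hlim α hα) (Or.inr hC)
  rw [mul_zero] at h0
  refine tendsto_of_tendsto_of_tendsto_of_le_of_le tendsto_const_nhds h0 (fun _ => zero_le)
    fun n => ?_
  refine le_trans (le_of_eq ?_) (h (b n) (hb n))
  congr 1
  funext T
  congr 1
  refine lintegral_congr fun t => setLIntegral_congr_fun measurableSet_Icc fun σ hσ => ?_
  rw [hf n _ (by have := hσ.1; simp; linarith)]

end SelfDual

end EpsteinZeta

namespace EpsteinZeta
open Set UniqueFactorizationMonoid

/-! ### The number of ideals of given norm -/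

/-- The elementary inequality behind the divisor bound. -/
theorem exists_forall_add_one_le_mul_rpow {ε : ℝ} (hε : 0 < ε) :
    ∃ M : ℝ, 1 ≤ M ∧ ∀ N : ℕ, 2 ≤ N → ∀ k : ℕ, (k + 1 : ℝ) ≤ M * ((N : ℝ) ^ ε) ^ k := by
  have h2 : (1 : ℝ) < 2 ^ ε := Real.one_lt_rpow one_lt_two hε
  set δ := (2 : ℝ) ^ ε - 1 with hδ
  have hδ0 : 0 < δ := by linarith
  refine ⟨1 + δ⁻¹, by have : 0 < δ⁻¹ := by positivity
                      linarith, fun N hN k => ?_⟩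
  have hb : 1 + (k : ℝ) * δ ≤ (1 + δ) ^ k := one_add_mul_le_pow (by linarith) k
  have hle : (1 + δ) ^ k ≤ ((N : ℝ) ^ ε) ^ k := by
    have : (2 : ℝ) ^ ε ≤ (N : ℝ) ^ ε := by
      gcongr; exact_mod_cast hN
    gcongr; linarith
  calc (k + 1 : ℝ) ≤ (1 + δ⁻¹) * (1 + k * δ) := by
        have : (1 + δ⁻¹) * (1 + k * δ) = 1 + k + δ⁻¹ + k * δ := by field_simp; ring
        rw [this]
        have : 0 < δ⁻¹ := by positivity
        have : 0 ≤ k * δ := by positivity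
        linarith
    _ ≤ (1 + δ⁻¹) * ((N : ℝ) ^ ε) ^ k := by
        gcongr; exact hb.trans hle

variable {K : Type*} [Field K] [NumberField K]

theorem two_le_absNorm_of_prime {P : Ideal (𝓞 K)} (hP : Prime P) : 2 ≤ Ideal.absNorm P := by
  have h0 : Ideal.absNorm P ≠ 0 := by simpa [Ideal.absNorm_eq_zero_iff] using hP.ne_zero
  have h1 : Ideal.absNorm P ≠ 1 := by
    rw [Ne, Ideal.absNorm_eq_one_iff]
    exact fun h => hP.not_isUnit (Ideal.isUnit_iff.2 h)
  omega

theorem absNorm_eq_prod_pow {𝔪 : Ideal (𝓞 K)} (h0 : 𝔪 ≠ 0) :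
    open Classical in (Ideal.absNorm 𝔪 : ℝ) = ∏ P ∈ (normalizedFactors 𝔪).toFinset,
      (Ideal.absNorm P : ℝ) ^ (normalizedFactors 𝔪).count P := by
  classical
  conv_lhs => rw [← normalize_eq 𝔪, ← prod_normalizedFactors_eq h0]
  rw [map_multiset_prod, Finset.prod_multiset_map_count]
  push_cast
  rfl

variable (K) in
/-- The divisor bound for ideals. -/
theorem exists_card_dvd_le {ε : ℝ} (hε : 0 < ε) :
    ∃ C : ℝ, 0 ≤ C ∧ ∀ 𝔪 : Ideal (𝓞 K), 𝔪 ≠ 0 →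
      {𝔫 : Ideal (𝓞 K) | 𝔫 ∣ 𝔪}.Finite ∧
      ({𝔫 : Ideal (𝓞 K) | 𝔫 ∣ 𝔪}.ncard : ℝ) ≤ C * (Ideal.absNorm 𝔪 : ℝ) ^ ε := by
  classical
  obtain ⟨M, hM1, hM⟩ := exists_forall_add_one_le_mul_rpow (ε := ε) hε
  -- only primes of norm less than `B` contribute to the constant
  obtain ⟨B, hB⟩ : ∃ B : ℕ, (2 : ℝ) ≤ (B : ℝ) ^ ε := by
    obtain ⟨B, hB⟩ := exists_nat_ge ((2 : ℝ) ^ (1 / ε))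
    refine ⟨B, ?_⟩
    calc (2 : ℝ) = ((2 : ℝ) ^ (1 / ε)) ^ ε := by
          rw [← Real.rpow_mul (by norm_num), one_div_mul_cancel hε.ne', Real.rpow_one]
      _ ≤ _ := by gcongr
  set S : Finset (Ideal (𝓞 K)) :=
    (Ideal.finite_setOfPred_absNorm_le (S := 𝓞 K) B).toFinset with hS
  refine ⟨M ^ S.card, by positivity, fun 𝔪 h0 => ?_⟩
  set s := normalizedFactors 𝔪 with hs
  have hmaps : ∀ 𝔫 ∈ {𝔫 : Ideal (𝓞 K) | 𝔫 ∣ 𝔪}, normalizedFactors 𝔫 ∈ (Finset.Iic s : Set _) := by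
    intro 𝔫 h𝔫
    have h𝔫 : 𝔫 ∣ 𝔪 := h𝔫
    simp only [Finset.coe_Iic, mem_Iic]
    exact (dvd_iff_normalizedFactors_le_normalizedFactors (ne_zero_of_dvd_ne_zero h0 h𝔫) h0).1 h𝔫
  have hinj : InjOn normalizedFactors {𝔫 : Ideal (𝓞 K) | 𝔫 ∣ 𝔪} := by
    intro x hx y hy hxy
    have := (associated_iff_normalizedFactors_eq_normalizedFactors
      (ne_zero_of_dvd_ne_zero h0 hx) (ne_zero_of_dvd_ne_zero h0 hy)).2 hxy
    exact associated_iff_eq.1 this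
  refine ⟨Finite.of_injOn hmaps hinj (Finset.finite_toSet _), ?_⟩
  have hcard : {𝔫 : Ideal (𝓞 K) | 𝔫 ∣ 𝔪}.ncard ≤ ∏ P ∈ s.toFinset, (s.count P + 1) := by
    rw [← Multiset.card_Iic, ← ncard_coe_finset]
    exact ncard_le_ncard_of_injOn _ hmaps hinj (Finset.finite_toSet _)
  have hprime : ∀ P ∈ s.toFinset, Prime P := fun P hP =>
    prime_of_normalized_factor P (Multiset.mem_toFinset.1 hP)
  calc ({𝔫 : Ideal (𝓞 K) | 𝔫 ∣ 𝔪}.ncard : ℝ) ≤ ∏ P ∈ s.toFinset, ((s.count P : ℝ) + 1) := by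
        exact_mod_cast hcard
    _ ≤ ∏ P ∈ s.toFinset, ((if P ∈ S then M else 1) * ((Ideal.absNorm P : ℝ) ^ ε) ^ s.count P) := by
        refine Finset.prod_le_prod (fun _ _ => by positivity) fun P hP => ?_
        split_ifs with hPS
        · exact hM _ (two_le_absNorm_of_prime (hprime P hP)) _
        · have hBP : B < Ideal.absNorm P := by simpa [hS] using hPS
          have h2 : (2 : ℝ) ≤ (Ideal.absNorm P : ℝ) ^ ε := hB.trans (by gcongr)
          rw [one_mul]
          calc ((s.count P : ℝ) + 1) ≤ 2 ^ s.count P := by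
                exact_mod_cast Nat.succ_le_of_lt Nat.lt_two_pow_self
            _ ≤ _ := by gcongr
    _ = (∏ P ∈ s.toFinset, if P ∈ S then M else 1) * (Ideal.absNorm 𝔪 : ℝ) ^ ε := by
        rw [Finset.prod_mul_distrib, absNorm_eq_prod_pow h0, ← Real.finsetProd_rpow _ _ fun _ _ => by positivity]
        congr 1
        refine Finset.prod_congr rfl fun P _ => ?_
        rw [← Real.rpow_natCast, ← Real.rpow_natCast, ← Real.rpow_mul (by positivity),
          ← Real.rpow_mul (by positivity), mul_comm]
    _ ≤ M ^ S.card * (Ideal.absNorm 𝔪 : ℝ) ^ ε := by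
        gcongr
        rw [Finset.prod_ite, Finset.prod_const, Finset.prod_const_one, mul_one]
        refine pow_le_pow_right₀ hM1 (Finset.card_le_card fun P hP => ?_)
        exact (Finset.mem_filter.1 hP).2

/-- The nonzero ideals of norm `m`. -/
abbrev IdealOfNorm (K : Type*) [Field K] [NumberField K] (m : ℕ) : Type _ :=
  {𝔫 : (Ideal (𝓞 K))⁰ // Ideal.absNorm (𝔫 : Ideal (𝓞 K)) = m}

theorem absNorm_pos (𝔫 : (Ideal (𝓞 K))⁰) : 0 < Ideal.absNorm (𝔫 : Ideal (𝓞 K)) :=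
  Nat.pos_of_ne_zero fun h =>
    nonZeroDivisors.ne_zero 𝔫.2 (Ideal.absNorm_eq_zero_iff.1 h)

instance (m : ℕ) : Finite (IdealOfNorm K m) :=
  have := (Ideal.finite_setOfPred_absNorm_le (S := 𝓞 K) m).to_subtype
  Finite.of_injective (β := {I : Ideal (𝓞 K) | Ideal.absNorm I ≤ m})
    (fun 𝔫 => ⟨𝔫.1.1, 𝔫.2.le⟩)
    fun _ _ h => Subtype.ext (Subtype.ext (Subtype.mk.inj h))

instance isEmpty_idealOfNorm_zero : IsEmpty (IdealOfNorm K 0) :=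
  ⟨fun 𝔫 => (absNorm_pos 𝔫.1).ne' 𝔫.2⟩

variable (K) in
theorem exists_card_idealOfNorm_le {ε : ℝ} (hε : 0 < ε) :
    ∃ C : ℝ, 0 ≤ C ∧ ∀ m : ℕ, (Nat.card (IdealOfNorm K m) : ℝ) ≤ C * (m : ℝ) ^ ε := by
  set d := Module.finrank ℚ K with hd
  have hd0 : 0 < d := Module.finrank_pos
  obtain ⟨C, hC0, hC⟩ := exists_card_dvd_le K (ε := ε / d) (by positivity)
  refine ⟨C, hC0, fun m => ?_⟩
  rcases eq_or_ne m 0 with rfl | hm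
  · rw [Nat.card_of_isEmpty]; simp [Real.zero_rpow hε.ne']
  have hm0 : Ideal.span {(m : 𝓞 K)} ≠ 0 := by simpa using hm
  obtain ⟨hfin, hle⟩ := hC _ hm0
  have hnorm : Ideal.absNorm (Ideal.span {(m : 𝓞 K)}) = m ^ d := by
    rw [Ideal.absNorm_span_singleton]
    have := Algebra.norm_algebraMap (S := 𝓞 K) (m : ℤ)
    simp only [algebraMap_int_eq, eq_intCast, Int.cast_natCast] at this
    rw [this, Int.natAbs_pow, Int.natAbs_natCast, hd, NumberField.RingOfIntegers.rank]
  have hcard : Nat.card (IdealOfNorm K m) ≤ {𝔫 : Ideal (𝓞 K) | 𝔫 ∣ Ideal.span {(m : 𝓞 K)}}.ncard := by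
    rw [← Nat.card_coe_set_eq]
    have := hfin.to_subtype
    refine Nat.card_le_card_of_injective (fun 𝔫 => ⟨𝔫.1.1, ?_⟩) fun x y h => ?_
    · have := Ideal.absNorm_mem 𝔫.1.1
      rw [𝔫.2] at this
      exact Ideal.dvd_span_singleton.2 this
    · exact Subtype.ext (Subtype.ext (Subtype.mk.inj h))
  calc (Nat.card (IdealOfNorm K m) : ℝ) ≤ _ := by exact_mod_cast hcard
    _ ≤ _ := hle
    _ = _ := by
      rw [hnorm, Nat.cast_pow, ← Real.rpow_natCast, ← Real.rpow_mul (by positivity)]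
      congr 2; field_simp

end EpsteinZeta

namespace EpsteinZeta
open Set

/-! ### Dirichlet series over ideals -/

variable {K : Type*} [Field K] [NumberField K]

/-- The coefficient of `m^{-s}` in the Dirichlet series `∑ u(𝔫) N(𝔫)^{-s}` over nonzero ideals. -/
def idealCoeff (u : (Ideal (𝓞 K))⁰ → ℂ) (m : ℕ) : ℂ := ∑' 𝔫 : IdealOfNorm K m, u 𝔫.1

theorem idealCoeff_zero (u : (Ideal (𝓞 K))⁰ → ℂ) : idealCoeff u 0 = 0 := tsum_empty

theorem norm_idealCoeff_le {u : (Ideal (𝓞 K))⁰ → ℂ} (hu : ∀ 𝔫, ‖u 𝔫‖ ≤ 1) (m : ℕ) :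
    ‖idealCoeff u m‖ ≤ Nat.card (IdealOfNorm K m) := by
  have := Fintype.ofFinite (IdealOfNorm K m)
  rw [idealCoeff, tsum_fintype, Nat.card_eq_fintype_card]
  refine (norm_sum_le _ _).trans ((Finset.sum_le_sum fun 𝔫 _ => hu 𝔫.1).trans (le_of_eq ?_))
  simp

theorem idealCoeff_sub (u v : (Ideal (𝓞 K))⁰ → ℂ) (m : ℕ) :
    idealCoeff (u - v) m = idealCoeff u m - idealCoeff v m := by
  have := Fintype.ofFinite (IdealOfNorm K m)
  simp only [idealCoeff, tsum_fintype, Pi.sub_apply, Finset.sum_sub_distrib]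

variable (K) in
/-- The square sums of the numbers of ideals of given norm converge as they do for bounded
sequences, by the divisor bound. -/
theorem summable_card_sq {σ : ℝ} (hσ : 1 / 2 < σ) :
    Summable fun m : ℕ => (Nat.card (IdealOfNorm K m) : ℝ) ^ 2 * (m : ℝ) ^ (-2 * σ) := by
  set ε := (2 * σ - 1) / 4 with hε
  have hε0 : 0 < ε := by rw [hε]; linarith
  obtain ⟨C, hC0, hC⟩ := exists_card_idealOfNorm_le K hε0
  have hs : Summable fun m : ℕ => C ^ 2 * (m : ℝ) ^ (2 * ε - 2 * σ) :=
    (Real.summable_nat_rpow.2 (by rw [hε]; linarith)).mul_left _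
  refine Summable.of_nonneg_of_le (fun m => by positivity) (fun m => ?_) hs
  rcases eq_or_ne m 0 with rfl | hm
  · rw [Nat.card_of_isEmpty]
    have : 0 ≤ C ^ 2 * ((0 : ℕ) : ℝ) ^ (2 * ε - 2 * σ) := by positivity
    simpa using this
  have hm0 : (0 : ℝ) < m := by exact_mod_cast Nat.pos_of_ne_zero hm
  calc _ ≤ (C * (m : ℝ) ^ ε) ^ 2 * (m : ℝ) ^ (-2 * σ) := by gcongr; exact hC m
    _ = _ := by
      rw [mul_pow, ← Real.rpow_natCast ((m : ℝ) ^ ε), ← Real.rpow_mul hm0.le, mul_assoc,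
        ← Real.rpow_add hm0]
      congr 2; push_cast; ring

theorem summable_idealCoeff_sq {u : (Ideal (𝓞 K))⁰ → ℂ} (hu : ∀ 𝔫, ‖u 𝔫‖ ≤ 1) {σ : ℝ}
    (hσ : 1 / 2 < σ) : Summable fun m : ℕ => ‖idealCoeff u m‖ ^ 2 * (m : ℝ) ^ (-2 * σ) := by
  refine Summable.of_nonneg_of_le (fun m => by positivity) (fun m => ?_) (summable_card_sq K hσ)
  gcongr
  exact norm_idealCoeff_le hu m

theorem summable_ideal_iff {g : ℕ → ℝ} (hg : ∀ m, 0 ≤ g m) :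
    (Summable fun 𝔫 : (Ideal (𝓞 K))⁰ => g (Ideal.absNorm (𝔫 : Ideal (𝓞 K)))) ↔
      Summable fun m : ℕ => (Nat.card (IdealOfNorm K m) : ℝ) * g m := by
  rw [← (Equiv.sigmaFiberEquiv fun 𝔫 : (Ideal (𝓞 K))⁰ =>
    Ideal.absNorm (𝔫 : Ideal (𝓞 K))).summable_iff, summable_sigma_of_nonneg (by exact fun _ => hg _)]
  have h : ∀ (m : ℕ) (𝔫 : IdealOfNorm K m), g (Ideal.absNorm (𝔫.1 : Ideal (𝓞 K))) = g m :=
    fun m 𝔫 => by rw [𝔫.2]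
  have hfin (m : ℕ) : Finite {𝔫 : (Ideal (𝓞 K))⁰ // Ideal.absNorm (𝔫 : Ideal (𝓞 K)) = m} :=
    inferInstanceAs (Finite (IdealOfNorm K m))
  have hval (m : ℕ) : ∑' 𝔫 : IdealOfNorm K m, g (Ideal.absNorm (𝔫.1 : Ideal (𝓞 K))) =
      (Nat.card (IdealOfNorm K m) : ℝ) * g m := by
    have := Fintype.ofFinite (IdealOfNorm K m)
    simp_rw [h m, tsum_fintype, Nat.card_eq_fintype_card]
    simp
  constructor
  · rintro ⟨-, h2⟩
    exact h2.congr fun m => hval m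
  · exact fun h2 => ⟨fun m => summable_of_hasFiniteSupport (toFinite _), h2.congr fun m => (hval m).symm⟩

variable (K) in
theorem summable_absNorm_rpow {s : ℝ} (hs : 1 < s) :
    Summable fun 𝔫 : (Ideal (𝓞 K))⁰ => (Ideal.absNorm (𝔫 : Ideal (𝓞 K)) : ℝ) ^ (-s) := by
  rw [summable_ideal_iff (g := fun m => (m : ℝ) ^ (-s)) fun m => by positivity]
  have hε0 : 0 < (s - 1) / 2 := by linarith
  obtain ⟨C, hC0, hC⟩ := exists_card_idealOfNorm_le K hε0
  refine Summable.of_nonneg_of_le (fun m => by positivity) (fun m => ?_)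
    ((Real.summable_nat_rpow.2 (by linarith : (s - 1) / 2 - s < -1)).mul_left C)
  rcases eq_or_ne m 0 with rfl | hm
  · rw [Nat.card_of_isEmpty]
    have : 0 ≤ C * ((0 : ℕ) : ℝ) ^ ((s - 1) / 2 - s) := by positivity
    simpa using this
  have hm0 : (0 : ℝ) < m := by exact_mod_cast Nat.pos_of_ne_zero hm
  calc _ ≤ (C * (m : ℝ) ^ ((s - 1) / 2)) * (m : ℝ) ^ (-s) := by gcongr; exact hC m
    _ = _ := by rw [mul_assoc, ← Real.rpow_add hm0, ← sub_eq_add_neg]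

/-- Summation over ideals, by norm. -/
theorem hasSum_idealCoeff {u : (Ideal (𝓞 K))⁰ → ℂ} {g : ℕ → ℂ} {S : ℂ}
    (h : HasSum (fun 𝔫 : (Ideal (𝓞 K))⁰ => u 𝔫 * g (Ideal.absNorm (𝔫 : Ideal (𝓞 K)))) S) :
    HasSum (fun m : ℕ => idealCoeff u m * g m) S := by
  rw [← (Equiv.sigmaFiberEquiv fun 𝔫 : (Ideal (𝓞 K))⁰ =>
    Ideal.absNorm (𝔫 : Ideal (𝓞 K))).hasSum_iff] at h
  refine h.sigma fun m => ?_
  have hfin : Finite {𝔫 : (Ideal (𝓞 K))⁰ // Ideal.absNorm (𝔫 : Ideal (𝓞 K)) = m} :=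
    inferInstanceAs (Finite (IdealOfNorm K m))
  have h1 : HasSum (fun 𝔫 : IdealOfNorm K m => u 𝔫.1 * g m) (idealCoeff u m * g m) :=
    (Summable.hasSum (summable_of_hasFiniteSupport (toFinite _))).mul_right _
  have h2 : (fun 𝔫 : IdealOfNorm K m => u 𝔫.1 * g (Ideal.absNorm (𝔫.1 : Ideal (𝓞 K)))) =
      fun 𝔫 => u 𝔫.1 * g m := funext fun 𝔫 => by rw [𝔫.2]
  exact h2 ▸ h1

/-- Absolute convergence passes from the sum over ideals to the sum over norms. -/
theorem summable_norm_idealCoeff_mul {u : (Ideal (𝓞 K))⁰ → ℂ} {g : ℕ → ℝ} (hg : ∀ m, 0 ≤ g m)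
    (h : Summable fun 𝔫 : (Ideal (𝓞 K))⁰ => ‖u 𝔫‖ * g (Ideal.absNorm (𝔫 : Ideal (𝓞 K)))) :
    Summable fun m : ℕ => ‖idealCoeff u m‖ * g m := by
  rw [← (Equiv.sigmaFiberEquiv fun 𝔫 : (Ideal (𝓞 K))⁰ =>
    Ideal.absNorm (𝔫 : Ideal (𝓞 K))).summable_iff, summable_sigma_of_nonneg
      (by exact fun _ => mul_nonneg (norm_nonneg _) (hg _))] at h
  refine Summable.of_nonneg_of_le (fun m => mul_nonneg (norm_nonneg _) (hg m)) (fun m => ?_) h.2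
  have := Fintype.ofFinite (IdealOfNorm K m)
  have h1 : ∑' 𝔫 : IdealOfNorm K m, ‖u 𝔫.1‖ * g (Ideal.absNorm (𝔫.1 : Ideal (𝓞 K))) =
      (∑ 𝔫 : IdealOfNorm K m, ‖u 𝔫.1‖) * g m := by
    rw [tsum_fintype, Finset.sum_mul]
    exact Finset.sum_congr rfl fun 𝔫 _ => by rw [𝔫.2]
  refine le_trans ?_ (le_of_eq h1.symm)
  rw [idealCoeff, tsum_fintype]
  exact mul_le_mul_of_nonneg_right (norm_sum_le _ _) (hg m)

end EpsteinZeta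

namespace EpsteinZeta
open Set IsDedekindDomain

/-! ### Finite Euler products -/

variable {K : Type*} [Field K] [NumberField K]

/-- All prime divisors of the ideal belong to `S`. -/
def IsSmooth (S : Finset (HeightOneSpectrum (𝓞 K))) (𝔫 : (Ideal (𝓞 K))⁰) : Prop :=
  ∀ v : HeightOneSpectrum (𝓞 K), v.asIdeal ∣ (𝔫 : Ideal (𝓞 K)) → v ∈ S

theorem eq_one_of_isSmooth_empty {𝔫 : (Ideal (𝓞 K))⁰} (h : IsSmooth ∅ 𝔫) : 𝔫 = 1 := by
  by_contra hne
  have hu : ¬ IsUnit (𝔫 : Ideal (𝓞 K)) := fun hu => hne (Subtype.ext (by simpa using hu))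
  obtain ⟨P, hP, hdvd⟩ := WfDvdMonoid.exists_irreducible_factor hu (nonZeroDivisors.ne_zero 𝔫.2)
  exact absurd (h ⟨P, Ideal.isPrime_of_prime hP.prime, hP.ne_zero⟩ hdvd) (by simp)

theorem isSmooth_one (S : Finset (HeightOneSpectrum (𝓞 K))) : IsSmooth S 1 := fun v hv =>
  absurd (isUnit_of_dvd_one hv) v.prime.not_isUnit

open Classical in
theorem isSmooth_pow_mul {S : Finset (HeightOneSpectrum (𝓞 K))} {v : HeightOneSpectrum (𝓞 K)} (k : ℕ)
    {𝔫 : (Ideal (𝓞 K))⁰} (h : IsSmooth S 𝔫) : IsSmooth (insert v S) (primeIdeal v ^ k * 𝔫) := by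
  intro w hw
  rcases w.prime.dvd_or_dvd hw with h1 | h1
  · have h2 : w.asIdeal ∣ v.asIdeal := w.prime.dvd_of_dvd_pow h1
    have h3 : w.asIdeal = v.asIdeal :=
      associated_iff_eq.1 (w.prime.associated_of_dvd v.prime h2)
    exact Finset.mem_insert.2 (Or.inl (HeightOneSpectrum.ext h3))
  · exact Finset.mem_insert.2 (Or.inr (h w h1))

open Classical in
/-- An ideal with prime divisors in `S ∪ {v}` is a power of `v` times an ideal with prime divisors
in `S`. -/
def smoothEquiv {S : Finset (HeightOneSpectrum (𝓞 K))} {v : HeightOneSpectrum (𝓞 K)} (hv : v ∉ S) :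
    ℕ × {𝔫 : (Ideal (𝓞 K))⁰ // IsSmooth S 𝔫} ≃ {𝔫 : (Ideal (𝓞 K))⁰ // IsSmooth (insert v S) 𝔫} :=
  Equiv.ofBijective (fun p => ⟨primeIdeal v ^ p.1 * p.2.1, isSmooth_pow_mul p.1 p.2.2⟩) <| by
    have hnd : ∀ 𝔫 : {𝔫 : (Ideal (𝓞 K))⁰ // IsSmooth S 𝔫}, ¬ v.asIdeal ∣ (𝔫.1 : Ideal (𝓞 K)) :=
      fun 𝔫 h => hv (𝔫.2 v h)
    have hv0 : v.asIdeal ≠ 0 := v.ne_bot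
    constructor
    · rintro ⟨j, 𝔞⟩ ⟨k, 𝔟⟩ h
      have h : v.asIdeal ^ j * (𝔞.1 : Ideal (𝓞 K)) = v.asIdeal ^ k * (𝔟.1 : Ideal (𝓞 K)) :=
        congrArg Subtype.val (Subtype.mk.inj h)
      have aux : ∀ (i d : ℕ) (𝔠 𝔡 : {𝔫 : (Ideal (𝓞 K))⁰ // IsSmooth S 𝔫}),
          v.asIdeal ^ i * (𝔠.1 : Ideal (𝓞 K)) = v.asIdeal ^ (i + d) * (𝔡.1 : Ideal (𝓞 K)) →
            d = 0 := by
        intro i d 𝔠 𝔡 h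
        by_contra hd
        rw [pow_add, mul_assoc] at h
        have h' := mul_left_cancel₀ (pow_ne_zero i hv0) h
        exact hnd 𝔠 (h' ▸ Dvd.dvd.mul_right (dvd_pow_self _ hd) _)
      have hjk : j = k := by
        rcases le_total j k with hle | hle
        · obtain ⟨d, rfl⟩ := Nat.exists_eq_add_of_le hle
          have := aux j d 𝔞 𝔟 h
          omega
        · obtain ⟨d, rfl⟩ := Nat.exists_eq_add_of_le hle
          have := aux k d 𝔟 𝔞 h.symm
          omega
      subst hjk
      have := mul_left_cancel₀ (pow_ne_zero j hv0) h
      exact Prod.ext rfl (Subtype.ext (Subtype.ext this))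
    · rintro ⟨𝔫, h𝔫⟩
      have h0 : (𝔫 : Ideal (𝓞 K)) ≠ 0 := nonZeroDivisors.ne_zero 𝔫.2
      obtain ⟨𝔠, hc, hvc⟩ := (FiniteMultiplicity.of_not_isUnit (a := v.asIdeal)
        (b := (𝔫 : Ideal (𝓞 K))) v.prime.not_isUnit h0).exists_eq_pow_mul_and_not_dvd
      have hc0 : 𝔠 ≠ 0 := by rintro rfl; simp at hc; exact h0 hc
      refine ⟨(_, ⟨⟨𝔠, mem_nonZeroDivisors_of_ne_zero hc0⟩, fun w hw => ?_⟩),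
        Subtype.ext (Subtype.ext hc.symm)⟩
      have hw' : w.asIdeal ∣ (𝔫 : Ideal (𝓞 K)) := hc ▸ Dvd.dvd.mul_left hw _
      rcases Finset.mem_insert.1 (h𝔫 w hw') with rfl | h
      · exact absurd hw hvc
      · exact h

theorem hasSum_geometric_mul {ι : Type*} {g : ι → ℂ} {r S : ℂ} (hr : ‖r‖ < 1)
    (hg : Summable fun i => ‖g i‖) (hS : HasSum g S) :
    (Summable fun p : ℕ × ι => ‖r ^ p.1 * g p.2‖) ∧
      HasSum (fun p : ℕ × ι => r ^ p.1 * g p.2) ((1 - r)⁻¹ * S) := by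
  have h1 := summable_norm_geometric_of_norm_lt_one hr
  refine ⟨?_, (hasSum_geometric_of_norm_lt_one hr).mul hS (summable_mul_of_summable_norm h1 hg)⟩
  simp_rw [norm_mul]
  exact h1.mul_of_nonneg hg (fun _ => norm_nonneg _) fun _ => norm_nonneg _

/-- The Euler product of a completely multiplicative function over finitely many primes. -/
theorem hasSum_isSmooth (f : (Ideal (𝓞 K))⁰ →* ℂ) (S : Finset (HeightOneSpectrum (𝓞 K)))
    (hf : ∀ v ∈ S, ‖f (primeIdeal v)‖ < 1) :
    (Summable fun 𝔫 : {𝔫 : (Ideal (𝓞 K))⁰ // IsSmooth S 𝔫} => ‖f 𝔫.1‖) ∧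
      HasSum (fun 𝔫 : {𝔫 : (Ideal (𝓞 K))⁰ // IsSmooth S 𝔫} => f 𝔫.1)
        (∏ v ∈ S, (1 - f (primeIdeal v))⁻¹) := by
  classical
  induction S using Finset.induction_on with
  | empty =>
    let _ : Unique {𝔫 : (Ideal (𝓞 K))⁰ // IsSmooth ∅ 𝔫} :=
      { default := ⟨1, isSmooth_one _⟩
        uniq := fun 𝔫 => Subtype.ext (eq_one_of_isSmooth_empty 𝔫.2) }
    refine ⟨summable_of_hasFiniteSupport (toFinite _), ?_⟩
    have h := hasSum_unique fun 𝔫 : {𝔫 : (Ideal (𝓞 K))⁰ // IsSmooth ∅ 𝔫} => f 𝔫.1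
    have hd : f (default : {𝔫 : (Ideal (𝓞 K))⁰ // IsSmooth ∅ 𝔫}).1 = 1 := map_one f
    rw [hd] at h
    rwa [Finset.prod_empty]
  | insert v S hv ih =>
    obtain ⟨h1, h2⟩ := ih fun w hw => hf w (Finset.mem_insert_of_mem hw)
    have hfv := hf v (Finset.mem_insert_self _ _)
    have hval : ∀ p : ℕ × {𝔫 : (Ideal (𝓞 K))⁰ // IsSmooth S 𝔫},
        f (smoothEquiv hv p).1 = f (primeIdeal v) ^ p.1 * f p.2.1 := fun p => by
      rw [← map_pow, ← map_mul]; rfl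
    rw [← (smoothEquiv hv).summable_iff, ← (smoothEquiv hv).hasSum_iff, Finset.prod_insert hv]
    obtain ⟨h3, h4⟩ := hasSum_geometric_mul hfv h1 h2
    refine ⟨h3.congr fun p => ?_, ?_⟩
    · rw [Function.comp_apply, hval]
    · have e : (fun 𝔫 : {𝔫 : (Ideal (𝓞 K))⁰ // IsSmooth (insert v S) 𝔫} => f 𝔫.1) ∘ smoothEquiv hv =
          fun p => f (primeIdeal v) ^ p.1 * f p.2.1 := funext hval
      rw [e]
      exact h4

/-! ### Hecke characters and truncated Euler products -/

theorem norm_classCharacter (χ : ClassGroup (𝓞 K) →* ℂˣ) (C : ClassGroup (𝓞 K)) :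
    ‖(χ C : ℂ)‖ = 1 := by
  have h : (χ C : ℂ) ^ Fintype.card (ClassGroup (𝓞 K)) = 1 := by
    rw [← Units.val_pow_eq_pow_val, ← map_pow, pow_card_eq_one]; simp
  exact Complex.norm_eq_one_of_pow_eq_one h Fintype.card_ne_zero

/-- The values `χ(𝔫)` of a class group character on ideals. -/
def idealChar (χ : ClassGroup (𝓞 K) →* ℂˣ) (𝔫 : (Ideal (𝓞 K))⁰) : ℂ := χ (ClassGroup.mk0 𝔫)

theorem norm_idealChar (χ : ClassGroup (𝓞 K) →* ℂˣ) (𝔫 : (Ideal (𝓞 K))⁰) : ‖idealChar χ 𝔫‖ = 1 :=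
  norm_classCharacter χ _

/-- The term of the Hecke series, as a multiplicative function of the ideal. -/
def heckeHom (χ : ClassGroup (𝓞 K) →* ℂˣ) (s : ℂ) : (Ideal (𝓞 K))⁰ →* ℂ where
  toFun 𝔫 := heckeTerm χ 𝔫 s
  map_one' := by simp [heckeTerm]
  map_mul' 𝔪 𝔫 := by
    simp only [heckeTerm, map_mul, Units.val_mul, Submonoid.coe_mul, Nat.cast_mul]
    rw [Complex.natCast_mul_natCast_cpow]
    ring

theorem norm_heckeTerm (χ : ClassGroup (𝓞 K) →* ℂˣ) (𝔫 : (Ideal (𝓞 K))⁰) (s : ℂ) :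
    ‖heckeTerm χ 𝔫 s‖ = (Ideal.absNorm (𝔫 : Ideal (𝓞 K)) : ℝ) ^ (-s.re) := by
  rw [heckeTerm, norm_mul, norm_classCharacter, one_mul,
    Complex.norm_natCast_cpow_of_pos (absNorm_pos 𝔫), Complex.neg_re]

theorem norm_heckeTerm_primeIdeal_lt_one (χ : ClassGroup (𝓞 K) →* ℂˣ)
    (v : HeightOneSpectrum (𝓞 K)) {s : ℂ} (hs : 0 < s.re) : ‖heckeTerm χ (primeIdeal v) s‖ < 1 := by
  rw [norm_heckeTerm]
  have h2 : 2 ≤ Ideal.absNorm v.asIdeal := two_le_absNorm_of_prime v.prime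
  exact Real.rpow_lt_one_of_one_lt_of_neg (by exact_mod_cast h2) (by linarith)

theorem summable_norm_heckeTerm (χ : ClassGroup (𝓞 K) →* ℂˣ) {s : ℂ} (hs : 1 < s.re) :
    Summable fun 𝔫 => ‖heckeTerm χ 𝔫 s‖ := by
  simp_rw [norm_heckeTerm]
  exact summable_absNorm_rpow K hs

open Classical in
/-- The character `χ`, restricted to the ideals all of whose prime divisors have norm at most
`p_n`. -/
def truncChar (χ : ClassGroup (𝓞 K) →* ℂˣ) (n : ℕ) (𝔫 : (Ideal (𝓞 K))⁰) : ℂ :=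
  if IsSmooth (finite_primes_absNorm_le K (nthPrime n)).toFinset 𝔫 then idealChar χ 𝔫 else 0

theorem hasSum_truncChar (χ : ClassGroup (𝓞 K) →* ℂˣ) (n : ℕ) {s : ℂ} (hs : 0 < s.re) :
    (Summable fun 𝔫 : (Ideal (𝓞 K))⁰ => ‖truncChar χ n 𝔫‖ *
        (Ideal.absNorm (𝔫 : Ideal (𝓞 K)) : ℝ) ^ (-s.re)) ∧
      HasSum (fun 𝔫 : (Ideal (𝓞 K))⁰ => truncChar χ n 𝔫 *
        (Ideal.absNorm (𝔫 : Ideal (𝓞 K)) : ℂ) ^ (-s)) (truncL χ n s) := by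
  obtain ⟨h1, h2⟩ := hasSum_isSmooth (heckeHom χ s) (finite_primes_absNorm_le K (nthPrime n)).toFinset
    fun v _ => norm_heckeTerm_primeIdeal_lt_one χ v hs
  set S := (finite_primes_absNorm_le K (nthPrime n)).toFinset with hS
  have hsub : ∀ x : {𝔫 : (Ideal (𝓞 K))⁰ // IsSmooth S 𝔫}, truncChar χ n x.1 = idealChar χ x.1 :=
    fun x => if_pos x.2
  have hout : ∀ x ∉ range (Subtype.val : {𝔫 : (Ideal (𝓞 K))⁰ // IsSmooth S 𝔫} → _),
      truncChar χ n x = 0 := fun x hx => if_neg fun h => hx ⟨⟨x, h⟩, rfl⟩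
  constructor
  · refine (Subtype.val_injective.summable_iff fun x hx => ?_).1 (h1.congr fun x => Eq.symm ?_)
    · rw [hout x hx, norm_zero, zero_mul]
    · rw [Function.comp_apply, hsub, norm_idealChar, one_mul]
      exact (norm_heckeTerm χ x.1 s).symm
  · refine (Function.Injective.hasSum_iff (g := (Subtype.val :
      {𝔫 : (Ideal (𝓞 K))⁰ // IsSmooth S 𝔫} → _)) Subtype.val_injective fun x hx => ?_).1 ?_
    · rw [hout x hx, zero_mul]
    · have e : (fun 𝔫 : (Ideal (𝓞 K))⁰ => truncChar χ n 𝔫 *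
          (Ideal.absNorm (𝔫 : Ideal (𝓞 K)) : ℂ) ^ (-s)) ∘
            (Subtype.val : {𝔫 : (Ideal (𝓞 K))⁰ // IsSmooth S 𝔫} → _) =
          fun x => heckeHom χ s x.1 := funext fun x => by
        rw [Function.comp_apply, hsub]; rfl
      rw [e]; exact h2

theorem absConvergent_idealCoeff_truncChar (χ : ClassGroup (𝓞 K) →* ℂˣ) (n : ℕ) :
    AbsConvergent (idealCoeff (truncChar χ n)) where
  zero := idealCoeff_zero _
  summable ε hε := summable_norm_idealCoeff_mul (g := fun m => (m : ℝ) ^ (-ε))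
    (fun m => by positivity) (by simpa using (hasSum_truncChar χ n (s := (ε : ℂ)) (by simpa)).1)

theorem truncL_eq_dirichletSeries (χ : ClassGroup (𝓞 K) →* ℂˣ) (n : ℕ) {s : ℂ} (hs : 0 < s.re) :
    truncL χ n s = dirichletSeries (idealCoeff (truncChar χ n)) s :=
  (hasSum_idealCoeff (g := fun m => (m : ℂ) ^ (-s)) (hasSum_truncChar χ n hs).2).tsum_eq.symm

/-- An ideal of norm at most `p_n` has only prime divisors of norm at most `p_n`. -/
theorem truncChar_eq {χ : ClassGroup (𝓞 K) →* ℂˣ} {n : ℕ} {𝔫 : (Ideal (𝓞 K))⁰}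
    (h : Ideal.absNorm (𝔫 : Ideal (𝓞 K)) ≤ nthPrime n) : truncChar χ n 𝔫 = idealChar χ 𝔫 := by
  refine if_pos fun v hv => ?_
  have := Nat.le_of_dvd (absNorm_pos 𝔫) (Ideal.absNorm_dvd_absNorm_of_le (Ideal.le_of_dvd hv))
  simpa using this.trans h

theorem norm_idealChar_sub_truncChar_le (χ : ClassGroup (𝓞 K) →* ℂˣ) (n : ℕ) (𝔫 : (Ideal (𝓞 K))⁰) :
    ‖(idealChar χ - truncChar χ n) 𝔫‖ ≤ 1 := by
  rw [Pi.sub_apply, truncChar]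
  split_ifs
  · simp
  · rw [sub_zero, norm_idealChar]

theorem tendsto_nthPrime : Tendsto nthPrime atTop atTop :=
  (Nat.nth_strictMono Nat.infinite_setOfPred_prime).tendsto_atTop.comp (tendsto_sub_atTop_nat 1)

theorem idealCoeff_sub_truncChar_eq_zero (χ : ClassGroup (𝓞 K) →* ℂˣ) {n m : ℕ}
    (h : m ≤ nthPrime n) : idealCoeff (idealChar χ) m - idealCoeff (truncChar χ n) m = 0 := by
  rw [← idealCoeff_sub, idealCoeff]
  refine (tsum_congr fun 𝔫 => ?_).trans tsum_zero
  rw [Pi.sub_apply, truncChar_eq (𝔫.2.trans_le h), sub_self]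

/-- The truncated coefficients agree with those of `L(s, χ)` up to `m = p_n`, and the tails tend to
`0`. -/
theorem tendsto_tsum_idealCoeff_sub (χ : ClassGroup (𝓞 K) →* ℂˣ) {α : ℝ} (hα : 1 / 2 < α) :
    Tendsto (fun n => ∑' m : ℕ, ‖idealCoeff (idealChar χ) m - idealCoeff (truncChar χ n) m‖ₑ ^ (2 : ℝ) *
      ENNReal.ofReal ((m : ℝ) ^ (-2 * α))) atTop (𝓝 0) := by
  have hs := summable_card_sq K hα
  set g : ℕ → ENNReal := fun m =>
    ENNReal.ofReal ((Nat.card (IdealOfNorm K m) : ℝ) ^ 2 * (m : ℝ) ^ (-2 * α)) with hg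
  have hgs : ∑' m, g m ≠ ⊤ := hs.tsum_ofReal_ne_top
  have htail := (ENNReal.tendsto_sum_nat_add g hgs).comp tendsto_nthPrime
  refine tendsto_of_tendsto_of_tendsto_of_le_of_le tendsto_const_nhds htail (fun _ => zero_le)
    fun n => ?_
  set N := nthPrime n with hN
  rw [← Summable.sum_add_tsum_nat_add' (k := N) ENNReal.summable, Finset.sum_eq_zero, zero_add]
  · refine ENNReal.tsum_le_tsum fun k => ?_
    simp only [hg]
    rw [← idealCoeff_sub, enorm_sq, ← ENNReal.ofReal_mul (by positivity)]
    gcongr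
    exact norm_idealCoeff_le (norm_idealChar_sub_truncChar_le χ n) _
  · intro m hm
    rw [idealCoeff_sub_truncChar_eq_zero χ (Finset.mem_range.1 hm).le]
    simp

end EpsteinZeta

namespace EpsteinZeta
open Set

/-! ### Theta series of binary quadratic forms -/

/-- The value of a real binary quadratic form at an integer vector. -/
def realForm (A B C : ℝ) (v : ℤ × ℤ) : ℝ := A * v.1 ^ 2 + B * v.1 * v.2 + C * v.2 ^ 2

/-- The theta series `∑ e^{-π z q(x, y) / ρ}` of the form `q = A x² + B x y + C y²`. -/
def formTheta (A B C ρ : ℝ) (z : ℂ) : ℂ :=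
  ∑' v : ℤ × ℤ, Complex.exp (-((Real.pi / ρ * realForm A B C v : ℝ)) * z)

theorem summable_exp_neg_mul_int_sq {c : ℝ} (hc : 0 < c) :
    Summable fun n : ℤ => Real.exp (-(c * n ^ 2)) := by
  have h := ((summable_jacobiTheta₂_term_iff 0 ((c / Real.pi : ℝ) * Complex.I)).2 (by
    rw [Complex.im_ofReal_mul]; simp; positivity)).norm
  refine h.congr fun n => ?_
  rw [norm_jacobiTheta₂_term, Complex.im_ofReal_mul]
  simp only [Complex.I_im, Complex.zero_im, mul_zero, sub_zero, mul_one]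
  congr 1
  field_simp

theorem summable_exp_neg_mul_int_sq_prod {c d : ℝ} (hc : 0 < c) (hd : 0 < d) :
    Summable fun v : ℤ × ℤ => Real.exp (-(c * v.1 ^ 2)) * Real.exp (-(d * v.2 ^ 2)) :=
  (summable_exp_neg_mul_int_sq hc).mul_of_nonneg (summable_exp_neg_mul_int_sq hd)
    (fun _ => (Real.exp_pos _).le) fun _ => (Real.exp_pos _).le

variable {A B C ρ : ℝ}

theorem le_realForm (hA : 0 < A) (hρ : 0 < ρ) (h : 4 * A * C - B ^ 2 = 4 * ρ ^ 2) :
    0 < A + C ∧ ∀ v : ℤ × ℤ, ρ ^ 2 / (A + C) * ((v.1 : ℝ) ^ 2 + (v.2 : ℝ) ^ 2) ≤ realForm A B C v := by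
  have hC : 0 < C := by
    by_contra hC
    have : A * C ≤ 0 := mul_nonpos_of_nonneg_of_nonpos hA.le (not_lt.1 hC)
    have : 0 < ρ ^ 2 := by positivity
    nlinarith [sq_nonneg B]
  have hAC : 0 < A + C := by positivity
  refine ⟨hAC, fun v => ?_⟩
  rw [div_mul_eq_mul_div, div_le_iff₀ hAC, realForm]
  nlinarith [sq_nonneg (2 * A * v.1 + B * v.2), sq_nonneg (2 * C * v.2 + B * v.1)]

theorem summable_formTheta (hA : 0 < A) (hρ : 0 < ρ) (h : 4 * A * C - B ^ 2 = 4 * ρ ^ 2) {z : ℂ}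
    (hz : 0 < z.re) :
    Summable fun v : ℤ × ℤ => Complex.exp (-((Real.pi / ρ * realForm A B C v : ℝ)) * z) := by
  obtain ⟨hAC, hle⟩ := le_realForm hA hρ h
  have hpi := Real.pi_pos
  set c := Real.pi / ρ * (ρ ^ 2 / (A + C)) * z.re with hc
  have hc0 : 0 < c := by positivity
  refine Summable.of_norm_bounded (summable_exp_neg_mul_int_sq_prod hc0 hc0) fun v => ?_
  rw [Complex.norm_exp, ← Real.exp_add, ← Complex.ofReal_neg, Complex.re_ofReal_mul]
  refine Real.exp_le_exp.2 ?_
  have h1 := mul_le_mul_of_nonneg_left (hle v) (by positivity : 0 ≤ Real.pi / ρ * z.re)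
  rw [hc]
  linarith

/-- The double series to which Poisson summation in the first variable leads. It is invariant under
`z ↦ 1 / z`, by exchange of the variables. -/
def dualTheta (A B ρ : ℝ) (z : ℂ) (v : ℤ × ℤ) : ℂ :=
  Complex.exp (-(Real.pi * ρ / A) * (z * v.2 ^ 2 + z⁻¹ * v.1 ^ 2) +
    Real.pi * Complex.I * (B / A) * v.1 * v.2)

theorem summable_dualTheta (hA : 0 < A) (hρ : 0 < ρ) {z : ℂ} (hz : 0 < z.re) :
    Summable (dualTheta A B ρ z) := by
  have hzi : 0 < (z⁻¹).re := by
    rw [Complex.inv_re]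
    exact div_pos hz (Complex.normSq_pos.2 (by rintro rfl; simp at hz))
  have hpi := Real.pi_pos
  refine Summable.of_norm_bounded (summable_exp_neg_mul_int_sq_prod
    (c := Real.pi * ρ / A * (z⁻¹).re) (d := Real.pi * ρ / A * z.re) (by positivity) (by positivity))
    fun v => ?_
  rw [dualTheta, Complex.norm_exp, ← Real.exp_add]
  refine Real.exp_le_exp.2 (le_of_eq ?_)
  have e1 : (-(Real.pi * ρ / A) * (z * v.2 ^ 2 + z⁻¹ * v.1 ^ 2) : ℂ) =
      ((-(Real.pi * ρ / A * (v.2 : ℝ) ^ 2) : ℝ) : ℂ) * z +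
        ((-(Real.pi * ρ / A * (v.1 : ℝ) ^ 2) : ℝ) : ℂ) * z⁻¹ := by
    push_cast; ring
  have e2 : (Real.pi * Complex.I * (B / A) * v.1 * v.2 : ℂ) =
      ((Real.pi * (B / A) * v.1 * v.2 : ℝ) : ℂ) * Complex.I := by
    push_cast; ring
  rw [e1, e2, Complex.add_re, Complex.add_re, Complex.re_ofReal_mul, Complex.re_ofReal_mul,
    Complex.re_ofReal_mul, Complex.I_re]
  ring

theorem tsum_dualTheta_inv (A B ρ : ℝ) (z : ℂ) :
    ∑' v, dualTheta A B ρ z⁻¹ v = ∑' v, dualTheta A B ρ z v := by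
  rw [← (Equiv.prodComm ℤ ℤ).tsum_eq]
  refine tsum_congr fun v => ?_
  simp only [dualTheta, Equiv.prodComm_apply, Prod.fst_swap, Prod.snd_swap, inv_inv]
  congr 1; ring

/-- Poisson summation in the first variable. -/
theorem formTheta_eq (hA : 0 < A) (hρ : 0 < ρ) (h : 4 * A * C - B ^ 2 = 4 * ρ ^ 2) {z : ℂ}
    (hz : 0 < z.re) :
    formTheta A B C ρ z = 1 / (((A / ρ : ℝ) : ℂ) * z) ^ (1 / 2 : ℂ) * ∑' v, dualTheta A B ρ z v := by
  have hz0 : z ≠ 0 := by rintro rfl; simp at hz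
  have hAC : (A : ℂ) ≠ 0 := by exact_mod_cast hA.ne'
  have hρC : (ρ : ℂ) ≠ 0 := by exact_mod_cast hρ.ne'
  have hpi : (Real.pi : ℂ) ≠ 0 := by exact_mod_cast Real.pi_ne_zero
  have hC : (C : ℂ) = (4 * ρ ^ 2 + B ^ 2) / (4 * A) := by
    field_simp; exact_mod_cast (by linarith : C * 4 * A = 4 * ρ ^ 2 + B ^ 2)
  have hs1 := (Equiv.prodComm ℤ ℤ).summable_iff.2 (summable_formTheta hA hρ h hz)
  have hs2 := (Equiv.prodComm ℤ ℤ).summable_iff.2 (summable_dualTheta (B := B) hA hρ hz)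
  rw [formTheta, ← (Equiv.prodComm ℤ ℤ).tsum_eq, ← (Equiv.prodComm ℤ ℤ).tsum_eq (dualTheta A B ρ z)]
  refine (hs1.tsum_prod' fun y => hs1.prod_factor y).trans ?_
  refine Eq.trans ?_ (congrArg _ (hs2.tsum_prod' fun y => hs2.prod_factor y).symm)
  rw [← tsum_mul_left]
  refine tsum_congr fun y => ?_
  simp only [Function.comp_apply, Equiv.prodComm_apply, Prod.swap_prod_mk]
  have ha : 0 < (((A / ρ : ℝ) : ℂ) * z).re := by rw [Complex.re_ofReal_mul]; positivity
  have hP := Complex.tsum_exp_neg_quadratic ha (-(z * B * y / (2 * ρ)))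
  have e1 : ∀ x : ℤ, Complex.exp (-((Real.pi / ρ * realForm A B C (x, y) : ℝ)) * z) =
      Complex.exp (-(Real.pi / ρ * C * y ^ 2) * z) *
        Complex.exp (-Real.pi * (((A / ρ : ℝ) : ℂ) * z) * x ^ 2 +
          2 * Real.pi * (-(z * B * y / (2 * ρ))) * x) := by
    intro x
    rw [← Complex.exp_add, realForm]
    congr 1
    push_cast
    field_simp
    ring
  have e2 : ∀ k : ℤ, dualTheta A B ρ z (k, y) = Complex.exp (-(Real.pi / ρ * C * y ^ 2) * z) *
      Complex.exp (-Real.pi / (((A / ρ : ℝ) : ℂ) * z) *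
        (k + Complex.I * (-(z * B * y / (2 * ρ)))) ^ 2) := by
    intro k
    rw [← Complex.exp_add, dualTheta]
    congr 1
    rw [hC]
    push_cast
    field_simp
    ring_nf
    simp only [Complex.I_sq]
    ring
  simp_rw [e1, e2]
  rw [tsum_mul_left, tsum_mul_left, hP]
  ring

/-- The theta series of a positive definite binary form is a modular form of weight one. -/
theorem formTheta_inv (hA : 0 < A) (hρ : 0 < ρ) (h : 4 * A * C - B ^ 2 = 4 * ρ ^ 2) {z : ℂ}
    (hz : 0 < z.re) : formTheta A B C ρ z⁻¹ = z * formTheta A B C ρ z := by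
  have hz0 : z ≠ 0 := by rintro rfl; simp at hz
  have hzi : 0 < (z⁻¹).re := by
    rw [Complex.inv_re]; exact div_pos hz (Complex.normSq_pos.2 hz0)
  have hr : 0 < A / ρ := by positivity
  rw [formTheta_eq hA hρ h hz, formTheta_eq hA hρ h hzi, tsum_dualTheta_inv,
    ofReal_mul_cpow hr hz0, ofReal_mul_cpow hr (inv_ne_zero hz0), Complex.inv_cpow _ _ (by
      have := Complex.abs_arg_lt_pi_div_two_iff.2 (Or.inl hz)
      intro h'; rw [h', abs_of_pos Real.pi_pos] at this; linarith [Real.pi_pos])]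
  have hz2 : z ^ (1 / 2 : ℂ) * z ^ (1 / 2 : ℂ) = z := by
    rw [← Complex.cpow_add _ _ hz0]; norm_num
  have hzh : z ^ (1 / 2 : ℂ) ≠ 0 := by simp [Complex.cpow_eq_zero_iff, hz0]
  have hA2 : ((A / ρ : ℝ) : ℂ) ^ (1 / 2 : ℂ) ≠ 0 := by
    rw [Ne, Complex.cpow_eq_zero_iff]
    exact fun h => (by exact_mod_cast hr.ne' : ((A / ρ : ℝ) : ℂ) ≠ 0) h.1
  generalize ∑' v, dualTheta A B ρ z v = Y
  nth_rewrite 2 [← hz2]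
  field_simp

end EpsteinZeta

namespace EpsteinZeta
open Set ComplexConjugate NumberField

/-! ### Imaginary quadratic fields -/

variable {K : Type*} [Field K] [NumberField K]

theorem isTotallyComplex_of_discr_neg (hdeg : Module.finrank ℚ K = 2) (himag : discr K < 0) :
    IsTotallyComplex K := by
  rw [← nrRealPlaces_eq_zero_iff]
  have h1 := InfinitePlace.card_add_two_mul_card_eq_rank K
  have h2 := sign_discr K
  rw [Int.sign_eq_neg_one_of_neg himag] at h2
  have h3 : InfinitePlace.nrComplexPlaces K ≠ 0 := by
    intro h; rw [h] at h2; norm_num at h2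
  omega

/-- The alternating form `x ȳ - x̄ y`, whose square is the discriminant of the pair `x, y`. -/
def altForm (x y : ℂ) : ℂ := x * conj y - conj x * y

theorem altForm_sq (x y : ℂ) :
    altForm x y ^ 2 = -((4 * ‖x‖ ^ 2 * ‖y‖ ^ 2 - (2 * (x * conj y).re) ^ 2 : ℝ) : ℂ) := by
  have hx : ((‖x‖ ^ 2 : ℝ) : ℂ) = x * conj x := by
    rw [Complex.mul_conj, Complex.normSq_eq_norm_sq]
  have hy : ((‖y‖ ^ 2 : ℝ) : ℂ) = y * conj y := by
    rw [Complex.mul_conj, Complex.normSq_eq_norm_sq]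
  have hr : ((2 * (x * conj y).re : ℝ) : ℂ) = x * conj y + conj x * y := by
    have := Complex.add_conj (x * conj y)
    rw [map_mul, Complex.conj_conj] at this
    rw [this]
  have e : ((4 * ‖x‖ ^ 2 * ‖y‖ ^ 2 - (2 * (x * conj y).re) ^ 2 : ℝ) : ℂ) =
      4 * ((‖x‖ ^ 2 : ℝ) : ℂ) * ((‖y‖ ^ 2 : ℝ) : ℂ) - ((2 * (x * conj y).re : ℝ) : ℂ) ^ 2 := by
    push_cast; ring
  rw [e, hx, hy, hr, altForm]
  ring

theorem altForm_eq_det_mul (φ : K →+* ℂ) (b : Module.Basis (Fin 2) ℤ (𝓞 K)) (e : Fin 2 → 𝓞 K) :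
    altForm (φ (e 0)) (φ (e 1)) = (b.det e : ℤ) * altForm (φ (b 0)) (φ (b 1)) := by
  have h : ∀ i, φ (e i) = (b.toMatrix e 0 i : ℤ) * φ (b 0) + (b.toMatrix e 1 i : ℤ) * φ (b 1) := by
    intro i
    have := b.sum_toMatrix_smul_self e i
    rw [Fin.sum_univ_two] at this
    have h2 := congrArg (fun x : 𝓞 K => φ x) this
    simp only [zsmul_eq_mul, map_add, map_mul, map_intCast] at h2
    exact h2.symm
  rw [Module.Basis.det_apply, Matrix.det_fin_two, h 0, h 1]
  simp only [altForm, map_add, map_mul, map_intCast]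
  push_cast
  ring

variable [Algebra.IsQuadraticExtension ℚ K]

variable (K) in
theorem exists_basis_fin_two : Nonempty (Module.Basis (Fin 2) ℤ (𝓞 K)) := by
  have h : Fintype.card (Module.Free.ChooseBasisIndex ℤ (𝓞 K)) = Fintype.card (Fin 2) := by
    rw [← Module.finrank_eq_card_chooseBasisIndex, RingOfIntegers.rank,
      Algebra.IsQuadraticExtension.finrank_eq_two]
    simp
  exact ⟨(RingOfIntegers.basis K).reindex (Fintype.equivOfCardEq h)⟩

variable [IsTotallyComplex K]

variable (K) in
theorem isCMField_of_isQuadraticExtension : IsCMField K := IsCMField.ofCMExtension ℚ K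

/-- The embeddings of an imaginary quadratic field are `φ` and its conjugate. -/
theorem sum_prod_embeddings (φ : K →+* ℂ) (x : K) :
    ∑ σ : K →ₐ[ℚ] ℂ, σ x = φ x + conj (φ x) ∧ ∏ σ : K →ₐ[ℚ] ℂ, σ x = φ x * conj (φ x) := by
  classical
  set σ : K →ₐ[ℚ] ℂ := RingHom.equivRatAlgHom K ℂ φ with hσ
  set τ : K →ₐ[ℚ] ℂ := RingHom.equivRatAlgHom K ℂ (ComplexEmbedding.conjugate φ) with hτ
  have hne : σ ≠ τ := fun h => IsTotallyComplex.complexEmbedding_not_isReal φ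
    ((RingHom.equivRatAlgHom K ℂ).injective h).symm
  have hcard : Fintype.card (K →ₐ[ℚ] ℂ) = 2 := by
    rw [AlgHom.card, Algebra.IsQuadraticExtension.finrank_eq_two]
  have huniv : (Finset.univ : Finset (K →ₐ[ℚ] ℂ)) = {σ, τ} := by
    refine (Finset.eq_univ_of_card _ ?_).symm
    rw [Finset.card_pair hne, hcard]
  rw [huniv, Finset.sum_pair hne, Finset.prod_pair hne]
  exact ⟨rfl, rfl⟩

theorem ratCast_trace (φ : K →+* ℂ) (x : K) :
    ((Algebra.trace ℚ K x : ℚ) : ℂ) = φ x + conj (φ x) := by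
  rw [← (sum_prod_embeddings φ x).1]
  exact trace_eq_sum_embeddings (K := ℚ) (L := K) ℂ (x := x)

theorem ratCast_norm (φ : K →+* ℂ) (x : K) :
    ((Algebra.norm ℚ x : ℚ) : ℂ) = φ x * conj (φ x) := by
  rw [← (sum_prod_embeddings φ x).2]
  exact Algebra.norm_eq_prod_embeddings ℚ ℂ x

theorem intCast_trace (φ : K →+* ℂ) (x : 𝓞 K) :
    ((Algebra.trace ℤ (𝓞 K) x : ℤ) : ℂ) = φ x + conj (φ x) := by
  rw [← ratCast_trace, ← Algebra.coe_trace_int]; norm_cast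

theorem intCast_norm (φ : K →+* ℂ) (x : 𝓞 K) :
    ((Algebra.norm ℤ x : ℤ) : ℂ) = φ x * conj (φ x) := by
  rw [← ratCast_norm, ← Algebra.coe_norm_int]; norm_cast

theorem absNorm_span_eq (φ : K →+* ℂ) (x : 𝓞 K) :
    (Ideal.absNorm (Ideal.span {x}) : ℝ) = ‖φ x‖ ^ 2 := by
  have h := intCast_norm φ x
  rw [Complex.mul_conj, Complex.normSq_eq_norm_sq] at h
  have h' : ((Algebra.norm ℤ x : ℤ) : ℝ) = ‖φ x‖ ^ 2 := by exact_mod_cast h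
  rw [Ideal.absNorm_span_singleton, Nat.cast_natAbs, Int.cast_abs, h', abs_of_nonneg (by positivity)]

theorem altForm_basis_sq (φ : K →+* ℂ) (b : Module.Basis (Fin 2) ℤ (𝓞 K)) :
    altForm (φ (b 0)) (φ (b 1)) ^ 2 = discr K := by
  rw [← discr_eq_discr K b, Algebra.discr_def, Matrix.det_fin_two]
  simp only [Algebra.traceMatrix_apply, Algebra.traceForm_apply]
  push_cast
  rw [intCast_trace φ, intCast_trace φ, intCast_trace φ, intCast_trace φ]
  simp only [map_mul, altForm]
  ring

/-- The discriminant of a basis of an ideal. -/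
theorem altForm_idealBasis_sq (φ : K →+* ℂ) (I : Ideal (𝓞 K)) (e : Module.Basis (Fin 2) ℤ I) :
    altForm (φ (e 0 : 𝓞 K)) (φ (e 1 : 𝓞 K)) ^ 2 = (Ideal.absNorm I : ℂ) ^ 2 * discr K := by
  obtain ⟨b⟩ := exists_basis_fin_two K
  have h := altForm_eq_det_mul φ b (Subtype.val ∘ e)
  have h2 := Ideal.natAbs_det_basis_change b I e
  have h3 : ((b.det (Subtype.val ∘ e) : ℤ) : ℂ) ^ 2 = (Ideal.absNorm I : ℂ) ^ 2 := by
    rw [← h2, ← Int.cast_natCast, ← Int.cast_pow, ← Int.cast_pow, Int.natAbs_sq]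
  simp only [Function.comp_apply] at h
  rw [h, mul_pow, altForm_basis_sq, h3]

/-- All units are roots of unity, since their only absolute value is `1`. -/
theorem unit_mem_torsion (u : (𝓞 K)ˣ) : u ∈ Units.torsion K := by
  rw [Units.mem_torsion]
  intro w
  have h := absNorm_span_eq w.embedding (u : 𝓞 K)
  rw [Ideal.span_singleton_eq_top.2 u.isUnit, Ideal.absNorm_top] at h
  have h1 : ‖w.embedding (u : 𝓞 K)‖ = 1 := by
    rw [← sq_eq_sq₀ (norm_nonneg _) zero_le_one, ← h]; simp
  rw [← InfinitePlace.norm_embedding_eq]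
  exact h1

variable (K) in
theorem finite_units_card : Finite (𝓞 K)ˣ ∧ Nat.card (𝓞 K)ˣ = Units.torsionOrder K := by
  have h : Units.torsion K = ⊤ := eq_top_iff.2 fun u _ => unit_mem_torsion u
  have e : Units.torsion K ≃ (𝓞 K)ˣ := (Equiv.setCongr (by rw [h]; rfl)).trans (Equiv.Set.univ _)
  exact ⟨Finite.of_equiv _ e, (Nat.card_congr e).symm⟩

end EpsteinZeta

namespace EpsteinZeta
open Set ComplexConjugate NumberField

/-! ### Ideals of a class and elements of an ideal -/

section

variable {K : Type*} [Field K] [NumberField K]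

theorem exists_generator {𝔟 : (Ideal (𝓞 K))⁰}
    (𝔫 : {𝔫 : (Ideal (𝓞 K))⁰ // ClassGroup.mk0 𝔫 = (ClassGroup.mk0 𝔟)⁻¹}) :
    ∃ x : 𝓞 K, x ≠ 0 ∧ (𝔫.1 : Ideal (𝓞 K)) * 𝔟 = Ideal.span {x} :=
  ClassGroup.mk0_eq_mk0_inv_iff.1 𝔫.2

/-- A generator of the principal ideal `𝔫 𝔟`. -/
def generator {𝔟 : (Ideal (𝓞 K))⁰}
    (𝔫 : {𝔫 : (Ideal (𝓞 K))⁰ // ClassGroup.mk0 𝔫 = (ClassGroup.mk0 𝔟)⁻¹}) : 𝓞 K :=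
  (exists_generator 𝔫).choose

theorem generator_ne_zero {𝔟 : (Ideal (𝓞 K))⁰}
    (𝔫 : {𝔫 : (Ideal (𝓞 K))⁰ // ClassGroup.mk0 𝔫 = (ClassGroup.mk0 𝔟)⁻¹}) : generator 𝔫 ≠ 0 :=
  (exists_generator 𝔫).choose_spec.1

theorem mul_eq_span_generator {𝔟 : (Ideal (𝓞 K))⁰}
    (𝔫 : {𝔫 : (Ideal (𝓞 K))⁰ // ClassGroup.mk0 𝔫 = (ClassGroup.mk0 𝔟)⁻¹}) :
    (𝔫.1 : Ideal (𝓞 K)) * 𝔟 = Ideal.span {generator 𝔫} :=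
  (exists_generator 𝔫).choose_spec.2

theorem span_generator_mul_unit {𝔟 : (Ideal (𝓞 K))⁰}
    (𝔫 : {𝔫 : (Ideal (𝓞 K))⁰ // ClassGroup.mk0 𝔫 = (ClassGroup.mk0 𝔟)⁻¹}) (u : (𝓞 K)ˣ) :
    Ideal.span {generator 𝔫 * (u : 𝓞 K)} = (𝔫.1 : Ideal (𝓞 K)) * 𝔟 := by
  rw [mul_eq_span_generator, Ideal.span_singleton_mul_right_unit u.isUnit]

/-- The nonzero elements of `𝔟` correspond to the ideals `𝔫` in the class inverse to that of `𝔟`,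
up to units: `x` corresponds to `𝔫` if `𝔫 𝔟 = (x)`. -/
def classEquiv (𝔟 : (Ideal (𝓞 K))⁰) :
    {𝔫 : (Ideal (𝓞 K))⁰ // ClassGroup.mk0 𝔫 = (ClassGroup.mk0 𝔟)⁻¹} × (𝓞 K)ˣ ≃
      {x : (𝔟 : Ideal (𝓞 K)) // x ≠ 0} :=
  Equiv.ofBijective (fun p => ⟨⟨generator p.1 * (p.2 : 𝓞 K), by
      rw [← Ideal.span_singleton_le_iff_mem, span_generator_mul_unit]
      exact Ideal.mul_le_right (I := (p.1.1 : Ideal (𝓞 K))) (J := (𝔟 : Ideal (𝓞 K)))⟩, fun h => by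
      have h := congrArg Subtype.val h
      exact mul_ne_zero (generator_ne_zero p.1) p.2.ne_zero h⟩) <| by
    have h𝔟 : (𝔟 : Ideal (𝓞 K)) ≠ 0 := nonZeroDivisors.ne_zero 𝔟.2
    constructor
    · rintro ⟨𝔪, u⟩ ⟨𝔫, v⟩ h
      have h : generator 𝔪 * (u : 𝓞 K) = generator 𝔫 * (v : 𝓞 K) :=
        congrArg Subtype.val (Subtype.mk.inj h)
      have h1 : (𝔪.1 : Ideal (𝓞 K)) * 𝔟 = 𝔫.1 * 𝔟 := by
        rw [← span_generator_mul_unit 𝔪 u, ← span_generator_mul_unit 𝔫 v, h]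
      have h2 : 𝔪 = 𝔫 := Subtype.ext (Subtype.ext (mul_right_cancel₀ h𝔟 h1))
      subst h2
      exact Prod.ext rfl (Units.ext (mul_left_cancel₀ (generator_ne_zero 𝔪) h))
    · rintro ⟨⟨x, hx⟩, hx0⟩
      have hx0 : x ≠ 0 := fun h => hx0 (Subtype.ext h)
      obtain ⟨𝔠, hc⟩ := Ideal.dvd_span_singleton.2 hx
      have hc0 : 𝔠 ≠ 0 := by
        rintro rfl
        rw [mul_zero] at hc
        exact hx0 (Ideal.span_singleton_eq_bot.1 hc)
      have hcl : ClassGroup.mk0 ⟨𝔠, mem_nonZeroDivisors_of_ne_zero hc0⟩ = (ClassGroup.mk0 𝔟)⁻¹ :=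
        ClassGroup.mk0_eq_mk0_inv_iff.2 ⟨x, hx0, by rw [hc, mul_comm]⟩
      set 𝔫 : {𝔫 : (Ideal (𝓞 K))⁰ // ClassGroup.mk0 𝔫 = (ClassGroup.mk0 𝔟)⁻¹} := ⟨_, hcl⟩
      have hspan : Ideal.span {generator 𝔫} = Ideal.span {x} := by
        rw [← mul_eq_span_generator, hc, mul_comm]
      obtain ⟨u, hu⟩ := Ideal.span_singleton_eq_span_singleton.1 hspan
      exact ⟨(𝔫, u), Subtype.ext (Subtype.ext hu)⟩

theorem absNorm_classEquiv (𝔟 : (Ideal (𝓞 K))⁰)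
    (p : {𝔫 : (Ideal (𝓞 K))⁰ // ClassGroup.mk0 𝔫 = (ClassGroup.mk0 𝔟)⁻¹} × (𝓞 K)ˣ) :
    Ideal.absNorm (Ideal.span {((classEquiv 𝔟 p).1 : 𝓞 K)}) / Ideal.absNorm (𝔟 : Ideal (𝓞 K)) =
      Ideal.absNorm (p.1.1 : Ideal (𝓞 K)) := by
  have h : Ideal.span {((classEquiv 𝔟 p).1 : 𝓞 K)} = (p.1.1 : Ideal (𝓞 K)) * 𝔟 :=
    span_generator_mul_unit p.1 p.2
  rw [h, map_mul, Nat.mul_div_cancel _ (absNorm_pos 𝔟)]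

variable (K) in
/-- Half of the square root of the absolute value of the discriminant. -/
def halfSqrtDiscr : ℝ := Real.sqrt |(discr K : ℝ)| / 2

variable (K) in
theorem halfSqrtDiscr_pos : 0 < halfSqrtDiscr K := by
  have : (discr K : ℝ) ≠ 0 := by exact_mod_cast discr_ne_zero K
  rw [halfSqrtDiscr]; positivity

end

theorem hasSum_prod_of_finite {ι κ : Type*} [Finite κ] {f : ι → ℂ} {S : ℂ} (h : HasSum f S) :
    HasSum (fun p : ι × κ => f p.1) (Nat.card κ * S) := by
  have := Fintype.ofFinite κ
  have h1 : HasSum (fun _ : κ => (1 : ℂ)) (Nat.card κ : ℂ) := by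
    simpa using hasSum_fintype (fun _ : κ => (1 : ℂ))
  have h2 : Summable fun p : ι × κ => f p.1 * 1 :=
    summable_mul_of_summable_norm (f := f) (g := fun _ : κ => (1 : ℂ)) h.summable.norm
      h1.summable.norm
  have h3 : HasSum (fun p : ι × κ => f p.1 * 1) (S * Nat.card κ) :=
    HasSum.mul (f := f) (g := fun _ : κ => (1 : ℂ)) h h1 h2
  simp only [mul_one] at h3
  rwa [mul_comm]

variable {K : Type*} [Field K] [NumberField K] [Algebra.IsQuadraticExtension ℚ K]
  [IsTotallyComplex K]

/-- A sum over the ideals of a class, as a sum over the nonzero vectors of a lattice. -/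
theorem hasSum_lattice {f : ℕ → ℂ} (𝔟 : (Ideal (𝓞 K))⁰)
    (e : Module.Basis (Fin 2) ℤ (𝔟 : Ideal (𝓞 K))) {S : ℂ}
    (h : HasSum (fun 𝔫 : {𝔫 : (Ideal (𝓞 K))⁰ // ClassGroup.mk0 𝔫 = (ClassGroup.mk0 𝔟)⁻¹} =>
      f (Ideal.absNorm (𝔫.1 : Ideal (𝓞 K)))) S) :
    HasSum (fun v : {v : ℤ × ℤ // v ≠ 0} => f (Ideal.absNorm (Ideal.span
      {(v.1.1 : 𝓞 K) * (e 0 : 𝓞 K) + (v.1.2 : 𝓞 K) * (e 1 : 𝓞 K)}) /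
        Ideal.absNorm (𝔟 : Ideal (𝓞 K)))) (Units.torsionOrder K * S) := by
  obtain ⟨hfin, hcard⟩ := finite_units_card K
  have h1 := hasSum_prod_of_finite (κ := (𝓞 K)ˣ) h
  rw [hcard] at h1
  set E : ℤ × ℤ ≃ (𝔟 : Ideal (𝓞 K)) :=
    (finTwoArrowEquiv ℤ).symm.trans e.equivFun.symm.toEquiv with hE
  have hEv : ∀ v, ((E v : (𝔟 : Ideal (𝓞 K))) : 𝓞 K) =
      (v.1 : 𝓞 K) * (e 0 : 𝓞 K) + (v.2 : 𝓞 K) * (e 1 : 𝓞 K) := by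
    intro v
    simp [hE, Module.Basis.equivFun_symm_apply, Fin.sum_univ_two]
  have hE0 : ∀ v, v ≠ 0 ↔ E v ≠ 0 := by
    intro v
    have h0 : E 0 = 0 := Subtype.ext (by rw [hEv]; simp)
    rw [Ne, Ne, ← h0, E.injective.eq_iff]
  set E' : {v : ℤ × ℤ // v ≠ 0} ≃ {x : (𝔟 : Ideal (𝓞 K)) // x ≠ 0} := E.subtypeEquiv hE0
  rw [← (E'.trans (classEquiv 𝔟).symm).symm.hasSum_iff]
  have hfun : (fun v : {v : ℤ × ℤ // v ≠ 0} => f (Ideal.absNorm (Ideal.span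
      {(v.1.1 : 𝓞 K) * (e 0 : 𝓞 K) + (v.1.2 : 𝓞 K) * (e 1 : 𝓞 K)}) /
        Ideal.absNorm (𝔟 : Ideal (𝓞 K)))) ∘ (E'.trans (classEquiv 𝔟).symm).symm =
      fun p => f (Ideal.absNorm (p.1.1 : Ideal (𝓞 K))) := by
    funext p
    obtain ⟨v, rfl⟩ := (E'.trans (classEquiv 𝔟).symm).surjective p
    rw [Function.comp_apply, Equiv.symm_apply_apply, ← hEv]
    congr 1
    rw [← absNorm_classEquiv]
    simp [E']
  rw [hfun]
  exact h1

/-! ### Functional equation of the theta series of a class -/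

/-- The coefficients of the quadratic form `N(x α + y β) / N(𝔟)` of an ideal `𝔟 = ℤ α + ℤ β`. -/
theorem exists_realForm (𝔟 : (Ideal (𝓞 K))⁰)
    (e : Module.Basis (Fin 2) ℤ (𝔟 : Ideal (𝓞 K))) :
    ∃ A B C : ℝ, 0 < A ∧ 4 * A * C - B ^ 2 = 4 * halfSqrtDiscr K ^ 2 ∧
      ∀ v : ℤ × ℤ, realForm A B C v = (Ideal.absNorm (Ideal.span
        {(v.1 : 𝓞 K) * (e 0 : 𝓞 K) + (v.2 : 𝓞 K) * (e 1 : 𝓞 K)}) : ℝ) /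
          (Ideal.absNorm (𝔟 : Ideal (𝓞 K)) : ℝ) := by
  let φ : K →+* ℂ := Classical.arbitrary _
  set x : ℂ := φ (e 0 : 𝓞 K) with hx
  set y : ℂ := φ (e 1 : 𝓞 K) with hy
  set N : ℝ := (Ideal.absNorm (𝔟 : Ideal (𝓞 K)) : ℝ) with hN
  have hN0 : 0 < N := Nat.cast_pos.2 (absNorm_pos 𝔟)
  have hx0 : x ≠ 0 := by
    rw [hx, Ne, map_eq_zero]
    have := e.ne_zero 0
    simpa using this
  have hdisc : 4 * ‖x‖ ^ 2 * ‖y‖ ^ 2 - (2 * (x * conj y).re) ^ 2 = N ^ 2 * |(discr K : ℝ)| := by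
    have h1 := altForm_idealBasis_sq φ _ e
    rw [altForm_sq] at h1
    have h2 : 4 * ‖x‖ ^ 2 * ‖y‖ ^ 2 - (2 * (x * conj y).re) ^ 2 = -(N ^ 2 * (discr K : ℝ)) := by
      have h3 : ((4 * ‖x‖ ^ 2 * ‖y‖ ^ 2 - (2 * (x * conj y).re) ^ 2 : ℝ) : ℂ) =
          ((-(N ^ 2 * (discr K : ℝ)) : ℝ) : ℂ) := by
        rw [← neg_eq_iff_eq_neg.2 h1.symm, hN]; push_cast; ring
      exact_mod_cast h3
    have h4 : (0 : ℝ) ≤ 4 * ‖x‖ ^ 2 * ‖y‖ ^ 2 - (2 * (x * conj y).re) ^ 2 := by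
      have h5 := Complex.abs_re_le_norm (x * conj y)
      rw [norm_mul, Complex.norm_conj] at h5
      have h6 := abs_le.1 h5
      nlinarith [norm_nonneg x, norm_nonneg y]
    have h7 : (discr K : ℝ) ≤ 0 := by
      by_contra hcon
      have : 0 < N ^ 2 * (discr K : ℝ) := mul_pos (by positivity) (not_le.1 hcon)
      linarith
    rw [abs_of_nonpos h7, h2]; ring
  refine ⟨‖x‖ ^ 2 / N, 2 * (x * conj y).re / N, ‖y‖ ^ 2 / N, by positivity, ?_, fun v => ?_⟩
  · have e1 : 4 * (‖x‖ ^ 2 / N) * (‖y‖ ^ 2 / N) - (2 * (x * conj y).re / N) ^ 2 =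
        (4 * ‖x‖ ^ 2 * ‖y‖ ^ 2 - (2 * (x * conj y).re) ^ 2) / N ^ 2 := by
      field_simp
    rw [e1, hdisc, halfSqrtDiscr, div_pow, Real.sq_sqrt (abs_nonneg _)]
    field_simp
    norm_num
  · rw [absNorm_span_eq φ]
    have hz : φ ((v.1 : 𝓞 K) * (e 0 : 𝓞 K) + (v.2 : 𝓞 K) * (e 1 : 𝓞 K) : 𝓞 K) =
        (v.1 : ℝ) * x + (v.2 : ℝ) * y := by
      simp [hx, hy]
    rw [hz, ← Complex.normSq_eq_norm_sq, ← Complex.normSq_eq_norm_sq, ← Complex.normSq_eq_norm_sq,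
      Complex.normSq_add, Complex.normSq_mul, Complex.normSq_mul, Complex.normSq_ofReal,
      Complex.normSq_ofReal, realForm]
    have : ((v.1 : ℝ) * x * conj ((v.2 : ℝ) * y) : ℂ) = ((v.1 * v.2 : ℝ) : ℂ) * (x * conj y) := by
      rw [map_mul, Complex.conj_ofReal]; push_cast; ring
    rw [this, Complex.re_ofReal_mul]
    field_simp
    ring

end EpsteinZeta

namespace EpsteinZeta
open Set NumberField

/-! ### The functional equation for class group characters -/

section

variable {K : Type*} [Field K] [NumberField K]

variable (K) in
theorem summable_exp_absNorm {x : ℝ} (hx : 0 < x) :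
    Summable fun 𝔫 : (Ideal (𝓞 K))⁰ => Real.exp (-x * Ideal.absNorm (𝔫 : Ideal (𝓞 K))) := by
  rw [summable_ideal_iff (g := fun m => Real.exp (-x * m)) fun m => (Real.exp_pos _).le]
  have h := (summable_ideal_iff (K := K) (g := fun m => (m : ℝ) ^ (-2 : ℝ)) fun m => by positivity).1
    (summable_absNorm_rpow K one_lt_two)
  have hs : Subexponential fun m => (Nat.card (IdealOfNorm K m) : ℂ) :=
    subexponential_of_summable (s := 2) (by simp) (by simpa using h)
  simpa using hs x hx

theorem absNorm_dvd_absNorm_span (𝔟 : (Ideal (𝓞 K))⁰)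
    (e : Module.Basis (Fin 2) ℤ (𝔟 : Ideal (𝓞 K))) (x y : ℤ) :
    Ideal.absNorm (𝔟 : Ideal (𝓞 K)) ∣ Ideal.absNorm (Ideal.span
      {(x : 𝓞 K) * (e 0 : 𝓞 K) + (y : 𝓞 K) * (e 1 : 𝓞 K)}) := by
  refine Ideal.absNorm_dvd_absNorm_of_le ((Ideal.span_singleton_le_iff_mem _).2 ?_)
  exact add_mem (Ideal.mul_mem_left _ _ (e 0).2) (Ideal.mul_mem_left _ _ (e 1).2)

/-- A sum over ideals weighted by a class group character, by classes. -/
theorem tsum_idealChar_mul (χ : ClassGroup (𝓞 K) →* ℂˣ) {f : ℕ → ℂ}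
    (hf : Summable fun 𝔫 : (Ideal (𝓞 K))⁰ => ‖f (Ideal.absNorm (𝔫 : Ideal (𝓞 K)))‖) :
    HasSum (fun 𝔫 : (Ideal (𝓞 K))⁰ => idealChar χ 𝔫 * f (Ideal.absNorm (𝔫 : Ideal (𝓞 K))))
      (∑ C : ClassGroup (𝓞 K), (χ C : ℂ) * ∑' 𝔫 : {𝔫 : (Ideal (𝓞 K))⁰ // ClassGroup.mk0 𝔫 = C},
        f (Ideal.absNorm (𝔫.1 : Ideal (𝓞 K)))) := by
  have hs : Summable fun 𝔫 : (Ideal (𝓞 K))⁰ =>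
      idealChar χ 𝔫 * f (Ideal.absNorm (𝔫 : Ideal (𝓞 K))) :=
    Summable.of_norm (by simpa only [norm_mul, norm_idealChar, one_mul] using hf)
  have h := hs.hasSum
  have h' := (Equiv.sigmaFiberEquiv fun 𝔫 : (Ideal (𝓞 K))⁰ => ClassGroup.mk0 𝔫).hasSum_iff.2 h
  have h1 : ∀ C : ClassGroup (𝓞 K), HasSum
      (fun 𝔫 : {𝔫 : (Ideal (𝓞 K))⁰ // ClassGroup.mk0 𝔫 = C} =>
        idealChar χ 𝔫.1 * f (Ideal.absNorm (𝔫.1 : Ideal (𝓞 K))))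
      ((χ C : ℂ) * ∑' 𝔫 : {𝔫 : (Ideal (𝓞 K))⁰ // ClassGroup.mk0 𝔫 = C},
        f (Ideal.absNorm (𝔫.1 : Ideal (𝓞 K)))) := by
    intro C
    have h2 : (fun 𝔫 : {𝔫 : (Ideal (𝓞 K))⁰ // ClassGroup.mk0 𝔫 = C} =>
        idealChar χ 𝔫.1 * f (Ideal.absNorm (𝔫.1 : Ideal (𝓞 K)))) =
        fun 𝔫 => (χ C : ℂ) * f (Ideal.absNorm (𝔫.1 : Ideal (𝓞 K))) :=
      funext fun 𝔫 => by rw [idealChar, 𝔫.2]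
    rw [h2]
    exact ((hf.subtype _).of_norm.hasSum).mul_left _
  have h3 := h'.sigma h1
  rw [h3.unique (hasSum_fintype _)] at h
  exact h

end

variable {K : Type*} [Field K] [NumberField K] [Algebra.IsQuadraticExtension ℚ K]
  [IsTotallyComplex K]

variable (K) in
/-- For each ideal class there is a binary quadratic form whose theta series is, up to the constant
term, the sum of `e^{-π z N(𝔫) / ρ}` over the ideals `𝔫` of the class, taken once for each unit. -/
theorem exists_formTheta_eq (C : ClassGroup (𝓞 K)) :
    ∃ a b c : ℝ, 0 < a ∧ 4 * a * c - b ^ 2 = 4 * halfSqrtDiscr K ^ 2 ∧ ∀ z : ℂ, 0 < z.re →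
      formTheta a b c (halfSqrtDiscr K) z = 1 + Units.torsionOrder K *
        ∑' 𝔫 : {𝔫 : (Ideal (𝓞 K))⁰ // ClassGroup.mk0 𝔫 = C},
          Complex.exp (-((Real.pi / halfSqrtDiscr K : ℝ) *
            (Ideal.absNorm (𝔫.1 : Ideal (𝓞 K)) : ℂ)) * z) := by
  obtain ⟨𝔟, h𝔟⟩ := ClassGroup.mk0_surjective C⁻¹
  have hC : C = (ClassGroup.mk0 𝔟)⁻¹ := by rw [h𝔟, inv_inv]
  subst hC
  obtain ⟨b⟩ := exists_basis_fin_two K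
  set e := Ideal.selfBasis b (𝔟 : Ideal (𝓞 K)) (nonZeroDivisors.ne_zero 𝔟.2)
  obtain ⟨A, B, C, hA, hdisc, hform⟩ := exists_realForm 𝔟 e
  refine ⟨A, B, C, hA, hdisc, fun z hz => ?_⟩
  have hρ := halfSqrtDiscr_pos K
  have hpi := Real.pi_pos
  set f : ℕ → ℂ := fun m => Complex.exp (-((Real.pi / halfSqrtDiscr K : ℝ) * (m : ℂ)) * z) with hf
  have hfs : Summable fun 𝔫 : (Ideal (𝓞 K))⁰ => f (Ideal.absNorm (𝔫 : Ideal (𝓞 K))) := by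
    refine Summable.of_norm ((summable_exp_absNorm K
      (x := Real.pi / halfSqrtDiscr K * z.re) (by positivity)).congr fun 𝔫 => ?_)
    rw [hf, Complex.norm_exp]
    congr 1
    rw [← Complex.ofReal_natCast, ← Complex.ofReal_mul, ← Complex.ofReal_neg, Complex.re_ofReal_mul]
    ring
  have hlat := hasSum_lattice 𝔟 e (hfs.subtype _).hasSum
  have hterm : ∀ v : ℤ × ℤ, Complex.exp (-((Real.pi / halfSqrtDiscr K * realForm A B C v : ℝ)) * z) =
      f (Ideal.absNorm (Ideal.span {(v.1 : 𝓞 K) * (e 0 : 𝓞 K) + (v.2 : 𝓞 K) * (e 1 : 𝓞 K)}) /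
        Ideal.absNorm (𝔟 : Ideal (𝓞 K))) := by
    intro v
    rw [hform, hf, ← Nat.cast_div (absNorm_dvd_absNorm_span 𝔟 e v.1 v.2)
      (Nat.cast_ne_zero.2 (absNorm_pos 𝔟).ne')]
    push_cast
    rfl
  have h0 : HasSum (fun v : ({0} : Set (ℤ × ℤ)) =>
      Complex.exp (-((Real.pi / halfSqrtDiscr K * realForm A B C v : ℝ)) * z)) 1 := by
    have := hasSum_unique fun v : ({0} : Set (ℤ × ℤ)) =>
      Complex.exp (-((Real.pi / halfSqrtDiscr K * realForm A B C v : ℝ)) * z)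
    simpa [realForm] using this
  have h1 : HasSum (fun v : (({0} : Set (ℤ × ℤ))ᶜ : Set (ℤ × ℤ)) =>
      Complex.exp (-((Real.pi / halfSqrtDiscr K * realForm A B C v : ℝ)) * z))
      (Units.torsionOrder K * ∑' 𝔫 : {𝔫 : (Ideal (𝓞 K))⁰ //
        ClassGroup.mk0 𝔫 = (ClassGroup.mk0 𝔟)⁻¹}, f (Ideal.absNorm (𝔫.1 : Ideal (𝓞 K)))) := by
    simp_rw [hterm]
    exact hlat
  exact (HasSum.add_compl (f := fun v : ℤ × ℤ =>
    Complex.exp (-((Real.pi / halfSqrtDiscr K * realForm A B C v : ℝ)) * z)) h0 h1).tsum_eq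

/-- The Dirichlet series of a class group character has a functional equation. -/
theorem selfDual_idealChar (χ : ClassGroup (𝓞 K) →* ℂˣ) :
    SelfDual (idealCoeff (idealChar χ)) (Real.pi / halfSqrtDiscr K)
      (1 / Units.torsionOrder K * ∑ C : ClassGroup (𝓞 K), (χ C : ℂ)) where
  zero := idealCoeff_zero _
  pos := div_pos Real.pi_pos (halfSqrtDiscr_pos K)
  summable_sq σ hσ := summable_idealCoeff_sq (fun 𝔫 => (norm_idealChar χ 𝔫).le) hσ
  feq z hz := by
    have hz0 : z ≠ 0 := by rintro rfl; simp at hz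
    have hzi : 0 < (z⁻¹).re := by
      rw [Complex.inv_re]; exact div_pos hz (Complex.normSq_pos.2 hz0)
    have hρ := halfSqrtDiscr_pos K
    have hpi := Real.pi_pos
    have hw : (Units.torsionOrder K : ℂ) ≠ 0 := by
      exact_mod_cast (NumberField.Units.torsionOrder_pos K).ne'
    choose a b c ha hdisc hθ using exists_formTheta_eq K
    have key : ∀ z : ℂ, 0 < z.re → 1 / Units.torsionOrder K * ∑ C : ClassGroup (𝓞 K), (χ C : ℂ) +
        expSeries (idealCoeff (idealChar χ)) (Real.pi / halfSqrtDiscr K) z =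
        1 / Units.torsionOrder K * ∑ C : ClassGroup (𝓞 K), (χ C : ℂ) *
          formTheta (a C) (b C) (c C) (halfSqrtDiscr K) z := by
      intro z hz
      have hfs : Summable fun 𝔫 : (Ideal (𝓞 K))⁰ => ‖Complex.exp (-((Real.pi / halfSqrtDiscr K : ℝ) *
          (Ideal.absNorm (𝔫 : Ideal (𝓞 K)) : ℂ)) * z)‖ := by
        refine (summable_exp_absNorm K
          (x := Real.pi / halfSqrtDiscr K * z.re) (by positivity)).congr fun 𝔫 => ?_
        rw [Complex.norm_exp]
        congr 1
        rw [← Complex.ofReal_natCast, ← Complex.ofReal_mul, ← Complex.ofReal_neg,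
          Complex.re_ofReal_mul]
        ring
      have h1 := (hasSum_idealCoeff (g := fun m => Complex.exp (-((Real.pi / halfSqrtDiscr K : ℝ) *
          (m : ℂ)) * z)) (tsum_idealChar_mul χ (f := fun m =>
            Complex.exp (-((Real.pi / halfSqrtDiscr K : ℝ) * (m : ℂ)) * z)) hfs)).tsum_eq
      rw [expSeries, h1, Finset.mul_sum, Finset.mul_sum, ← Finset.sum_add_distrib]
      refine Finset.sum_congr rfl fun C _ => ?_
      rw [hθ C z hz, mul_add, mul_add, ← mul_assoc, mul_left_comm, ← mul_assoc (1 / _ : ℂ),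
        one_div_mul_cancel hw]
      ring
    rw [key z hz, key z⁻¹ hzi, Finset.mul_sum, Finset.mul_sum, Finset.mul_sum]
    refine Finset.sum_congr rfl fun C _ => ?_
    rw [formTheta_inv (ha C) hρ (hdisc C) hz]
    ring

theorem IsContinuation.continuation {ι : Type*} {u : ι → ℂ → ℂ} {F : ℂ → ℂ}
    (h : IsContinuation u F) : IsContinuation u (continuation u) := by
  have h' : ∃ F : ℂ → ℂ, IsContinuation u F := ⟨F, h⟩
  rw [EpsteinZeta.continuation, dif_pos h']
  exact h'.choose_spec

/-- The continuation of `L(s, χ)`, which exists since its theta series is modular. -/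
theorem isContinuation_heckeL (χ : ClassGroup (𝓞 K) →* ℂˣ) :
    IsContinuation (heckeTerm χ) (heckeL χ) := by
  obtain ⟨H, -, hF⟩ := (selfDual_idealChar χ).exists_continuation
  refine IsContinuation.continuation (F := fun s => H s / (s - 1)) ⟨hF.1, fun s hs => ?_⟩
  have h1 := (summable_norm_heckeTerm χ hs).of_norm.hasSum
  rwa [(hF.2 s hs).unique (hasSum_idealCoeff (u := idealChar χ) (g := fun m => (m : ℂ) ^ (-s)) h1)]

/-- The truncated Euler products are Dirichlet series convergent for `Re s > 0`, with coefficients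
close to those of `L(s, χ)` in the square mean. -/
theorem convergesInMean_truncL (χ : ClassGroup (𝓞 K) →* ℂˣ) :
    ConvergesInMean 2 ((1 / 2 : ℝ) : EReal) ⊤ (truncL χ) (heckeL χ) := by
  have hL := isContinuation_heckeL χ
  refine (selfDual_idealChar χ).convergesInMean (b := fun n => idealCoeff (truncChar χ n))
    ⟨hL.1, fun s hs => ?_⟩ (absConvergent_idealCoeff_truncChar χ)
    (fun α hα => tendsto_tsum_idealCoeff_sub χ hα) fun n s hs => truncL_eq_dirichletSeries χ n hs
  exact hasSum_idealCoeff (u := idealChar χ) (g := fun m => (m : ℂ) ^ (-s)) (hL.2 s hs)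

end EpsteinZeta

namespace EpsteinZeta
open Set ComplexConjugate NumberField

/-! ### Conjugate characters -/

section

variable {K : Type*} [Field K]

theorem conjChar_apply (χ : ClassGroup (𝓞 K) →* ℂˣ) (C : ClassGroup (𝓞 K)) :
    (conjChar χ C : ℂ) = conj (χ C : ℂ) := rfl

variable [NumberField K]

theorem conjChar_apply_eq_inv (χ : ClassGroup (𝓞 K) →* ℂˣ) (C : ClassGroup (𝓞 K)) :
    (conjChar χ C : ℂ) = χ C⁻¹ := by
  rw [conjChar_apply, map_inv, Units.val_inv_eq_inv_val, Complex.inv_eq_conj (norm_classCharacter χ C)]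

variable [IsCMField K]

variable (K) in
/-- Complex conjugation on the ring of integers of a CM field, as a `ℤ`-algebra automorphism. -/
def conjInt : 𝓞 K ≃ₐ[ℤ] 𝓞 K := (IsCMField.ringOfIntegersComplexConj K).restrictScalars ℤ

theorem embedding_conjInt (φ : K →+* ℂ) (x : 𝓞 K) : φ (conjInt K x : 𝓞 K) = conj (φ x) :=
  IsCMField.complexEmbedding_complexConj K φ x

theorem conjInt_conjInt (x : 𝓞 K) : conjInt K (conjInt K x) = x :=
  RingOfIntegers.ext (IsCMField.complexConj_apply_apply K x)

theorem absNorm_map_conjInt (I : Ideal (𝓞 K)) :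
    Ideal.absNorm (I.map (conjInt K)) = Ideal.absNorm I := by
  have h := Ideal.relNorm_map_algEquiv (R := ℤ) (conjInt K) I
  rw [Ideal.relNorm_int, Ideal.relNorm_int, Ideal.span_singleton_eq_span_singleton,
    Int.associated_iff_natAbs] at h
  simpa using h

/-- The conjugate of a nonzero ideal. -/
def conjIdeal (𝔫 : (Ideal (𝓞 K))⁰) : (Ideal (𝓞 K))⁰ :=
  ⟨(𝔫 : Ideal (𝓞 K)).map (conjInt K), mem_nonZeroDivisors_of_ne_zero fun h => by
    have h1 := absNorm_pos 𝔫
    rw [← absNorm_map_conjInt, h, map_zero] at h1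
    exact h1.false⟩

theorem conjIdeal_conjIdeal (𝔫 : (Ideal (𝓞 K))⁰) : conjIdeal (conjIdeal 𝔫) = 𝔫 := by
  refine Subtype.ext ?_
  change ((𝔫 : Ideal (𝓞 K)).map (conjInt K)).map (conjInt K) = 𝔫
  have h : ((conjInt K : 𝓞 K →+* 𝓞 K).comp (conjInt K : 𝓞 K →+* 𝓞 K)) = RingHom.id _ :=
    RingHom.ext conjInt_conjInt
  have h2 := Ideal.map_map (I := (𝔫 : Ideal (𝓞 K))) (conjInt K : 𝓞 K →+* 𝓞 K)
    (conjInt K : 𝓞 K →+* 𝓞 K)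
  rw [h, Ideal.map_id] at h2
  exact h2

end

section

variable {K : Type*} [Field K] [NumberField K] [Algebra.IsQuadraticExtension ℚ K]
  [IsTotallyComplex K]

/-- Complex conjugation is the nontrivial automorphism, so the norm of `x` is `x` times its
conjugate. -/
theorem algebraMap_norm_eq_mul_conjInt [IsCMField K] (x : 𝓞 K) :
    algebraMap ℤ (𝓞 K) (Algebra.norm ℤ x) = x * conjInt K x := by
  let φ : K →+* ℂ := Classical.arbitrary _
  refine RingOfIntegers.ext (φ.injective ?_)
  have h := intCast_norm φ x
  rw [← embedding_conjInt] at h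
  simpa using h

/-- The product of an ideal and its conjugate is generated by the norm. This holds since the norms
of the elements of the ideal generate the ideal of `ℤ` generated by its norm. -/
theorem mul_conjIdeal [IsCMField K] (𝔫 : (Ideal (𝓞 K))⁰) :
    (𝔫 : Ideal (𝓞 K)) * (conjIdeal 𝔫 : Ideal (𝓞 K)) =
      Ideal.span {(Ideal.absNorm (𝔫 : Ideal (𝓞 K)) : 𝓞 K)} := by
  set N := Ideal.absNorm (𝔫 : Ideal (𝓞 K)) with hN
  set I : Ideal (𝓞 K) := (𝔫 : Ideal (𝓞 K)) * (conjIdeal 𝔫 : Ideal (𝓞 K)) with hI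
  -- One inclusion comes from the elements `x * conj x` of `I`, equality from comparing norms.
  have hmem : (N : 𝓞 K) ∈ I := by
    have h1 : Ideal.relNorm ℤ (𝔫 : Ideal (𝓞 K)) ≤ I.comap (algebraMap ℤ (𝓞 K)) := by
      rw [Ideal.relNorm_apply, Ideal.span_le]
      rintro _ ⟨x, hx, rfl⟩
      rw [Algebra.intNorm_eq_norm, SetLike.mem_coe, Ideal.mem_comap, algebraMap_norm_eq_mul_conjInt]
      exact Ideal.mul_mem_mul hx (Ideal.mem_map_of_mem _ hx)
    rw [Ideal.relNorm_int, Ideal.span_singleton_le_iff_mem, Ideal.mem_comap] at h1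
    simpa using h1
  obtain ⟨J, hJ⟩ := Ideal.dvd_span_singleton.2 hmem
  have hIN : Ideal.absNorm I = N ^ 2 := by
    rw [hI, map_mul, sq]
    congr 1
    exact absNorm_map_conjInt _
  have hN0 : 0 < N := absNorm_pos 𝔫
  have hJ1 : Ideal.absNorm J = 1 := by
    have h := congrArg Ideal.absNorm hJ
    rw [map_mul, hIN] at h
    have h2 : Ideal.absNorm (Ideal.span {(N : 𝓞 K)}) = N ^ 2 := by
      let φ : K →+* ℂ := Classical.arbitrary _
      have h3 := absNorm_span_eq φ (N : 𝓞 K)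
      have h4 : ‖φ ((N : 𝓞 K) : K)‖ = N := by simp
      rw [h4] at h3
      exact_mod_cast h3
    rw [h2] at h
    exact (Nat.eq_of_mul_eq_mul_left (pow_pos hN0 2) (by rw [mul_one]; exact h)).symm
  rw [Ideal.absNorm_eq_one_iff] at hJ1
  rw [hJ, hJ1, Ideal.mul_top]

theorem mk0_conjIdeal [IsCMField K] (𝔫 : (Ideal (𝓞 K))⁰) :
    ClassGroup.mk0 (conjIdeal 𝔫) = (ClassGroup.mk0 𝔫)⁻¹ :=
  ClassGroup.mk0_eq_mk0_inv_iff.2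
    ⟨_, Nat.cast_ne_zero.2 (absNorm_pos 𝔫).ne', by rw [mul_comm, mul_conjIdeal]⟩

/-- Since conjugation inverts ideal classes, conjugate characters have the same `L`-function. -/
theorem heckeL_conjChar (χ : ClassGroup (𝓞 K) →* ℂˣ) :
    EqOn (heckeL (conjChar χ)) (heckeL χ) {1}ᶜ := by
  have := isCMField_of_isQuadraticExtension K
  refine (isContinuation_heckeL (conjChar χ)).eqOn
    ⟨(isContinuation_heckeL χ).1, fun s hs => ?_⟩
  have h := (isContinuation_heckeL χ).2 s hs
  rw [← (Function.Involutive.toPerm _ (conjIdeal_conjIdeal (K := K))).hasSum_iff] at h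
  refine (congrArg (fun g => HasSum g _) (funext fun 𝔫 => ?_)).mp h
  change heckeTerm χ (conjIdeal 𝔫) s = _
  rw [heckeTerm, heckeTerm, mk0_conjIdeal, conjChar_apply_eq_inv]
  congr 3
  exact absNorm_map_conjInt _

end

/-! ### Orthogonality of characters -/

/-- Orthogonality relation for the characters of a finite abelian group. -/
theorem sum_character_apply {G : Type*} [CommGroup G] [Finite G] [Fintype (G →* ℂˣ)]
    [DecidableEq G] (x : G) :
    ∑ χ : G →* ℂˣ, (χ x : ℂ) = if x = 1 then (Nat.card G : ℂ) else 0 := by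
  split_ifs with h
  · subst h
    simp [← CommGroup.card_monoidHom_of_hasEnoughRootsOfUnity G ℂ, Nat.card_eq_fintype_card]
  · obtain ⟨ψ, hψ⟩ := CommGroup.exists_apply_ne_one_of_hasEnoughRootsOfUnity G ℂ h
    have h1 : ∑ χ : G →* ℂˣ, (χ x : ℂ) = (ψ x : ℂ) * ∑ χ : G →* ℂˣ, (χ x : ℂ) := by
      rw [Finset.mul_sum, ← Equiv.sum_comp (Equiv.mulLeft ψ)]
      simp
    have h2 : ((ψ x : ℂ) - 1) * ∑ χ : G →* ℂˣ, (χ x : ℂ) = 0 := by rw [sub_mul, ← h1]; ring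
    exact (mul_eq_zero.1 h2).resolve_left (sub_ne_zero.2 fun h3 => hψ (Units.ext h3))

end EpsteinZeta

namespace EpsteinZeta
open Set ComplexConjugate NumberField

/-! ### The ideal of a binary quadratic form -/

variable {K : Type*} [Field K] [NumberField K]

theorem isIntegral_root (Q : BinaryForm) {δ : K} (hδ : δ ^ 2 = (Q.discr : K)) :
    IsIntegral ℤ ((-(Q.b : K) + δ) / 2) := by
  refine ⟨Polynomial.X ^ 2 + Polynomial.C Q.b * Polynomial.X + Polynomial.C (Q.a * Q.c),
    by monicity!, ?_⟩
  simp only [Polynomial.eval₂_add, Polynomial.eval₂_mul, Polynomial.eval₂_pow,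
    Polynomial.eval₂_X, Polynomial.eval₂_C]
  rw [eq_intCast, eq_intCast]
  rw [BinaryForm.discr] at hδ
  push_cast at hδ ⊢
  linear_combination hδ / 4

theorem conj_eq_neg_of_sq_eq {z : ℂ} {d : ℤ} (hd : d < 0) (hz : z ^ 2 = d) : conj z = -z := by
  have h1 := congrArg Complex.re hz
  have h2 := congrArg Complex.im hz
  simp only [sq, Complex.mul_re, Complex.mul_im, Complex.intCast_re, Complex.intCast_im] at h1 h2
  have h3 : z.re = 0 := by
    have h4 : z.re * z.im = 0 := by linarith
    rcases mul_eq_zero.1 h4 with h5 | h5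
    · exact h5
    · have : (d : ℝ) < 0 := by exact_mod_cast hd
      rw [h5] at h1
      nlinarith [mul_self_nonneg z.re]
  apply Complex.ext <;> simp [h3]

variable [Algebra.IsQuadraticExtension ℚ K] [IsTotallyComplex K]

variable (K) in
/-- The discriminant is a square in the field: for an integral basis `x, y`, it is the square of
`x * conj y - conj x * y = x * Tr y - y * Tr x`. -/
theorem exists_sq_eq_discr : ∃ δ : K, δ ^ 2 = (discr K : K) := by
  obtain ⟨b⟩ := exists_basis_fin_two K
  let φ : K →+* ℂ := Classical.arbitrary _
  refine ⟨(b 0 : K) * (Algebra.trace ℤ (𝓞 K) (b 1) : K) -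
    (b 1 : K) * (Algebra.trace ℤ (𝓞 K) (b 0) : K), φ.injective ?_⟩
  have h : φ ((b 0 : K) * (Algebra.trace ℤ (𝓞 K) (b 1) : K) -
      (b 1 : K) * (Algebra.trace ℤ (𝓞 K) (b 0) : K)) = altForm (φ (b 0)) (φ (b 1)) := by
    rw [map_sub, map_mul, map_mul, map_intCast, map_intCast, intCast_trace φ, intCast_trace φ,
      altForm]
    ring
  rw [map_pow, h, altForm_basis_sq, map_intCast]

/-- If `1, ω` has the discriminant of the field, then it is an integral basis. -/
theorem exists_eq_add_mul (φ : K →+* ℂ) {ω : 𝓞 K} (h : altForm 1 (φ ω) ^ 2 = discr K) :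
    LinearIndependent ℤ ![1, ω] ∧ ∀ x : 𝓞 K, ∃ m n : ℤ, x = m + n * ω := by
  obtain ⟨b⟩ := exists_basis_fin_two K
  have h1 := altForm_eq_det_mul φ b ![1, ω]
  simp only [Matrix.cons_val_zero, Matrix.cons_val_one, map_one] at h1
  rw [h1, mul_pow, altForm_basis_sq] at h
  have h2 : (b.det ![1, ω]) ^ 2 = 1 := by
    have : ((b.det ![1, ω] : ℤ) : ℂ) ^ 2 * (discr K : ℂ) = 1 * (discr K : ℂ) := by rw [h, one_mul]
    have := mul_right_cancel₀ (by exact_mod_cast discr_ne_zero K) this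
    exact_mod_cast this
  obtain ⟨hli, hsp⟩ := (b.is_basis_iff_det).2 (IsUnit.of_mul_eq_one _ (by rw [← sq, h2]))
  refine ⟨hli, fun x => ?_⟩
  have hx : x ∈ Submodule.span ℤ (range ![1, ω]) := hsp ▸ Submodule.mem_top
  rw [Matrix.range_cons, Matrix.range_cons, Matrix.range_empty, union_empty, singleton_union,
    Submodule.mem_span_pair] at hx
  obtain ⟨m, n, h⟩ := hx
  exact ⟨m, n, by rw [← h]; simp⟩

/-- The ideal of a form has a `ℤ`-basis for which its norm form is the given form. -/
theorem exists_idealBasis (Q : BinaryForm) (hQ : Q.PosDef) (hD : Q.discr = discr K)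
    {δ : K} (hδ : δ ^ 2 = (Q.discr : K)) (hneg : discr K < 0) :
    ∃ e : Module.Basis (Fin 2) ℤ (Q.ideal hQ δ : Ideal (𝓞 K)), ∀ m n : ℤ,
      ((Ideal.absNorm (Ideal.span {(m : 𝓞 K) * (e 0 : 𝓞 K) + (n : 𝓞 K) * (e 1 : 𝓞 K)}) /
        Ideal.absNorm (Q.ideal hQ δ : Ideal (𝓞 K)) : ℕ) : ℤ) = Q.eval m n := by
  let φ : K →+* ℂ := Classical.arbitrary _
  let ω : 𝓞 K := ⟨(-(Q.b : K) + δ) / 2, isIntegral_root Q hδ⟩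
  have hωK : (ω : K) = (-(Q.b : K) + δ) / 2 := rfl
  have ha := hQ.a_pos
  have hφδ : φ δ ^ 2 = (Q.discr : ℤ) := by rw [← map_pow, hδ, map_intCast]
  have hconj : conj (φ δ) = -φ δ := conj_eq_neg_of_sq_eq (by rw [hD]; exact hneg) hφδ
  have hω : φ ω = (-(Q.b : ℂ) + φ δ) / 2 := by rw [hωK, map_div₀, map_ofNat]; simp
  have hωc : conj (φ ω) = (-(Q.b : ℂ) - φ δ) / 2 := by
    rw [hω, map_div₀, map_ofNat, map_add, hconj]; simp [sub_eq_add_neg]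
  have halt : altForm 1 (φ ω) ^ 2 = discr K := by
    rw [altForm, hωc, hω, map_one, ← hD, ← hφδ]; ring
  obtain ⟨hli, hspan⟩ := exists_eq_add_mul φ halt
  have hωsq : ω * ω = -(Q.a * Q.c : ℤ) - (Q.b : ℤ) * ω := by
    refine RingOfIntegers.ext (φ.injective ?_)
    have h1 := hφδ
    rw [BinaryForm.discr] at h1
    simp only [map_mul, map_sub, map_neg, map_intCast, hω]
    push_cast at h1 ⊢
    linear_combination h1 / 4
  have hgen : (Q.ideal hQ δ : Ideal (𝓞 K)) = Ideal.span {(Q.a : 𝓞 K), ω} := by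
    change Ideal.span _ = _
    congr 1
    ext x
    rw [mem_insert_iff, mem_singleton_iff, mem_ofPred_eq, ← hωK]
    refine or_congr ?_ ?_
    · rw [RingOfIntegers.ext_iff]; simp
    · rw [RingOfIntegers.ext_iff]
  have haI : (Q.a : 𝓞 K) ∈ (Q.ideal hQ δ : Ideal (𝓞 K)) := by
    rw [hgen]; exact Ideal.subset_span (by simp)
  have hωI : -ω ∈ (Q.ideal hQ δ : Ideal (𝓞 K)) := by
    rw [hgen, neg_mem_iff]; exact Ideal.subset_span (by simp)
  have hmem : ∀ x ∈ (Q.ideal hQ δ : Ideal (𝓞 K)), ∃ m n : ℤ, x = m * Q.a + n * (-ω) := by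
    intro x hx
    rw [hgen, Ideal.mem_span_pair] at hx
    obtain ⟨p, q, rfl⟩ := hx
    obtain ⟨m, n, rfl⟩ := hspan p
    obtain ⟨k, l, rfl⟩ := hspan q
    refine ⟨m - l * Q.c, -(n * Q.a + k - l * Q.b), ?_⟩
    push_cast at hωsq ⊢
    linear_combination l * hωsq
  -- With `-ω` in place of `ω`, the norm form of the basis has middle coefficient `b` instead of
  -- `-b`.
  let v : Fin 2 → (Q.ideal hQ δ : Ideal (𝓞 K)) := ![⟨_, haI⟩, ⟨_, hωI⟩]
  have hv : LinearIndependent ℤ v := by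
    rw [LinearIndependent.pair_iff] at hli ⊢
    intro s t h
    have h1 := congrArg Subtype.val h
    simp only [Submodule.coe_add] at h1
    have h2 : (s * Q.a) • (1 : 𝓞 K) + (-t) • ω = 0 := by
      rw [zsmul_eq_mul, zsmul_eq_mul]
      push_cast
      have h3 : (s : 𝓞 K) * Q.a + t * (-ω) = 0 := by
        simpa using h1
      linear_combination h3
    obtain ⟨h4, h5⟩ := hli _ _ h2
    exact ⟨(mul_eq_zero.1 h4).resolve_right ha.ne', neg_eq_zero.1 h5⟩
  have hsp : ⊤ ≤ Submodule.span ℤ (range v) := by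
    rintro ⟨x, hx⟩ -
    obtain ⟨m, n, rfl⟩ := hmem x hx
    rw [Matrix.range_cons, Matrix.range_cons, Matrix.range_empty, union_empty, singleton_union,
      Submodule.mem_span_pair]
    exact ⟨m, n, Subtype.ext (by simp)⟩
  set e := Module.Basis.mk hv hsp with he
  have he0 : (e 0 : 𝓞 K) = Q.a := by rw [he, Module.Basis.mk_apply]; rfl
  have he1 : (e 1 : 𝓞 K) = -ω := by rw [he, Module.Basis.mk_apply]; rfl
  have hnorm : (Ideal.absNorm (Q.ideal hQ δ : Ideal (𝓞 K)) : ℤ) = Q.a := by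
    have h1 := altForm_idealBasis_sq φ _ e
    have h2 : altForm (φ (e 0 : 𝓞 K)) (φ (e 1 : 𝓞 K)) ^ 2 = (Q.a : ℂ) ^ 2 * discr K := by
      rw [he0, he1, ← halt]
      simp only [altForm, map_neg, map_intCast, map_one]
      ring
    have h3 := mul_right_cancel₀ (by exact_mod_cast discr_ne_zero K) (h1.symm.trans h2)
    have h4 : (Ideal.absNorm (Q.ideal hQ δ : Ideal (𝓞 K)) : ℤ) ^ 2 = Q.a ^ 2 := by
      exact_mod_cast h3
    exact (sq_eq_sq₀ (by positivity) ha.le).1 h4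
  refine ⟨e, fun m n => ?_⟩
  rw [Int.natCast_div, hnorm]
  refine Int.ediv_eq_of_eq_mul_right ha.ne' ?_
  have h1 := absNorm_span_eq φ ((m : 𝓞 K) * (e 0 : 𝓞 K) + (n : 𝓞 K) * (e 1 : 𝓞 K))
  set N := Ideal.absNorm (Ideal.span {(m : 𝓞 K) * (e 0 : 𝓞 K) + (n : 𝓞 K) * (e 1 : 𝓞 K)})
  rw [he0, he1] at h1
  have h2 : (N : ℂ) = φ ((m : 𝓞 K) * (Q.a : 𝓞 K) + (n : 𝓞 K) * (-ω) : 𝓞 K) *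
      conj (φ ((m : 𝓞 K) * (Q.a : 𝓞 K) + (n : 𝓞 K) * (-ω) : 𝓞 K)) := by
    rw [Complex.mul_conj, Complex.normSq_eq_norm_sq, ← h1]; simp
  simp only [map_add, map_mul, map_neg, map_intCast] at h2
  rw [hωc, hω] at h2
  have h3 : (N : ℂ) = ((Q.a * Q.eval m n : ℤ) : ℂ) := by
    have h4 := hφδ
    rw [BinaryForm.discr] at h4
    rw [h2, BinaryForm.eval]
    push_cast at h4 ⊢
    linear_combination -n ^ 2 / 4 * h4
  exact_mod_cast h3

end EpsteinZeta

namespace EpsteinZeta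
open Set ComplexConjugate NumberField

/-! ### The Epstein zeta function as a combination of `L`-functions -/

section

variable {K : Type*} [Field K] [NumberField K] [Algebra.IsQuadraticExtension ℚ K]
  [IsTotallyComplex K]

/-- The character sum `∑ χ(C) L(s, χ)` isolates the ideals of the class `C⁻¹`. -/
theorem sum_character_mul_heckeL [Fintype (ClassGroup (𝓞 K) →* ℂˣ)] (C : ClassGroup (𝓞 K)) {s : ℂ}
    (hs : 1 < s.re) :
    ∑ χ : ClassGroup (𝓞 K) →* ℂˣ, (χ C : ℂ) * heckeL χ s =
      classNumber K * ∑' 𝔫 : {𝔫 : (Ideal (𝓞 K))⁰ // ClassGroup.mk0 𝔫 = C⁻¹},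
        (Ideal.absNorm (𝔫.1 : Ideal (𝓞 K)) : ℂ) ^ (-s) := by
  classical
  have hf : Summable fun 𝔫 : (Ideal (𝓞 K))⁰ =>
      ‖(Ideal.absNorm (𝔫 : Ideal (𝓞 K)) : ℂ) ^ (-s)‖ := by
    simpa [heckeTerm] using summable_norm_heckeTerm (1 : ClassGroup (𝓞 K) →* ℂˣ) hs
  set S : ClassGroup (𝓞 K) → ℂ := fun C =>
    ∑' 𝔫 : {𝔫 : (Ideal (𝓞 K))⁰ // ClassGroup.mk0 𝔫 = C},
      (Ideal.absNorm (𝔫.1 : Ideal (𝓞 K)) : ℂ) ^ (-s) with hS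
  have h1 : ∀ χ : ClassGroup (𝓞 K) →* ℂˣ, heckeL χ s = ∑ B, (χ B : ℂ) * S B := fun χ =>
    ((isContinuation_heckeL χ).2 s hs).unique (tsum_idealChar_mul χ (f := fun m => (m : ℂ) ^ (-s)) hf)
  simp_rw [h1, Finset.mul_sum]
  rw [Finset.sum_comm]
  have h2 : ∀ B, ∑ χ : ClassGroup (𝓞 K) →* ℂˣ, (χ C : ℂ) * ((χ B : ℂ) * S B) =
      if B = C⁻¹ then (classNumber K : ℂ) * S B else 0 := by
    intro B
    have h3 := sum_character_apply (C * B)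
    simp only [map_mul, Units.val_mul] at h3
    simp_rw [← mul_assoc]
    rw [← Finset.sum_mul, h3, ite_mul, zero_mul, mul_eq_one_iff_eq_inv', Nat.card_eq_fintype_card]
    rfl
  simp_rw [h2]
  rw [Finset.sum_ite_eq' Finset.univ C⁻¹, if_pos (Finset.mem_univ _)]

/-- The Epstein zeta function is `w` times the partial zeta function of the class inverse to that of
the ideal of the form, and orthogonality of characters expresses the latter by the functions `L(s,
χ)`. -/
theorem isContinuation_epsteinTerm [Fintype (ClassGroup (𝓞 K) →* ℂˣ)] (Q : BinaryForm)
    (hQ : Q.PosDef) (hD : Q.discr = discr K) {δ : K} (hδ : δ ^ 2 = (Q.discr : K))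
    (hneg : discr K < 0) :
    IsContinuation Q.epsteinTerm fun s => (Units.torsionOrder K : ℂ) / classNumber K *
      ∑ χ : ClassGroup (𝓞 K) →* ℂˣ, (χ (ClassGroup.mk0 (Q.ideal hQ δ)) : ℂ) * heckeL χ s := by
  constructor
  · refine DifferentiableOn.const_mul (DifferentiableOn.fun_sum fun χ _ => ?_) _
    exact (isContinuation_heckeL χ).1.const_mul _
  · intro s hs
    obtain ⟨e, he⟩ := exists_idealBasis Q hQ hD hδ hneg
    have hf : Summable fun 𝔫 : (Ideal (𝓞 K))⁰ => (Ideal.absNorm (𝔫 : Ideal (𝓞 K)) : ℂ) ^ (-s) := by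
      simpa [heckeTerm] using (summable_norm_heckeTerm (1 : ClassGroup (𝓞 K) →* ℂˣ) hs).of_norm
    have h := hasSum_lattice (f := fun m => (m : ℂ) ^ (-s)) (Q.ideal hQ δ) e (hf.subtype _).hasSum
    have hterm : (fun v : {v : ℤ × ℤ // v ≠ 0} => Q.epsteinTerm v s) =
        fun v => ((Ideal.absNorm (Ideal.span
          {(v.1.1 : 𝓞 K) * (e 0 : 𝓞 K) + (v.1.2 : 𝓞 K) * (e 1 : 𝓞 K)}) /
            Ideal.absNorm (Q.ideal hQ δ : Ideal (𝓞 K)) : ℕ) : ℂ) ^ (-s) := by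
      funext v
      rw [BinaryForm.epsteinTerm, ← he, Int.cast_natCast]
    have hcl : (classNumber K : ℂ) ≠ 0 := by exact_mod_cast classNumber_ne_zero K
    dsimp only
    rw [hterm, sum_character_mul_heckeL _ hs, div_mul_eq_mul_div, mul_left_comm,
      mul_div_cancel_left₀ _ hcl]
    exact h

theorem isContinuation_epsteinE (Q : BinaryForm) (hQ : Q.PosDef) (hD : Q.discr = discr K)
    (hneg : discr K < 0) : IsContinuation Q.epsteinTerm Q.epsteinE := by
  have := Fintype.ofFinite (ClassGroup (𝓞 K) →* ℂˣ)
  obtain ⟨δ, hδ⟩ := exists_sq_eq_discr K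
  exact (isContinuation_epsteinTerm Q hQ hD (by rw [hD, hδ]) hneg).continuation

/-- Grouping conjugate characters, which have the same `L`-function. -/
theorem sum_character_eq_sum_coeff [Fintype (ClassGroup (𝓞 K) →* ℂˣ)] (𝔞 : (Ideal (𝓞 K))⁰) {J : ℕ}
    {χ : Fin J → (ClassGroup (𝓞 K) →* ℂˣ)} (hχ : IsRepresentatives χ) {s : ℂ} (hs : s ≠ 1) :
    (Units.torsionOrder K : ℂ) / classNumber K *
      ∑ ψ : ClassGroup (𝓞 K) →* ℂˣ, (ψ (ClassGroup.mk0 𝔞) : ℂ) * heckeL ψ s =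
        ∑ j, coeff 𝔞 (χ j) * heckeL (χ j) s := by
  classical
  choose r hr using hχ
  simp only at hr
  have hr' : ∀ ψ j, r ψ = j ↔ ψ = χ j ∨ ψ = conjChar (χ j) := fun ψ j =>
    ⟨fun h => h ▸ (hr ψ).1, fun h => ((hr ψ).2 j h).symm⟩
  rw [← Finset.sum_fiberwise Finset.univ r, Finset.mul_sum]
  refine Finset.sum_congr rfl fun j _ => ?_
  have hfil : Finset.univ.filter (fun ψ => r ψ = j) = {χ j, conjChar (χ j)} := by
    ext ψ
    simp [hr']
  rw [hfil, coeff]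
  split_ifs with h
  · rw [h, Finset.pair_eq_singleton, Finset.sum_singleton]
    ring
  · rw [Finset.sum_pair (Ne.symm h), heckeL_conjChar (χ j) hs, conjChar_apply, ← add_mul,
      Complex.add_conj]
    push_cast
    ring

end

/-! ### Linear combinations of functions converging in the mean -/

/-- The values at the point `1` do not matter, since the mean is taken over `t ≥ 1`. -/
theorem ConvergesInMean.congr {r : ℝ} {α β : EReal} {fn : ℕ → ℂ → ℂ} {f g : ℂ → ℂ}
    (h : ConvergesInMean r α β fn f) (hfg : EqOn f g {1}ᶜ) : ConvergesInMean r α β fn g := by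
  intro α₁ β₁ h1 h2 h3
  convert h α₁ β₁ h1 h2 h3 using 5 with n T
  refine setLIntegral_congr_fun measurableSet_Icc fun t ht => ?_
  refine lintegral_congr fun σ => ?_
  rw [hfg]
  intro h4
  have h5 := congrArg Complex.im h4
  simp at h5
  linarith [ht.1]

theorem measurable_lintegral_enorm_rpow {d : ℂ → ℂ} (hd : Measurable d) (a b : ℝ) :
    Measurable fun t : ℝ => ∫⁻ σ in Icc a b, ‖d ((σ : ℂ) + (t : ℂ) * Complex.I)‖ₑ ^ (2 : ℝ) := by
  refine Measurable.lintegral_prod_right (f := fun t σ : ℝ =>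
    ‖d ((σ : ℂ) + (t : ℂ) * Complex.I)‖ₑ ^ (2 : ℝ)) ?_
  refine ((hd.comp ?_).enorm).pow_const _
  fun_prop

theorem ConvergesInMean.add {α β : EReal} {fn gn : ℕ → ℂ → ℂ} {f g : ℂ → ℂ}
    (hf : ConvergesInMean 2 α β fn f) (hg : ConvergesInMean 2 α β gn g)
    (hfm : ∀ n, Measurable fun s => f s - fn n s) :
    ConvergesInMean 2 α β (fun n s => fn n s + gn n s) fun s => f s + g s := by
  intro α₁ β₁ h1 h2 h3
  refine ENNReal.tendsto_nhds_zero.2 fun ε hε => ?_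
  have hε' : 0 < ε / 2 / 2 := ENNReal.half_pos (ENNReal.half_pos hε.ne').ne'
  filter_upwards [(tendsto_order.1 (hf α₁ β₁ h1 h2 h3)).2 _ hε',
    (tendsto_order.1 (hg α₁ β₁ h1 h2 h3)).2 _ hε'] with n hn1 hn2
  refine limsup_le_of_le (h := ?_)
  filter_upwards [eventually_lt_of_limsup_lt hn1, eventually_lt_of_limsup_lt hn2] with T hT1 hT2
  have hsum := mul_le_mul_right (add_le_add hT1.le hT2.le) 2
  rw [ENNReal.add_halves, two_mul (ε / 2), ENNReal.add_halves] at hsum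
  refine le_trans ?_ hsum
  rw [← mul_add, mul_left_comm, ← lintegral_add_left (measurable_lintegral_enorm_rpow (hfm n) _ _),
    ← lintegral_const_mul' 2 _ (by simp)]
  refine mul_le_mul_right (lintegral_mono fun t => ?_) _
  have hm : Measurable fun σ : ℝ => ‖f ((σ : ℂ) + (t : ℂ) * Complex.I) -
      fn n ((σ : ℂ) + (t : ℂ) * Complex.I)‖ₑ ^ (2 : ℝ) :=
    (((hfm n).comp (g := fun s => f s - fn n s) (f := fun σ : ℝ => (σ : ℂ) + (t : ℂ) * Complex.I)
      (by fun_prop)).enorm).pow_const _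
  dsimp only
  rw [← lintegral_add_left (hm), ← lintegral_const_mul' 2 _ (by simp)]
  refine lintegral_mono fun σ => ?_
  rw [add_sub_add_comm]
  exact enorm_sq_add_le _ _

theorem ConvergesInMean.const_mul {α β : EReal} {fn : ℕ → ℂ → ℂ} {f : ℂ → ℂ} (a : ℂ)
    (hf : ConvergesInMean 2 α β fn f) :
    ConvergesInMean 2 α β (fun n s => a * fn n s) fun s => a * f s := by
  intro α₁ β₁ h1 h2 h3
  have ha : ‖a‖ₑ ^ (2 : ℝ) ≠ ⊤ := by simp
  have h := ENNReal.Tendsto.const_mul (a := ‖a‖ₑ ^ (2 : ℝ)) (hf α₁ β₁ h1 h2 h3) (Or.inr ha)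
  rw [mul_zero] at h
  refine h.congr fun n => ?_
  rw [← ENNReal.limsup_const_mul_of_ne_top ha]
  congr 1
  funext T
  rw [mul_left_comm, ← lintegral_const_mul' _ _ ha]
  congr 2
  funext t
  rw [← lintegral_const_mul' _ _ ha]
  congr 1
  funext σ
  rw [← mul_sub, enorm_mul, ENNReal.mul_rpow_of_nonneg _ _ (by norm_num)]

theorem ConvergesInMean.sum {ι : Type*} {α β : EReal} {fn : ι → ℕ → ℂ → ℂ} {f : ι → ℂ → ℂ}
    (a : ι → ℂ) (h : ∀ j, ConvergesInMean 2 α β (fn j) (f j)) (hf : ∀ j, Measurable (f j))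
    (hfn : ∀ j n, Measurable (fn j n)) (s : Finset ι) :
    ConvergesInMean 2 α β (fun n z => ∑ j ∈ s, a j * fn j n z) fun z => ∑ j ∈ s, a j * f j z := by
  classical
  induction s using Finset.induction_on with
  | empty =>
    intro α₁ β₁ _ _ _
    simp
  | insert j s hj ih =>
    simp_rw [Finset.sum_insert hj]
    refine ConvergesInMean.add ((h j).const_mul (a j)) ih fun n => ?_
    exact ((hf j).const_mul _).sub ((hfn j n).const_mul _)

/-! ### Convergence in the mean towards the Epstein zeta function -/

section

variable {K : Type*} [Field K] [NumberField K]

theorem measurable_truncL (χ : ClassGroup (𝓞 K) →* ℂˣ) (n : ℕ) : Measurable (truncL χ n) := by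
  refine Finset.measurable_prod _ fun v _ => ?_
  refine (measurable_const.sub ?_).inv
  refine Continuous.measurable ?_
  refine continuous_const.mul (Continuous.const_cpow continuous_neg (Or.inl ?_))
  exact Nat.cast_ne_zero.2 (absNorm_pos _).ne'

variable [Algebra.IsQuadraticExtension ℚ K] [IsTotallyComplex K]

/-- By linearity from the convergence of the truncated Euler products. -/
theorem convergesInMean_truncE (Q : BinaryForm) (hQ : Q.PosDef) (hD : Q.discr = discr K)
    (hneg : discr K < 0) {δ : K} (hδ : δ ^ 2 = (Q.discr : K)) {𝔞 : (Ideal (𝓞 K))⁰}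
    (h𝔞 : ClassGroup.mk0 𝔞 = ClassGroup.mk0 (Q.ideal hQ δ)) {J : ℕ}
    {χ : Fin J → (ClassGroup (𝓞 K) →* ℂˣ)} (hχ : IsRepresentatives χ) :
    ConvergesInMean 2 ((1 / 2 : ℝ) : EReal) ⊤ (truncE 𝔞 χ) Q.epsteinE := by
  have := Fintype.ofFinite (ClassGroup (𝓞 K) →* ℂˣ)
  have hE : EqOn (fun s => ∑ j, coeff 𝔞 (χ j) * heckeL (χ j) s) Q.epsteinE {1}ᶜ := by
    intro s hs
    rw [← (isContinuation_epsteinTerm Q hQ hD hδ hneg).eqOn (isContinuation_epsteinE Q hQ hD hneg) hs]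
    simp only
    rw [← h𝔞, sum_character_eq_sum_coeff 𝔞 hχ hs]
  refine ConvergesInMean.congr ?_ hE
  exact ConvergesInMean.sum _ (fun j => convergesInMean_truncL (χ j))
    (fun j => measurable_of_continuousOn_compl_singleton 1
      (isContinuation_heckeL (χ j)).1.continuousOn)
    (fun j n => measurable_truncL (χ j) n) Finset.univ

end

end EpsteinZeta

end

theorem proposition2p3 (K : Type*) [Field K] [NumberField K]
    (hdeg : Module.finrank ℚ K = 2) (himag : NumberField.discr K < 0) :
    (∀ χ : ClassGroup (𝓞 K) →* ℂˣ,
      EpsteinZeta.IsContinuation (EpsteinZeta.heckeTerm χ) (EpsteinZeta.heckeL χ) ∧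
      EpsteinZeta.ConvergesInMean 2 ((1 / 2 : ℝ) : EReal) ⊤
        (EpsteinZeta.truncL χ) (EpsteinZeta.heckeL χ)) ∧
    (∀ (Q : EpsteinZeta.BinaryForm) (hQ : Q.PosDef), Q.discr = NumberField.discr K →
      EpsteinZeta.IsContinuation Q.epsteinTerm Q.epsteinE ∧
      ∀ δ : K, δ ^ 2 = (Q.discr : K) →
      ∀ 𝔞 : (Ideal (𝓞 K))⁰, ClassGroup.mk0 𝔞 = ClassGroup.mk0 (Q.ideal hQ δ) →
      ∀ (J : ℕ) (χ : Fin J → (ClassGroup (𝓞 K) →* ℂˣ)), EpsteinZeta.IsRepresentatives χ →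
        EpsteinZeta.ConvergesInMean 2 ((1 / 2 : ℝ) : EReal) ⊤
          (EpsteinZeta.truncE 𝔞 χ) Q.epsteinE) := by
  have : Algebra.IsQuadraticExtension ℚ K := ⟨hdeg⟩
  have := EpsteinZeta.isTotallyComplex_of_discr_neg hdeg himag
  exact ⟨fun χ => ⟨EpsteinZeta.isContinuation_heckeL χ, EpsteinZeta.convergesInMean_truncL χ⟩,
    fun Q hQ hD => ⟨EpsteinZeta.isContinuation_epsteinE Q hQ hD himag,
      fun δ hδ 𝔞 h𝔞 J χ hχ => EpsteinZeta.convergesInMean_truncE Q hQ hD himag hδ h𝔞 hχ⟩⟩
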